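/- Let $K_5\backslash e$ denote the complete graph on five vertices with one edge deleted. For a finite simple graph $G=(V,E)$ with positive real edge weights $w:E\to\mathbb{R}_{>0}$, MIN CUT is the problem of finding a set $U$ with $\emptyset\ne U\subsetneq V$ such that the cut $\delta(U)$, i.e. the set of edges with exactly one end in $U$, has the least total weight among all sets $U$ with $\emptyset\ne U\subsetneq V$. **Corollary 2.6.** MIN CUT can be solved in quadratic time on graphs without a $K_5\backslash e$ minor, without a maximum flow subroutine and with weights used only through additions and comparisons. Precisely: there are a single program $P$ and constants $C,k\in\mathbb{N}$ such that, for every $n\ge 2$, every simple graph $G$ on $n$ vertices that does not have $K_5\backslash e$ as a minor, and all positive real weights $w$ on the edges of $G$, the program $P$ on input $(G,w)$ halts after at most $C\,n^2$ steps and outputs a set $U$ that solves MIN CUT for $(G,w)$. Here programs run on a unit-cost random access machine with separate memories for words and for weights. Words are natural numbers of value at most $n^k$ (that is, of $O(\log n)$ bits); they can be copied, added, subtracted, multiplied, divided with rounding, compared, and used as addresses. Weights are real numbers; the only operations on them are reading the weight of an edge from the input, setting to $0$, copying, adding two weights, and comparing two weights. The input is given by random access to the adjacency matrix and the weight matrix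 of $G$, and to $n$. -/

import Mathlib

/-! ### Graph minors and cuts -/

/-- `H` is a minor of `G`: there are pairwise disjoint branch sets in `G`, one for each vertex of
`H`, each inducing a connected (in particular nonempty) subgraph, such that branch sets of adjacent
vertices of `H` are joined by an edge of `G`. -/
def IsGraphMinor {W V : Type*} (H : SimpleGraph W) (G : SimpleGraph V) : Prop :=
  ∃ B : W → Set V,
    (∀ a, (G.induce (B a)).Connected) ∧
    (∀ a b, a ≠ b → Disjoint (B a) (B b)) ∧
    ∀ a b, H.Adj a b → ∃ x ∈ B a, ∃ y ∈ B b, G.Adj x y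

/-- The complete graph on five vertices with one edge deleted. -/
def K5DeleteEdge : SimpleGraph (Fin 5) :=
  (⊤ : SimpleGraph (Fin 5)).deleteEdges {s(0, 1)}

/-- The cut `δ(U)`: the edges of `G` that link a vertex of `U` to a vertex outside `U`. -/
def edgeCut {V : Type*} (G : SimpleGraph V) (U : Set V) : Set (Sym2 V) :=
  {e | e ∈ G.edgeSet ∧ ∃ u ∈ U, ∃ v ∉ U, e = s(u, v)}

/-- The total weight of the edges of the cut `δ(U)`. -/
noncomputable def cutWeight {V : Type*} [Fintype V] [DecidableEq V] (G : SimpleGraph V)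
    (w : Sym2 V → ℝ) (U : Set V) : ℝ :=
  ∑ e : Sym2 V, (edgeCut G U).indicator w e

/-- `U` is a solution of MIN CUT for `(G, w)`: it is a nonempty proper set of vertices, and `δ(U)`
has the least weight among all cuts given by nonempty proper sets of vertices. -/
def IsMinCut {V : Type*} [Fintype V] [DecidableEq V] (G : SimpleGraph V)
    (w : Sym2 V → ℝ) (U : Set V) : Prop :=
  U.Nonempty ∧ U ≠ Set.univ ∧
    ∀ U' : Set V, U'.Nonempty → U' ≠ Set.univ → cutWeight G w U ≤ cutWeight G w U'

/-! ### The machine: a random access machine on words, with real weights that can be added and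
compared -/

namespace RAM

/-- A weighted graph on the vertices `0, …, n - 1`, the read-only input of the machine. Only the
values of `weight` on edges of the graph are visible to the machine. -/
structure Input where
  n : ℕ
  graph : SimpleGraph (Fin n)
  weight : Sym2 (Fin n) → ℝ

/-- The entry `(i, j)` of the adjacency matrix (false outside the range of the matrix). -/
def Input.Adj (I : Input) (i j : ℕ) : Prop :=
  ∃ (hi : i < I.n) (hj : j < I.n), I.graph.Adj ⟨i, hi⟩ ⟨j, hj⟩

open Classical in
/-- The entry `(i, j)` of the weight matrix: the weight of the edge `ij`, and `0` if there is no
such edge. -/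
noncomputable def Input.weightAt (I : Input) (i j : ℕ) : ℝ :=
  if h : I.Adj i j then I.weight s(⟨i, h.1⟩, ⟨j, h.2.1⟩) else 0

/-- The memory. Words (natural numbers) are kept in registers and in arrays, and weights (real
numbers) are kept in weight registers and in weight arrays; a program names its registers and
arrays explicitly, so that it uses finitely many of them, and it addresses the cells of an array
by the content of a word register. -/
structure State where
  reg : ℕ → ℕ
  arr : ℕ → ℕ → ℕ
  wreg : ℕ → ℝ
  warr : ℕ → ℕ → ℝ

namespace State

/-- Initially register `0` holds the number of vertices, and everything else is zero. -/
def init (n : ℕ) : State where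
  reg := Function.update (fun _ => 0) 0 n
  arr := fun _ _ => 0
  wreg := fun _ => 0
  warr := fun _ _ => 0

def setReg (s : State) (x v : ℕ) : State :=
  { s with reg := Function.update s.reg x v }

def setArr (s : State) (a i v : ℕ) : State :=
  { s with arr := Function.update s.arr a (Function.update (s.arr a) i v) }

def setWReg (s : State) (x : ℕ) (v : ℝ) : State :=
  { s with wreg := Function.update s.wreg x v }

def setWArr (s : State) (a i : ℕ) (v : ℝ) : State :=
  { s with warr := Function.update s.warr a (Function.update (s.warr a) i v) }

end State

/-- The arithmetic operations on words. -/
inductive Op where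
  | add
  | sub
  | mul
  | div

/-- Subtraction is truncated at `0`, division rounds down, and division by `0` gives `0`. -/
def Op.eval : Op → ℕ → ℕ → ℕ
  | .add, a, b => a + b
  | .sub, a, b => a - b
  | .mul, a, b => a * b
  | .div, a, b => a / b

/-- The tests. `lt x y` and `eq x y` compare two word registers, `adj x y` asks whether the two
vertices whose numbers are in the word registers `x` and `y` are adjacent, and `wle x y` compares
two weight registers. -/
inductive Test where
  | lt (x y : ℕ)
  | eq (x y : ℕ)
  | adj (x y : ℕ)
  | wle (x y : ℕ)

def Test.Holds (I : Input) (s : State) : Test → Prop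
  | .lt x y => s.reg x < s.reg y
  | .eq x y => s.reg x = s.reg y
  | .adj x y => I.Adj (s.reg x) (s.reg y)
  | .wle x y => s.wreg x ≤ s.wreg y

/-- Programs. The letters `x`, `y`, `z` are names of registers, and `a` is the name of an array.
The only operations on weights are reading the input, moving, adding and (in tests) comparing. -/
inductive Program where
  /-- do nothing -/
  | skip
  /-- put the constant `k` into register `x` -/
  | const (x k : ℕ)
  /-- copy register `y` to register `x` -/
  | copy (x y : ℕ)
  /-- put the result of the operation `o` on registers `y` and `z` into register `x` -/
  | arith (o : Op) (x y z : ℕ)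
  /-- copy to register `x` the cell of array `a` whose address is in register `y` -/
  | load (x a y : ℕ)
  /-- copy register `y` to the cell of array `a` whose address is in register `x` -/
  | store (a x y : ℕ)
  /-- put the weight of the edge between the vertices whose numbers are in the word registers `y`
  and `z` into weight register `x` -/
  | weight (x y z : ℕ)
  /-- put zero into weight register `x` -/
  | wzero (x : ℕ)
  /-- copy weight register `y` to weight register `x` -/
  | wcopy (x y : ℕ)
  /-- put the sum of the weight registers `y` and `z` into weight register `x` -/
  | wadd (x y z : ℕ)
  /-- copy to weight register `x` the cell of weight array `a` whose address is in the word
  register `y` -/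
  | wload (x a y : ℕ)
  /-- copy weight register `y` to the cell of weight array `a` whose address is in the word
  register `x` -/
  | wstore (a x y : ℕ)
  | seq (p q : Program)
  | ite (c : Test) (p q : Program)
  | loop (c : Test) (p : Program)

/-- `Run I B p s s' t`: on input `I`, on a machine whose words are the natural numbers up to `B`,
the program `p` started with memory `s` halts with memory `s'` after exactly `t` steps, where each
instruction and each evaluation of a test takes one step. A computation whose arithmetic leaves the
range of the words is stuck: it has no run. `loop c p` repeats `p` as long as the test `c` holds. -/
inductive Run (I : Input) (B : ℕ) : Program → State → State → ℕ → Prop where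
  | skip (s : State) : Run I B .skip s s 1
  | const (s : State) (x k : ℕ) (h : k ≤ B) : Run I B (.const x k) s (s.setReg x k) 1
  | copy (s : State) (x y : ℕ) : Run I B (.copy x y) s (s.setReg x (s.reg y)) 1
  | arith (s : State) (o : Op) (x y z : ℕ) (h : o.eval (s.reg y) (s.reg z) ≤ B) :
      Run I B (.arith o x y z) s (s.setReg x (o.eval (s.reg y) (s.reg z))) 1
  | load (s : State) (x a y : ℕ) :
      Run I B (.load x a y) s (s.setReg x (s.arr a (s.reg y))) 1
  | store (s : State) (a x y : ℕ) :
      Run I B (.store a x y) s (s.setArr a (s.reg x) (s.reg y)) 1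
  | weight (s : State) (x y z : ℕ) :
      Run I B (.weight x y z) s (s.setWReg x (I.weightAt (s.reg y) (s.reg z))) 1
  | wzero (s : State) (x : ℕ) : Run I B (.wzero x) s (s.setWReg x 0) 1
  | wcopy (s : State) (x y : ℕ) : Run I B (.wcopy x y) s (s.setWReg x (s.wreg y)) 1
  | wadd (s : State) (x y z : ℕ) :
      Run I B (.wadd x y z) s (s.setWReg x (s.wreg y + s.wreg z)) 1
  | wload (s : State) (x a y : ℕ) :
      Run I B (.wload x a y) s (s.setWReg x (s.warr a (s.reg y))) 1
  | wstore (s : State) (a x y : ℕ) :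
      Run I B (.wstore a x y) s (s.setWArr a (s.reg x) (s.wreg y)) 1
  | seq {p q : Program} {s s' s'' : State} {t t' : ℕ} (hp : Run I B p s s' t)
      (hq : Run I B q s' s'' t') : Run I B (.seq p q) s s'' (t + t')
  | ite_true {c : Test} {p q : Program} {s s' : State} {t : ℕ} (hc : c.Holds I s)
      (hp : Run I B p s s' t) : Run I B (.ite c p q) s s' (t + 1)
  | ite_false {c : Test} {p q : Program} {s s' : State} {t : ℕ} (hc : ¬ c.Holds I s)
      (hq : Run I B q s s' t) : Run I B (.ite c p q) s s' (t + 1)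
  | loop_true {c : Test} {p : Program} {s s' s'' : State} {t t' : ℕ} (hc : c.Holds I s)
      (hp : Run I B p s s' t) (hl : Run I B (.loop c p) s' s'' t') :
      Run I B (.loop c p) s s'' (t + t' + 1)
  | loop_false {c : Test} {p : Program} {s : State} (hc : ¬ c.Holds I s) :
      Run I B (.loop c p) s s 1

/-- The set of vertices that a computation outputs: those whose cell in array `0` holds `1`. -/
def State.output (s : State) (n : ℕ) : Set (Fin n) :=
  {v | s.arr 0 v = 1}

end RAM

/-- The program `p` solves MIN CUT on the positively weighted graph `(G, w)` within `T` steps, on a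
machine whose words are the natural numbers up to `B`. -/
def SolvesMinCut (p : RAM.Program) {n : ℕ} (G : SimpleGraph (Fin n)) (w : Sym2 (Fin n) → ℝ)
    (B T : ℕ) : Prop :=
  ∃ (s : RAM.State) (t : ℕ), RAM.Run ⟨n, G, w⟩ B p (RAM.State.init n) s t ∧ t ≤ T ∧
    IsMinCut G w (s.output n)

/-! ### Connected sets and minors -/

/-! Call two vertices `u`, `v` safe if in every cut separating them one of the two can change sides
without increasing the cut. Then a least cut can be sought among the two cuts `{u}`, `{v}` and the
cuts that keep `u` and `v` together, and the latter are the cuts of the graph with `u` merged into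
`v` (`IsWeight.le_cut_of_merge`). Hence it suffices to merge safe pairs until two vertices are left,
remembering the least single-vertex cut met on the way; no flow is needed. If this cut ever has
weight zero it is optimal, and otherwise all row sums are positive.

Safe pairs have two sources. If one edge at `u` carries at least half of the weight at `u`, its ends
are safe; this settles all vertices with one or two neighbours. If no vertex with at most three
neighbours is dominated in this way, then all degrees are at least three, and a cubic vertex with
two neighbours across a cut can be moved. So two adjacent cubic vertices with a common neighbour are
safe, and so are two cubic vertices with the same neighbours. The first merge is a contraction and
the second a deletion as far as the graph is concerned, so the excluded minor stays excluded.

That a pair of the second kind exists is the graph theory (`hasPairAvoiding_of_not_minor`). A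
3-connected graph with the minor excluded is a wheel, a prism or `K₃,₃`
(`NoTwoSep.isWheelPrismK33`): contract an edge so that 3-connectivity survives, apply induction, and
inspect all ways of splitting the contracted vertex again. In each of these graphs a suitable pair
avoids the ends of any given edge. If the graph has a separation by at most two vertices, pass to
one side with the separating vertices joined by an edge. This is again a minor, and a pair found
there away from that edge is a pair of the whole graph.

For the running time, each vertex carries a record of its degree and, if this is at most three, of
its neighbours. With records, one vertex is tested in constant time; for twins this works because
one of their common neighbours is cubic too, so its record lists them. The merged vertex `u` has at
most three neighbours, and only these and `v` need new records, which costs four row scans. Thus a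
round is linear, and there are fewer than `n` rounds. -/

namespace SimpleGraph

variable {V W : Type*}

/-- `S` is nonempty, and no nonempty proper subset of `S` is closed under adjacency within `S`. -/
def ConnOn (G : SimpleGraph V) (S : Set V) : Prop :=
  S.Nonempty ∧ ∀ C ⊆ S, C.Nonempty → (∀ c ∈ C, ∀ d ∈ S, G.Adj c d → d ∈ C) → S ⊆ C

/-- The vertices of `S` reachable from a fixed one form a closed set. The closure form is the
working notion of connectivity below, since it needs neither walks nor subtypes. -/
theorem ConnOn.connected {G : SimpleGraph V} {S : Set V} (h : G.ConnOn S) :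
    (G.induce S).Connected := by
  obtain ⟨⟨x, hx⟩, hS⟩ := h
  have key : ∀ y : S, (G.induce S).Reachable ⟨x, hx⟩ y := by
    intro y
    have := hS {v | ∃ hv : v ∈ S, (G.induce S).Reachable ⟨x, hx⟩ ⟨v, hv⟩}
      (fun v hv => hv.1) ⟨x, hx, Reachable.refl _⟩
      (fun c ⟨hc, hr⟩ d hd hcd => ⟨hd, hr.trans (Adj.reachable (by simpa using hcd))⟩) y.2
    exact this.2
  have : Nonempty S := ⟨⟨x, hx⟩⟩
  exact ⟨fun a b => (key a).symm.trans (key b)⟩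

theorem connOn_of_connected {G : SimpleGraph V} {S : Set V} (h : (G.induce S).Connected) :
    G.ConnOn S := by
  refine ⟨Set.nonempty_coe_sort.1 h.nonempty, ?_⟩
  rintro C hCS ⟨c, hc⟩ hcl d hd
  have := h.preconnected ⟨c, hCS hc⟩ ⟨d, hd⟩
  have key : ∀ a b : S, (G.induce S).Reachable a b → a.1 ∈ C → b.1 ∈ C := by
    rintro a b ⟨p⟩
    induction p with
    | nil => exact id
    | cons hadj _ ih => exact fun ha => ih (hcl _ ha _ (Subtype.coe_prop _) (by simpa using hadj))
  exact key _ _ this hc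

theorem connOn_singleton (G : SimpleGraph V) (a : V) : G.ConnOn {a} := by
  refine ⟨⟨a, rfl⟩, ?_⟩
  rintro C hC ⟨c, hc⟩ _ x rfl
  obtain rfl := hC hc
  exact hc

/-- Adding a vertex that has a neighbour in a connected set. -/
theorem ConnOn.insert {G : SimpleGraph V} {S : Set V} (h : G.ConnOn S) {a b : V} (hb : b ∈ S)
    (hab : G.Adj a b) : G.ConnOn (Insert.insert a S) := by
  by_cases haS : a ∈ S
  · rwa [Set.insert_eq_of_mem haS]
  refine ⟨⟨a, Or.inl rfl⟩, ?_⟩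
  rintro C hC ⟨c, hc⟩ hcl
  have hbC : b ∈ C := by
    by_cases ha : a ∈ C
    · exact hcl a ha b (Or.inr hb) hab
    · refine h.2 C ?_ ⟨c, hc⟩ (fun c hc d hd hcd => hcl c hc d (Or.inr hd) hcd) hb
      intro x hx
      rcases hC hx with rfl | h
      · exact absurd hx ha
      · exact h
  have haC : a ∈ C := hcl b hbC a (Or.inl rfl) hab.symm
  have hSC := h.2 (C ∩ S) Set.inter_subset_right ⟨b, hbC, hb⟩
    (fun c hc d hd hcd => ⟨hcl c hc.1 d (Or.inr hd) hcd, hd⟩)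
  rintro x (rfl | hx)
  · exact haC
  · exact (hSC hx).1

theorem connOn_pair {G : SimpleGraph V} {a b : V} (h : G.Adj a b) : G.ConnOn {a, b} :=
  (G.connOn_singleton b).insert rfl h

/-- Removing a vertex with at most one neighbour in a connected set. -/
theorem ConnOn.diff_pendant {G : SimpleGraph V} {S : Set V} (h : G.ConnOn S) {f g : V}
    (hfg : ∀ w ∈ S, G.Adj f w → w = g) (hne : ∃ z ∈ S, z ≠ f) : G.ConnOn (S \ {f}) := by
  obtain ⟨z, hz, hzf⟩ := hne
  refine ⟨⟨z, hz, hzf⟩, ?_⟩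
  rintro C hC hCn hcl
  -- A closed set containing `g` stays closed in `S` after adding `f`; one that misses `g` is
  -- already closed in `S`, as `f` has no other neighbour there.
  by_cases hg : g ∈ C
  · have := h.2 (Insert.insert f C ∩ S) Set.inter_subset_right
      (hCn.imp fun c hc => ⟨Or.inr hc, (hC hc).1⟩) ?_
    · rintro x ⟨hx, hxf⟩
      rcases (this hx).1 with rfl | h
      · exact absurd rfl hxf
      · exact h
    · rintro c ⟨rfl | hc, hcS⟩ d hd hcd
      · exact ⟨Or.inr (hfg d hd hcd ▸ hg), hd⟩
      · by_cases hdf : d = f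
        · exact ⟨Or.inl hdf, hd⟩
        · exact ⟨Or.inr (hcl c hc d ⟨hd, hdf⟩ hcd), hd⟩
  · refine Set.sdiff_subset.trans (h.2 C (hC.trans Set.sdiff_subset) hCn ?_)
    intro c hc d hd hcd
    by_cases hdf : d = f
    · subst hdf
      exact absurd (hfg c (hC hc).1 hcd.symm ▸ hc) hg
    · exact hcl c hc d ⟨hd, hdf⟩ hcd

end SimpleGraph

open SimpleGraph in
/-- The union of connected branch sets over a connected set is connected. -/
theorem connOn_biUnion {V W : Type*} {G : SimpleGraph V} {H : SimpleGraph W} {B : W → Set V}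
    (hB : ∀ a, G.ConnOn (B a)) (hadj : ∀ a b, H.Adj a b → ∃ x ∈ B a, ∃ y ∈ B b, G.Adj x y)
    {S : Set W} (hS : H.ConnOn S) : G.ConnOn (⋃ a ∈ S, B a) := by
  constructor
  · obtain ⟨a, ha⟩ := hS.1
    obtain ⟨x, hx⟩ := (hB a).1
    exact ⟨x, Set.mem_biUnion ha hx⟩
  rintro C hC ⟨c, hc⟩ hcl
  -- A closed set that meets a branch set contains it, so it induces a closed set of indices.
  have full : ∀ a ∈ S, ∀ x ∈ B a, x ∈ C → B a ⊆ C := by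
    intro a ha x hx hxC y hy
    exact ((hB a).2 (C ∩ B a) Set.inter_subset_right ⟨x, hxC, hx⟩
      (fun c hc d hd hcd => ⟨hcl c hc.1 d (Set.mem_biUnion ha hd) hcd, hd⟩) hy).1
  obtain ⟨a, ha, hca⟩ := Set.mem_iUnion₂.1 (hC hc)
  have := hS.2 {a | a ∈ S ∧ B a ⊆ C} (fun a h => h.1) ⟨a, ha, full a ha c hca hc⟩ (by
    rintro a ⟨ha, haC⟩ b hb hab
    obtain ⟨x, hx, y, hy, hxy⟩ := hadj a b hab
    exact ⟨hb, full b hb y hy (hcl x (haC hx) y (Set.mem_biUnion hb hy) hxy)⟩)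
  intro x hx
  obtain ⟨b, hb, hxb⟩ := Set.mem_iUnion₂.1 hx
  exact (this hb).2 hxb

/-- The composite branch sets are unions of inner branch sets over outer ones; `connOn_biUnion`
gives their connectivity. -/
theorem IsGraphMinor.trans {U W V : Type*} {K : SimpleGraph U} {H : SimpleGraph W}
    {G : SimpleGraph V} (h₁ : IsGraphMinor K H) (h₂ : IsGraphMinor H G) : IsGraphMinor K G := by
  obtain ⟨A, hA, hAd, hAa⟩ := h₁
  obtain ⟨B, hB, hBd, hBa⟩ := h₂
  refine ⟨fun u => ⋃ a ∈ A u, B a, fun u => ?_, ?_, ?_⟩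
  · exact (connOn_biUnion (fun a => SimpleGraph.connOn_of_connected (hB a)) hBa
      (SimpleGraph.connOn_of_connected (hA u))).connected
  · intro u v huv
    simp only [Set.disjoint_iUnion_left, Set.disjoint_iUnion_right]
    intro a ha b hb
    exact hBd b a fun h => Set.disjoint_left.1 (hAd u v huv) (h ▸ hb) ha
  · intro u v huv
    obtain ⟨a, ha, b, hb, hab⟩ := hAa u v huv
    obtain ⟨x, hx, y, hy, hxy⟩ := hBa a b hab
    exact ⟨x, Set.mem_biUnion ha hx, y, Set.mem_biUnion hb hy, hxy⟩

namespace SimpleGraph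

variable {V : Type*}

/-- There is an edge between `S` and `T`. -/
def Linked (G : SimpleGraph V) (S T : Set V) : Prop :=
  ∃ x ∈ S, ∃ y ∈ T, G.Adj x y

theorem Linked.symm {G : SimpleGraph V} {S T : Set V} (h : G.Linked S T) : G.Linked T S := by
  obtain ⟨x, hx, y, hy, h⟩ := h
  exact ⟨y, hy, x, hx, h.symm⟩

/-- Two sets `A`, `B` and three sets `C`, `D`, `E`, any two linked except perhaps `A` and `B`. -/
theorem k5DeleteEdge_minor {G : SimpleGraph V} (A B C D E : Set V)
    (hA : G.ConnOn A) (hB : G.ConnOn B) (hC : G.ConnOn C) (hD : G.ConnOn D) (hE : G.ConnOn E)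
    (dAB : Disjoint A B) (dAC : Disjoint A C) (dAD : Disjoint A D) (dAE : Disjoint A E)
    (dBC : Disjoint B C) (dBD : Disjoint B D) (dBE : Disjoint B E)
    (dCD : Disjoint C D) (dCE : Disjoint C E) (dDE : Disjoint D E)
    (lAC : G.Linked A C) (lAD : G.Linked A D) (lAE : G.Linked A E)
    (lBC : G.Linked B C) (lBD : G.Linked B D) (lBE : G.Linked B E)
    (lCD : G.Linked C D) (lCE : G.Linked C E) (lDE : G.Linked D E) :
    IsGraphMinor K5DeleteEdge G := by
  refine ⟨![A, B, C, D, E], ?_, ?_, ?_⟩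
  · intro a
    fin_cases a
    exacts [hA.connected, hB.connected, hC.connected, hD.connected, hE.connected]
  · intro a b hab
    fin_cases a <;> fin_cases b <;>
      first | exact absurd rfl hab | assumption | exact Disjoint.symm ‹_›
  · intro a b hab
    fin_cases a <;> fin_cases b <;>
      first | exact absurd rfl hab.1 | assumption | exact Linked.symm ‹_› |
        (exfalso; revert hab; simp [K5DeleteEdge])

theorem Linked.of_adj {G : SimpleGraph V} {S T : Set V} {x y : V} (h : G.Adj x y) (hx : x ∈ S)
    (hy : y ∈ T) : G.Linked S T := ⟨x, hx, y, hy, h⟩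

end SimpleGraph

/-! ### Three-connected graphs and contractible edges -/

namespace SimpleGraph

variable {V : Type*}

/-- `C` is a nonempty set all of whose neighbours outside `C` are `x`, `y` or `z`, and these
vertices and another one are outside `C`. -/
structure IsSep (G : SimpleGraph V) (x y z : V) (C : Set V) : Prop where
  nonempty : C.Nonempty
  hx : x ∉ C
  hy : y ∉ C
  hz : z ∉ C
  closed : ∀ c ∈ C, ∀ d ∉ C, G.Adj c d → d = x ∨ d = y ∨ d = z
  other : ∃ w, w ∉ C ∧ w ≠ x ∧ w ≠ y ∧ w ≠ z

/-- One of the two sides of a separation avoids a given edge or vertex. -/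
theorem IsSep.exists_avoiding {G : SimpleGraph V} {a b c x y : V} {D : Set V}
    (hD : G.IsSep a b c D) (hxy : x = y ∨ G.Adj x y) :
    ∃ D, G.IsSep a b c D ∧ x ∉ D ∧ y ∉ D := by
  by_cases hxyD : x ∉ D ∧ y ∉ D
  · exact ⟨D, hD, hxyD⟩
  -- Take the opposite side: an end of the edge lies in `D`, so the other end is in `D` or is a
  -- separating vertex.
  refine ⟨{u | u ∉ D ∧ u ≠ a ∧ u ≠ b ∧ u ≠ c}, ⟨?_, ?_, ?_, ?_, ?_, ?_⟩, ?_, ?_⟩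
  · obtain ⟨u, hu⟩ := hD.other
    exact ⟨u, hu⟩
  · simp
  · simp
  · simp
  · rintro e ⟨heD, he⟩ d hd hed
    simp only [Set.mem_ofPred_eq, not_and_or, not_not] at hd
    rcases hd with hd | hd
    · have := hD.closed d hd e heD hed.symm
      tauto
    · exact hd
  · obtain ⟨u, hu⟩ := hD.nonempty
    exact ⟨u, fun h => h.1 hu, fun e => hD.hx (e ▸ hu), fun e => hD.hy (e ▸ hu),
      fun e => hD.hz (e ▸ hu)⟩
  · rintro ⟨hxD, hx⟩
    have hyD : y ∈ D := by tauto
    rcases hxy with rfl | hxy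
    · exact hxD hyD
    have := hD.closed y hyD x hxD hxy.symm
    tauto
  · rintro ⟨hyD, hy⟩
    have hxD : x ∈ D := by tauto
    rcases hxy with rfl | hxy
    · exact hyD hxD
    have := hD.closed x hxD y hyD hxy
    tauto

/-- No two vertices separate the graph. -/
def NoTwoSep (G : SimpleGraph V) : Prop :=
  ∀ x y C, ¬ G.IsSep x y y C

/-- The form in which 3-connectivity is applied. Separating vertices may coincide, so the case `x =
y` excludes cut vertices as well. -/
theorem NoTwoSep.all {G : SimpleGraph V} (h : G.NoTwoSep) {x y : V} {C : Set V} (hC : C.Nonempty)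
    (hx : x ∉ C) (hy : y ∉ C) (hcl : ∀ c ∈ C, ∀ d ∉ C, G.Adj c d → d = x ∨ d = y) (w : V) :
    w ∈ C ∨ w = x ∨ w = y := by
  by_contra! hw
  exact h x y C ⟨hC, hx, hy, hy, fun c hc d hd hcd => by have := hcl c hc d hd hcd; tauto,
    w, hw.1, hw.2.1, hw.2.2, hw.2.2⟩

/-- The vertex `v` has at least three neighbours. -/
def ThreeLeDegree (G : SimpleGraph V) (v : V) : Prop :=
  ∀ s t, ∃ w, G.Adj v w ∧ w ≠ s ∧ w ≠ t

/-- Two vertices containing all neighbours of `v` would separate `v` from a fourth vertex. -/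
theorem NoTwoSep.threeLeDegree [Fintype V] {G : SimpleGraph V} (h : G.NoTwoSep)
    (h4 : 4 ≤ Fintype.card V) (v : V) : G.ThreeLeDegree v := by
  classical
  have big : ∀ s t : V, ∃ w, w ≠ v ∧ w ≠ s ∧ w ≠ t := by
    intro s t
    have h1 : ({v, s, t} : Finset V).card ≤ 3 := Finset.card_le_three
    obtain ⟨w, hw⟩ : ∃ w, w ∉ ({v, s, t} : Finset V) := by
      by_contra! hall
      have := Finset.card_le_card (fun x _ => hall x : (Finset.univ : Finset V) ⊆ {v, s, t})
      rw [Finset.card_univ] at this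
      omega
    exact ⟨w, by simpa using hw⟩
  have main : ∀ s t : V, s ≠ v → t ≠ v → ∃ w, G.Adj v w ∧ w ≠ s ∧ w ≠ t := by
    intro s t hs ht
    by_contra! hno
    obtain ⟨w, hwv, hws, hwt⟩ := big s t
    have := h.all (x := s) (y := t) (C := {v}) ⟨v, rfl⟩ hs ht (by
      rintro c rfl d _ hcd
      by_cases hd : d = s
      · exact Or.inl hd
      · exact Or.inr (hno d hcd hd)) w
    simp_all
  intro s t
  -- A forbidden vertex equal to `v` forbids nothing, so another vertex can take its place.
  obtain ⟨a, ha, _⟩ := big v v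
  by_cases hs : s = v
  · by_cases ht : t = v
    · obtain ⟨w, hw, _⟩ := main a a ha ha
      exact ⟨w, hw, hs ▸ hw.ne', ht ▸ hw.ne'⟩
    · obtain ⟨w, hw, h1, _⟩ := main t t ht ht
      exact ⟨w, hw, hs ▸ hw.ne', h1⟩
  · by_cases ht : t = v
    · obtain ⟨w, hw, h1, _⟩ := main s s hs hs
      exact ⟨w, hw, h1, ht ▸ hw.ne'⟩
    · exact main s t hs ht

/-- The contraction of the edge `xy` to the vertex `x`. -/
def contractEdge (G : SimpleGraph V) (x y : V) : SimpleGraph {v : V // v ≠ y} where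
  Adj a b := a ≠ b ∧ (G.Adj a b ∨ (a.1 = x ∧ G.Adj y b) ∨ (b.1 = x ∧ G.Adj y a))
  symm := ⟨fun a b h => ⟨h.1.symm, by
    rcases h.2 with h | h | h
    · exact Or.inl h.symm
    · exact Or.inr (Or.inr h)
    · exact Or.inr (Or.inl h)⟩⟩
  loopless := ⟨fun a h => h.1 rfl⟩

theorem contractEdge_minor {G : SimpleGraph V} {x y : V} (hxy : G.Adj x y) :
    IsGraphMinor (G.contractEdge x y) G := by
  refine ⟨fun a => {v | v = a.1 ∨ (a.1 = x ∧ v = y)}, ?_, ?_, ?_⟩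
  · intro a
    by_cases ha : a.1 = x
    · have : {v | v = a.1 ∨ (a.1 = x ∧ v = y)} = ({x, y} : Set V) := by
        ext v; simp [ha]
      beta_reduce
      rw [this]
      exact (connOn_pair hxy).connected
    · have : {v | v = a.1 ∨ (a.1 = x ∧ v = y)} = ({a.1} : Set V) := by
        ext v; simp [ha]
      beta_reduce
      rw [this]
      exact (G.connOn_singleton _).connected
  · intro a b hab
    rw [Set.disjoint_left]
    rintro v (rfl | ⟨h1, rfl⟩) (h | ⟨h2, h3⟩)
    · exact hab (Subtype.ext h)
    · exact a.2 h3
    · exact b.2 h.symm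
    · exact hab (Subtype.ext (h1.trans h2.symm))
  · rintro a b ⟨_, h | ⟨ha, h⟩ | ⟨hb, h⟩⟩
    · exact ⟨a, Or.inl rfl, b, Or.inl rfl, h⟩
    · exact ⟨y, Or.inr ⟨ha, rfl⟩, b, Or.inl rfl, h⟩
    · exact ⟨a, Or.inl rfl, y, Or.inr ⟨hb, rfl⟩, h.symm⟩

theorem contractEdge_adj_of_ne {G : SimpleGraph V} {x y a b : V} (ha : a ≠ y) (hb : b ≠ y)
    (hax : a ≠ x) (hbx : b ≠ x) :
    (G.contractEdge x y).Adj ⟨a, ha⟩ ⟨b, hb⟩ ↔ G.Adj a b := by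
  simp only [contractEdge, ne_eq, Subtype.mk.injEq, hax, hbx, false_and, or_false,
    and_iff_right_iff_imp]
  exact fun h => h.ne

theorem contractEdge_adj_left {G : SimpleGraph V} {x y b : V} (hx : x ≠ y) (hb : b ≠ y)
    (hbx : b ≠ x) :
    (G.contractEdge x y).Adj ⟨x, hx⟩ ⟨b, hb⟩ ↔ G.Adj x b ∨ G.Adj y b := by
  simp [contractEdge, hbx, Ne.symm hbx]

/-- If contracting `xy` creates a separating pair, then `x`, `y` and a third vertex separate. -/
theorem exists_isSep_of_contractEdge {G : SimpleGraph V} (h : G.NoTwoSep) {x y : V}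
    (hxy : G.Adj x y) (hc : ¬ (G.contractEdge x y).NoTwoSep) : ∃ z C, G.IsSep x y z C := by
  simp only [NoTwoSep, not_forall, not_not] at hc
  obtain ⟨⟨a, ha⟩, ⟨b, hb⟩, C, hC⟩ := hc
  have hxney := hxy.ne
  obtain ⟨⟨w, hwy⟩, hwC, hwa, hwb, -⟩ := hC.other
  have hwa' : w ≠ a := fun e => hwa (Subtype.ext e)
  have hwb' : w ≠ b := fun e => hwb (Subtype.ext e)
  obtain ⟨⟨c₀, hc₀⟩, hc₀C⟩ := hC.nonempty
  have hcl : ∀ c (hc : c ≠ y), (⟨c, hc⟩ : {v // v ≠ y}) ∈ C → ∀ d (hd : d ≠ y),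
      (⟨d, hd⟩ : {v // v ≠ y}) ∉ C → (G.contractEdge x y).Adj ⟨c, hc⟩ ⟨d, hd⟩ → d = a ∨ d = b := by
    intro c hc hcC d hd hdC hcd
    have := hC.closed _ hcC _ hdC hcd
    simpa using this
  -- If the contracted vertex belongs to the separating pair, then `x`, `y` and the other member of
  -- the pair separate `G`.
  by_cases hx : x = a ∨ x = b
  · have key : ∀ z, z ≠ y → (∀ d, d = a ∨ d = b → d = x ∨ d = z) → (∀ hz, (⟨z, hz⟩ : {v // v ≠ y}) ∉ C) →
        w ≠ z → ∃ z C, G.IsSep x y z C := by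
      intro z hzy hab hz hwz
      refine ⟨z, {v | ∃ hv : v ≠ y, ⟨v, hv⟩ ∈ C}, ⟨c₀, hc₀, hc₀C⟩, ?_, fun h => h.1 rfl,
        fun h => hz h.1 h.2, ?_, w, fun h => hwC h.2, ?_, hwy, hwz⟩
      · rintro ⟨h1, h2⟩
        rcases hx with rfl | rfl
        · exact hC.hx h2
        · exact hC.hy h2
      · rintro c ⟨hcy, hcC⟩ d hd hcd
        by_cases hdy : d = y
        · exact Or.inr (Or.inl hdy)
        · have := hab d (hcl c hcy hcC d hdy (fun h => hd ⟨hdy, h⟩)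
            ⟨fun e => hcd.ne (Subtype.ext_iff.1 e), Or.inl hcd⟩)
          tauto
      · rcases hx with rfl | rfl <;> assumption
    rcases hx with rfl | rfl
    · exact key b hb (fun d h => h) (fun _ => hC.hy) hwb'
    · exact key a ha (fun d h => h.symm) (fun _ => hC.hx) hwa'
  -- If the pair avoids the contracted vertex, it already separates `G`: put `y` on the side of `x`.
  · push Not at hx
    exfalso
    by_cases hxC : (⟨x, hxney⟩ : {v // v ≠ y}) ∈ C
    · have := h.all (x := a) (y := b) (C := {v | v = y ∨ ∃ hv : v ≠ y, ⟨v, hv⟩ ∈ C}) ⟨y, Or.inl rfl⟩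
        (by rintro (h | ⟨_, h⟩); exacts [ha h, hC.hx h])
        (by rintro (h | ⟨_, h⟩); exacts [hb h, hC.hy h]) ?_ w
      · rcases this with (h | ⟨_, h⟩) | h | h
        exacts [hwy h, hwC h, hwa' h, hwb' h]
      · rintro c hc d hd hcd
        simp only [Set.mem_ofPred_eq, not_or, not_exists] at hd
        rcases hc with rfl | ⟨hcy, hcC⟩
        · have hdx : d ≠ x := by rintro rfl; exact hd.2 hd.1 hxC
          exact hcl x hxney hxC d hd.1 (hd.2 hd.1)
            ((contractEdge_adj_left hxney hd.1 hdx).2 (Or.inr hcd))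
        · exact hcl c hcy hcC d hd.1 (hd.2 hd.1)
            ⟨fun e => hcd.ne (Subtype.ext_iff.1 e), Or.inl hcd⟩
    · have := h.all (x := a) (y := b) (C := {v | ∃ hv : v ≠ y, ⟨v, hv⟩ ∈ C}) ⟨c₀, hc₀, hc₀C⟩
        (fun h => hC.hx h.2) (fun h => hC.hy h.2) ?_ w
      · rcases this with ⟨_, h⟩ | h | h
        exacts [hwC h, hwa' h, hwb' h]
      · rintro c ⟨hcy, hcC⟩ d hd hcd
        have hcx : c ≠ x := by rintro rfl; exact hxC hcC
        by_cases hdy : d = y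
        · subst hdy
          have := hcl c hcy hcC x hxney hxC
            ((contractEdge_adj_left hxney hcy hcx).2 (Or.inr hcd.symm)).symm
          tauto
        · exact hcl c hcy hcC d hdy (fun h => hd ⟨hdy, h⟩)
            ⟨fun e => hcd.ne (Subtype.ext_iff.1 e), Or.inl hcd⟩

/-- A 3-connected graph on at least five vertices has an edge whose contraction leaves it
3-connected. -/
theorem NoTwoSep.exists_contractible [Fintype V] {G : SimpleGraph V} (h : G.NoTwoSep)
    (h4 : 4 ≤ Fintype.card V) : ∃ x y, G.Adj x y ∧ (G.contractEdge x y).NoTwoSep := by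
  classical
  by_contra! hno
  have hsep : ∀ x y, G.Adj x y → ∃ z C, G.IsSep x y z C := fun x y hxy =>
    exists_isSep_of_contractEdge h hxy (hno x y hxy)
  -- Descent on the size of a side `C` of a separation containing both ends of an edge `xy`. The
  -- third vertex `z` has a neighbour `v` in `C`, and the edge `zv` lies in another separation, with
  -- a side `D` avoiding `x` and `y`. Then `D ∩ C` is a side for the edge `zv`, and it is smaller
  -- than `C` because it lacks `v`.
  have hmin : ∀ k, ∀ x y z C, G.Adj x y → G.IsSep x y z C → C.ncard = k → False := by
    intro k
    induction k using Nat.strong_induction_on with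
    | _ k ih =>
      rintro x y z C hxy hC rfl
      obtain ⟨v, hvC, hzv⟩ : ∃ v ∈ C, G.Adj z v := by
        by_contra! hz
        refine h x y C ⟨hC.nonempty, hC.hx, hC.hy, hC.hy, ?_, ?_⟩
        · intro c hc d hd hcd
          rcases hC.closed c hc d hd hcd with h | h | rfl
          · exact Or.inl h
          · exact Or.inr (Or.inl h)
          · exact absurd hcd.symm (hz c hc)
        · obtain ⟨w, h1, h2, h3, _⟩ := hC.other
          exact ⟨w, h1, h2, h3, h3⟩
      obtain ⟨w, D, hD, hDx, hDy⟩ : ∃ w D, G.IsSep z v w D ∧ x ∉ D ∧ y ∉ D := by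
        obtain ⟨w, D, hD⟩ := hsep z v hzv
        exact ⟨w, hD.exists_avoiding (Or.inr hxy)⟩
      obtain ⟨d, hdD, hdv⟩ : ∃ d ∈ D, G.Adj v d := by
        by_contra! hv
        refine h z w D ⟨hD.nonempty, hD.hx, hD.hz, hD.hz, ?_, ?_⟩
        · intro c hc d hd hcd
          rcases hD.closed c hc d hd hcd with h | rfl | h
          · exact Or.inl h
          · exact absurd hcd.symm (hv c hc)
          · exact Or.inr (Or.inl h)
        · obtain ⟨w, h1, h2, h3, h4⟩ := hD.other
          exact ⟨w, h1, h2, h4, h4⟩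
      have hDxyz : ∀ u ∈ D, u ≠ x ∧ u ≠ y ∧ u ≠ z := fun u hu =>
        ⟨fun e => hDx (e ▸ hu), fun e => hDy (e ▸ hu), fun e => hD.hx (e ▸ hu)⟩
      -- Outside `C` the vertex `v` has only neighbours among `x`, `y`, `z`, all avoided by `D`. So
      -- `D ∩ C` is nonempty.
      have hdC : d ∈ C := by
        by_contra hdC
        have := hC.closed v hvC d hdC hdv
        have := hDxyz d hdD
        tauto
      refine ih (D ∩ C).ncard ?_ z v w (D ∩ C) hzv ⟨⟨d, hdD, hdC⟩, fun h => hD.hx h.1,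
        fun h => hD.hy h.1, fun h => hD.hz h.1, ?_, ?_⟩ rfl
      · refine Set.ncard_lt_ncard ⟨Set.inter_subset_right, fun hsub => ?_⟩ (Set.toFinite C)
        exact hD.hy (hsub hvC).1
      · rintro c ⟨hcD, hcC⟩ e he hce
        by_cases heD : e ∈ D
        · have heC : e ∉ C := fun h => he ⟨heD, h⟩
          have := hC.closed c hcC e heC hce
          have := hDxyz e heD
          tauto
        · exact hD.closed c hcD e heD hce
      · obtain ⟨u, hu, h1⟩ := hD.other
        exact ⟨u, fun h => hu h.1, h1⟩
  have : Nonempty V := Fintype.card_pos_iff.1 (by omega)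
  obtain ⟨v⟩ := this
  obtain ⟨w, hvw, _⟩ := h.threeLeDegree h4 v v v
  obtain ⟨z, C, hC⟩ := hsep v w hvw
  exact hmin _ v w z C hvw hC rfl

end SimpleGraph

/-! ### Three-connected graphs without a minor `K₅` minus an edge -/

namespace SimpleGraph

variable {V : Type*}

/-- The vertex `v` has exactly the three neighbours `a`, `b`, `c`. -/
def Nbr3 (G : SimpleGraph V) (v a b c : V) : Prop :=
  a ≠ b ∧ a ≠ c ∧ b ≠ c ∧ ∀ w, G.Adj v w ↔ w = a ∨ w = b ∨ w = c

/-- The hub `h` is adjacent to all other vertices, and these have degree three. -/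
def IsWheel (G : SimpleGraph V) (h : V) : Prop :=
  ∀ v, v ≠ h → ∃ a b, G.Nbr3 v h a b

/-- The neighbours are listed cyclically, so that the symmetries of the prism merely permute the
fields. -/
structure IsPrism (G : SimpleGraph V) (a₁ a₂ a₃ b₁ b₂ b₃ : V) : Prop where
  ha₁ : G.Nbr3 a₁ a₂ a₃ b₁
  ha₂ : G.Nbr3 a₂ a₃ a₁ b₂
  ha₃ : G.Nbr3 a₃ a₁ a₂ b₃
  hb₁ : G.Nbr3 b₁ b₂ b₃ a₁
  hb₂ : G.Nbr3 b₂ b₃ b₁ a₂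
  hb₃ : G.Nbr3 b₃ b₁ b₂ a₃
  all : ∀ v, v = a₁ ∨ v = a₂ ∨ v = a₃ ∨ v = b₁ ∨ v = b₂ ∨ v = b₃

structure IsK33 (G : SimpleGraph V) (a₁ a₂ a₃ b₁ b₂ b₃ : V) : Prop where
  ha₁ : G.Nbr3 a₁ b₁ b₂ b₃
  ha₂ : G.Nbr3 a₂ b₁ b₂ b₃
  ha₃ : G.Nbr3 a₃ b₁ b₂ b₃
  hb₁ : G.Nbr3 b₁ a₁ a₂ a₃
  hb₂ : G.Nbr3 b₂ a₁ a₂ a₃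
  hb₃ : G.Nbr3 b₃ a₁ a₂ a₃
  all : ∀ v, v = a₁ ∨ v = a₂ ∨ v = a₃ ∨ v = b₁ ∨ v = b₂ ∨ v = b₃

theorem IsPrism.rotate {G : SimpleGraph V} {a₁ a₂ a₃ b₁ b₂ b₃ : V}
    (h : G.IsPrism a₁ a₂ a₃ b₁ b₂ b₃) : G.IsPrism a₂ a₃ a₁ b₂ b₃ b₁ :=
  ⟨h.ha₂, h.ha₃, h.ha₁, h.hb₂, h.hb₃, h.hb₁, fun v => by have := h.all v; tauto⟩

theorem IsPrism.swap {G : SimpleGraph V} {a₁ a₂ a₃ b₁ b₂ b₃ : V}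
    (h : G.IsPrism a₁ a₂ a₃ b₁ b₂ b₃) : G.IsPrism b₁ b₂ b₃ a₁ a₂ a₃ :=
  ⟨h.hb₁, h.hb₂, h.hb₃, h.ha₁, h.ha₂, h.ha₃, fun v => by have := h.all v; tauto⟩

theorem Nbr3.rotate {G : SimpleGraph V} {v a b c : V} (h : G.Nbr3 v a b c) : G.Nbr3 v b c a :=
  ⟨h.2.2.1, h.1.symm, h.2.1.symm, fun w => by have := h.2.2.2 w; tauto⟩

theorem Nbr3.swap {G : SimpleGraph V} {v a b c : V} (h : G.Nbr3 v a b c) : G.Nbr3 v b a c :=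
  ⟨h.1.symm, h.2.2.1, h.2.1, fun w => by have := h.2.2.2 w; tauto⟩

theorem IsK33.rotate {G : SimpleGraph V} {a₁ a₂ a₃ b₁ b₂ b₃ : V}
    (h : G.IsK33 a₁ a₂ a₃ b₁ b₂ b₃) : G.IsK33 a₂ a₃ a₁ b₁ b₂ b₃ :=
  ⟨h.ha₂, h.ha₃, h.ha₁, h.hb₁.rotate, h.hb₂.rotate, h.hb₃.rotate,
    fun v => by have := h.all v; tauto⟩

theorem IsK33.swap {G : SimpleGraph V} {a₁ a₂ a₃ b₁ b₂ b₃ : V}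
    (h : G.IsK33 a₁ a₂ a₃ b₁ b₂ b₃) : G.IsK33 b₁ b₂ b₃ a₁ a₂ a₃ :=
  ⟨h.hb₁, h.hb₂, h.hb₃, h.ha₁, h.ha₂, h.ha₃, fun v => by have := h.all v; tauto⟩

/-- Any vertex of a prism can be taken as the first one. -/
theorem IsPrism.exists_first {G : SimpleGraph V} {a₁ a₂ a₃ b₁ b₂ b₃ : V}
    (h : G.IsPrism a₁ a₂ a₃ b₁ b₂ b₃) (v : V) : ∃ c₂ c₃ d₁ d₂ d₃, G.IsPrism v c₂ c₃ d₁ d₂ d₃ := by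
  rcases h.all v with rfl | rfl | rfl | rfl | rfl | rfl
  exacts [⟨_, _, _, _, _, h⟩, ⟨_, _, _, _, _, h.rotate⟩, ⟨_, _, _, _, _, h.rotate.rotate⟩,
    ⟨_, _, _, _, _, h.swap⟩, ⟨_, _, _, _, _, h.rotate.swap⟩, ⟨_, _, _, _, _, h.rotate.rotate.swap⟩]

/-- Any vertex of a `K₃,₃` can be taken as the first one. -/
theorem IsK33.exists_first {G : SimpleGraph V} {a₁ a₂ a₃ b₁ b₂ b₃ : V}
    (h : G.IsK33 a₁ a₂ a₃ b₁ b₂ b₃) (v : V) : ∃ c₂ c₃ d₁ d₂ d₃, G.IsK33 v c₂ c₃ d₁ d₂ d₃ := by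
  rcases h.all v with rfl | rfl | rfl | rfl | rfl | rfl
  exacts [⟨_, _, _, _, _, h⟩, ⟨_, _, _, _, _, h.rotate⟩, ⟨_, _, _, _, _, h.rotate.rotate⟩,
    ⟨_, _, _, _, _, h.swap⟩, ⟨_, _, _, _, _, h.swap.rotate⟩, ⟨_, _, _, _, _, h.swap.rotate.rotate⟩]

theorem ConnOn.exists_adj {G : SimpleGraph V} {S : Set V} (h : G.ConnOn S) {f z : V} (hf : f ∈ S)
    (hz : z ∈ S) (hzf : z ≠ f) : ∃ g ∈ S, G.Adj f g := by
  by_contra! hno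
  have := h.2 {f} (by simpa using hf) ⟨f, rfl⟩ (by
    rintro c rfl d hd hcd
    exact absurd hcd (hno d hd)) hz
  exact hzf this

/-- The branch sets are `{y}`, `{f}`, `{x}`, `S` and `T`; the pair `y`, `f` takes the place of the
deleted edge. -/
theorem k5DeleteEdge_minor_of_three_sets {G : SimpleGraph V} {x y : V} {S T : Set V} {f : V}
    (hxy : G.Adj x y) (hS : G.ConnOn S) (hT : G.ConnOn T)
    (hxS : x ∉ S) (hyS : y ∉ S) (hxT : x ∉ T) (hyT : y ∉ T) (hST : Disjoint S T)
    (hfS : f ∉ S) (hfT : f ∉ T) (hfy : f ≠ y) (hxf : G.Adj x f)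
    (lxS : ∃ s ∈ S, G.Adj x s) (lyS : ∃ s ∈ S, G.Adj y s)
    (lxT : ∃ s ∈ T, G.Adj x s) (lyT : ∃ s ∈ T, G.Adj y s)
    (lfS : ∃ s ∈ S, G.Adj f s) (lfT : ∃ s ∈ T, G.Adj f s) (lST : G.Linked S T) :
    IsGraphMinor K5DeleteEdge G := by
  have link : ∀ {v : V} {S : Set V}, (∃ s ∈ S, G.Adj v s) → G.Linked {v} S := by
    rintro v S ⟨s, hs, h⟩
    exact ⟨v, rfl, s, hs, h⟩
  refine k5DeleteEdge_minor {y} {f} {x} S T (G.connOn_singleton _) (G.connOn_singleton _)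
    (G.connOn_singleton _) hS hT ?_ ?_ ?_ ?_ ?_ ?_ ?_ ?_ ?_ hST (link ⟨x, rfl, hxy.symm⟩) (link lyS)
    (link lyT) (link ⟨x, rfl, hxf.symm⟩) (link lfS) (link lfT) (link lxS) (link lxT) lST
  all_goals simp [*, hxy.ne', hxf.ne', Ne.symm hfy]

/-- A connected set `S` and a disjoint path with ends `f` and `l` that continue in `S`, such that
`x` and `y` have neighbours in `S` and on the path, and together are adjacent to the whole path. -/
theorem k5DeleteEdge_minor_of_path {G : SimpleGraph V} {x y : V} {S P : Set V} {f l z : V}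
    (hxy : G.Adj x y) (hS : G.ConnOn S) (hP : G.ConnOn P)
    (hxS : x ∉ S) (hyS : y ∉ S) (hxP : x ∉ P) (hyP : y ∉ P) (hSP : Disjoint S P)
    (hf : f ∈ P) (hl : l ∈ P) (hz : z ∈ P) (hfl : f ≠ l) (hzf : z ≠ f) (hzl : z ≠ l)
    (lfS : ∃ s ∈ S, G.Adj f s) (llS : ∃ s ∈ S, G.Adj l s)
    (pf : ∃ g, ∀ w ∈ P, G.Adj f w → w = g) (pl : ∃ g, ∀ w ∈ P, G.Adj l w → w = g)
    (lxS : ∃ s ∈ S, G.Adj x s) (lyS : ∃ s ∈ S, G.Adj y s)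
    (lxP : ∃ s ∈ P, G.Adj x s) (lyP : ∃ s ∈ P, G.Adj y s)
    (hall : ∀ p ∈ P, G.Adj x p ∨ G.Adj y p) : IsGraphMinor K5DeleteEdge G := by
  -- Cut off the end `f` of the path: the rest is connected and still linked to `S` through `l`.
  -- This works if `x` and `y` both keep a neighbour on the rest.
  have core : ∀ f l, f ∈ P → l ∈ P → f ≠ l → (∃ s ∈ S, G.Adj f s) → (∃ s ∈ S, G.Adj l s) →
      (∃ g, ∀ w ∈ P, G.Adj f w → w = g) → (∃ p ∈ P, p ≠ f ∧ G.Adj x p) →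
      (∃ p ∈ P, p ≠ f ∧ G.Adj y p) → IsGraphMinor K5DeleteEdge G := by
    rintro f l hf hl hfl lfS llS ⟨g, hg⟩ ⟨p, hp, hpf, hxp⟩ ⟨q, hq, hqf, hyq⟩
    have hT : G.ConnOn (P \ {f}) := hP.diff_pendant hg ⟨l, hl, hfl.symm⟩
    have hST : Disjoint S (P \ {f}) := hSP.mono_right Set.sdiff_subset
    have hfS : f ∉ S := fun h => Set.disjoint_left.1 hSP h hf
    have hfT : f ∉ P \ {f} := fun h => h.2 rfl
    have lfT : ∃ s ∈ P \ {f}, G.Adj f s := by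
      obtain ⟨s, hs, hfs⟩ := hP.exists_adj hf hl hfl.symm
      exact ⟨s, ⟨hs, hfs.ne'⟩, hfs⟩
    have lST : G.Linked S (P \ {f}) := by
      obtain ⟨s, hs, hls⟩ := llS
      exact ⟨s, hs, l, ⟨hl, hfl.symm⟩, hls.symm⟩
    have hxT : x ∉ P \ {f} := fun h => hxP h.1
    have hyT : y ∉ P \ {f} := fun h => hyP h.1
    rcases hall f hf with h | h
    · exact k5DeleteEdge_minor_of_three_sets hxy hS hT hxS hyS hxT hyT hST hfS hfT
        (fun e => hyP (e ▸ hf)) h lxS lyS ⟨p, ⟨hp, hpf⟩, hxp⟩ ⟨q, ⟨hq, hqf⟩, hyq⟩ lfS lfT lST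
    · exact k5DeleteEdge_minor_of_three_sets hxy.symm hS hT hyS hxS hyT hxT hST hfS hfT
        (fun e => hxP (e ▸ hf)) h lyS lxS ⟨q, ⟨hq, hqf⟩, hyq⟩ ⟨p, ⟨hp, hpf⟩, hxp⟩ lfS lfT lST
  obtain ⟨p, hp, hxp⟩ := lxP
  obtain ⟨q, hq, hyq⟩ := lyP
  have c1 := core f l hf hl hfl lfS llS pf
  have c2 := core l f hl hf hfl.symm llS lfS pl
  -- One of `x`, `y` sees the inner vertex `z`, which survives either cut. The end to cut off is
  -- chosen so that the other one keeps its neighbour.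
  rcases hall z hz with h | h
  · by_cases hqf : q = f
    · exact c2 ⟨z, hz, hzl, h⟩ ⟨q, hq, hqf ▸ hfl, hyq⟩
    · exact c1 ⟨z, hz, hzf, h⟩ ⟨q, hq, hqf, hyq⟩
  · by_cases hpf : p = f
    · exact c2 ⟨p, hp, hpf ▸ hfl, hxp⟩ ⟨z, hz, hzl, h⟩
    · exact c1 ⟨p, hp, hpf, hxp⟩ ⟨z, hz, hzf, h⟩

/-- The conclusion of the classification. -/
def IsWheelPrismK33 (G : SimpleGraph V) : Prop :=
  (∃ h, G.IsWheel h) ∨ (∃ a₁ a₂ a₃ b₁ b₂ b₃, G.IsPrism a₁ a₂ a₃ b₁ b₂ b₃) ∨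
    ∃ a₁ a₂ a₃ b₁ b₂ b₃, G.IsK33 a₁ a₂ a₃ b₁ b₂ b₃

/-- The hub is `b`, and the rim is the 4-cycle `x`, `y`, `l`, `f`. This is the small case left over
by several searches for the minor. -/
theorem isWheel_of_five {G : SimpleGraph V} {b x y f l : V} (hxy : G.Adj x y)
    (hxb : G.Adj x b) (hyb : G.Adj y b) (hxf : G.Adj x f) (hbf : G.Adj b f) (hfl : G.Adj f l)
    (hyl : G.Adj y l) (hbl : G.Adj b l) (nfy : f ≠ y) (nxl : x ≠ l) (hfy : ¬ G.Adj f y)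
    (hxl : ¬ G.Adj x l) (hall : ∀ z, z = x ∨ z = y ∨ z = b ∨ z = f ∨ z = l) : G.IsWheel b := by
  have n1 := hxy.ne
  have n2 := hxf.ne
  have n3 := hyl.ne
  have n4 := hxb.ne
  have n5 := hyb.ne
  have n6 := hbf.ne
  have n7 := hbl.ne
  have n8 := hfl.ne
  have hsym := fun v w => G.adj_comm v w
  have irr := fun v => G.irrefl (v := v)
  intro v hv
  rcases hall v with rfl | rfl | rfl | rfl | rfl
  · exact ⟨y, f, by grind, by grind, by grind, fun w => by have := hall w; grind⟩
  · exact ⟨x, l, by grind, by grind, by grind, fun w => by have := hall w; grind⟩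
  · exact absurd rfl hv
  · exact ⟨x, l, by grind, by grind, by grind, fun w => by have := hall w; grind⟩
  · exact ⟨y, f, by grind, by grind, by grind, fun w => by have := hall w; grind⟩

/-- Splitting the hub of a wheel into `x` and `y`, when a rim vertex is adjacent to both. -/
theorem wheel_hub_split_of_common {G : SimpleGraph V} {x y : V} (hxy : G.Adj x y)
    (hx : G.ThreeLeDegree x) (hy : G.ThreeLeDegree y)
    (hall : ∀ v, v ≠ x → v ≠ y → G.Adj x v ∨ G.Adj y v)
    (hrim : ∀ v, v ≠ x → v ≠ y → ∃ a b, a ≠ b ∧ a ≠ x ∧ a ≠ y ∧ b ≠ x ∧ b ≠ y ∧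
      ∀ w, w ≠ x → w ≠ y → (G.Adj v w ↔ w = a ∨ w = b))
    (hconn : ∀ c, ∀ C : Set V, C.Nonempty → x ∉ C → y ∉ C → c ∉ C →
      (∀ a ∈ C, ∀ d ∉ C, G.Adj a d → d = x ∨ d = y ∨ d = c) →
      ∀ w, w ∈ C ∨ w = x ∨ w = y ∨ w = c)
    {b : V} (hxb : G.Adj x b) (hyb : G.Adj y b) :
    IsGraphMinor K5DeleteEdge G ∨ G.IsWheelPrismK33 := by
  have hbx := hxb.ne'
  have hby := hyb.ne'
  obtain ⟨f, l, hfl, hfx, hfy, hlx, hly, hb⟩ := hrim b hbx hby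
  have hbf : G.Adj b f := (hb f hfx hfy).2 (Or.inl rfl)
  have hbl : G.Adj b l := (hb l hlx hly).2 (Or.inr rfl)
  obtain ⟨x2, hx2, hx2y, hx2b⟩ := hx y b
  obtain ⟨y2, hy2, hy2x, hy2b⟩ := hy x b
  have hx2x := hx2.ne'
  have hy2y := hy2.ne'
  have pend : ∀ f, f ≠ x → f ≠ y → G.Adj b f →
      ∃ g, g ≠ x ∧ g ≠ y ∧ g ≠ b ∧ G.Adj f g ∧
        ∀ w, w ≠ x → w ≠ y → w ≠ b → G.Adj f w → w = g := by
    intro f hfx hfy hbf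
    obtain ⟨a, c, hac, hax, hay, hcx, hcy, hf⟩ := hrim f hfx hfy
    have h1 := (hf b hbx hby).1 hbf.symm
    have h2 := (hf a hax hay).2 (Or.inl rfl)
    have h3 := (hf c hcx hcy).2 (Or.inr rfl)
    grind
  obtain ⟨g, hgx, hgy, hgb, hfg, hg⟩ := pend f hfx hfy hbf
  obtain ⟨g', hgx', hgy', hgb', hlg', hg'⟩ := pend l hlx hly hbl
  -- If the rim has a further vertex, then the rim without `b` is a path from `f` to `l` with an
  -- inner vertex, and `{b}` is the other connected set. Otherwise the rim is the triangle `b`, `f`,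
  -- `l`.
  by_cases hz : ∃ z, z ≠ x ∧ z ≠ y ∧ z ≠ b ∧ z ≠ f ∧ z ≠ l
  · left
    obtain ⟨z, hzx, hzy, hzb, hzf, hzl⟩ := hz
    have hP : G.ConnOn {v | v ≠ x ∧ v ≠ y ∧ v ≠ b} := by
      refine ⟨⟨z, hzx, hzy, hzb⟩, ?_⟩
      intro C hC hCn hcl v hv
      have := hconn b C hCn (fun h => (hC h).1 rfl) (fun h => (hC h).2.1 rfl)
        (fun h => (hC h).2.2 rfl) (fun c hc d hd hcd => by
          by_contra! hne
          exact hd (hcl c hc d hne hcd)) v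
      rcases this with h | h | h | h
      exacts [h, absurd h hv.1, absurd h hv.2.1, absurd h hv.2.2]
    refine k5DeleteEdge_minor_of_path (S := {b}) (f := f) (l := l) (z := z) hxy
      (G.connOn_singleton b) hP (by simpa using hbx.symm) (by simpa using hby.symm) (fun h => h.1 rfl)
      (fun h => h.2.1 rfl) (by simp) ⟨hfx, hfy, hbf.ne'⟩ ⟨hlx, hly, hbl.ne'⟩
      ⟨hzx, hzy, hzb⟩ hfl hzf hzl ⟨b, rfl, hbf.symm⟩ ⟨b, rfl, hbl.symm⟩ ⟨g, fun w hw => hg w hw.1 hw.2.1 hw.2.2⟩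
      ⟨g', fun w hw => hg' w hw.1 hw.2.1 hw.2.2⟩ ⟨b, rfl, hxb⟩ ⟨b, rfl, hyb⟩
      ⟨x2, ⟨hx2x, hx2y, hx2b⟩, hx2⟩ ⟨y2, ⟨hy2x, hy2y, hy2b⟩, hy2⟩ (fun p hp => hall p hp.1 hp.2.1)
  · push Not at hz
    have hfl' : G.Adj f l := by
      have := hz g hgx hgy hgb hfg.ne'
      rwa [this] at hfg
    -- With `f` adjacent to both `x` and `y`, five single vertices serve as branch sets: `l` sees at
    -- least one of `x`, `y`, and only the other link may be missing.
    have minor : ∀ f l, f ≠ x → f ≠ y → l ≠ x → l ≠ y → G.Adj b f → G.Adj b l → G.Adj f l →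
        G.Adj x f → G.Adj y f → IsGraphMinor K5DeleteEdge G := by
      intro f l hfx hfy hlx hly hbf hbl hfl hxf hyf
      have h1 := hbf.ne
      have h2 := hbl.ne
      have h3 := hfl.ne
      rcases hall l hlx hly with h | h
      · exact k5DeleteEdge_minor_of_three_sets (S := {b}) (T := {f}) (f := l) hxy
          (G.connOn_singleton b) (G.connOn_singleton f) hbx.symm hby.symm hfx.symm hfy.symm
          (by simpa using h1) h2.symm h3.symm hly h ⟨b, rfl, hxb⟩ ⟨b, rfl, hyb⟩ ⟨f, rfl, hxf⟩
          ⟨f, rfl, hyf⟩ ⟨b, rfl, hbl.symm⟩ ⟨f, rfl, hfl.symm⟩ ⟨b, rfl, f, rfl, hbf⟩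
      · exact k5DeleteEdge_minor_of_three_sets (S := {b}) (T := {f}) (f := l) hxy.symm
          (G.connOn_singleton b) (G.connOn_singleton f) hby.symm hbx.symm hfy.symm hfx.symm
          (by simpa using h1) h2.symm h3.symm hlx h ⟨b, rfl, hyb⟩ ⟨b, rfl, hxb⟩ ⟨f, rfl, hyf⟩
          ⟨f, rfl, hxf⟩ ⟨b, rfl, hbl.symm⟩ ⟨f, rfl, hfl.symm⟩ ⟨b, rfl, f, rfl, hbf⟩
    by_cases h1 : G.Adj x f ∧ G.Adj y f
    · exact Or.inl (minor f l hfx hfy hlx hly hbf hbl hfl' h1.1 h1.2)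
    by_cases h2 : G.Adj x l ∧ G.Adj y l
    · exact Or.inl (minor l f hlx hly hfx hfy hbl hbf hfl'.symm h2.1 h2.2)
    right; left
    refine ⟨b, ?_⟩
    have key : ∀ f l, f ≠ x → f ≠ y → l ≠ x → l ≠ y → G.Adj b f → G.Adj b l → G.Adj f l →
        (∀ z, z ≠ x → z ≠ y → z ≠ b → z ≠ f → z = l) →
        G.Adj x f → ¬ G.Adj y f → G.Adj y l → ¬ G.Adj x l → G.IsWheel b := by
      intro f l hfx hfy hlx hly hbf hbl hfl hz hxf hyf hyl hxl
      exact isWheel_of_five hxy hxb hyb hxf hbf hfl hyl hbl hfy hlx.symm (fun h => hyf h.symm) hxl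
        (fun z => by have := hz z; tauto)
    have hx2' : x2 = f ∨ x2 = l := by
      by_cases h : x2 = f
      exacts [Or.inl h, Or.inr (hz x2 hx2x hx2y hx2b h)]
    have hy2' : y2 = f ∨ y2 = l := by
      by_cases h : y2 = f
      exacts [Or.inl h, Or.inr (hz y2 hy2x hy2y hy2b h)]
    rcases hx2' with rfl | rfl <;> rcases hy2' with rfl | rfl
    · exact absurd ⟨hx2, hy2⟩ h1
    · exact key _ _ hfx hfy hlx hly hbf hbl hfl' hz hx2 (fun h => h1 ⟨hx2, h⟩) hy2
        (fun h => h2 ⟨h, hy2⟩)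
    · exact key _ _ hlx hly hfx hfy hbl hbf hfl'.symm (fun z h1 h2 h3 h4 => by
        by_contra h5; exact h4 (hz z h1 h2 h3 h5)) hx2 (fun h => h2 ⟨hx2, h⟩) hy2
        (fun h => h1 ⟨h, hy2⟩)
    · exact absurd ⟨hx2, hy2⟩ h2

end SimpleGraph

/-! ### Splitting the hub of a wheel into vertices without common rim neighbours -/

namespace SimpleGraph

variable {V : Type*}

theorem isPrism_of_six {G : SimpleGraph V} {a₁ a₂ a₃ b₁ b₂ b₃ : V} (h12 : G.Adj a₁ a₂)
    (h13 : G.Adj a₁ a₃) (h23 : G.Adj a₂ a₃) (k12 : G.Adj b₁ b₂) (k13 : G.Adj b₁ b₃)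
    (k23 : G.Adj b₂ b₃) (l1 : G.Adj a₁ b₁) (l2 : G.Adj a₂ b₂) (l3 : G.Adj a₃ b₃)
    (m12 : ¬ G.Adj a₁ b₂) (m13 : ¬ G.Adj a₁ b₃) (m21 : ¬ G.Adj a₂ b₁) (m23 : ¬ G.Adj a₂ b₃)
    (m31 : ¬ G.Adj a₃ b₁) (m32 : ¬ G.Adj a₃ b₂) (n12 : a₁ ≠ b₂) (n13 : a₁ ≠ b₃) (n21 : a₂ ≠ b₁)
    (n23 : a₂ ≠ b₃) (n31 : a₃ ≠ b₁) (n32 : a₃ ≠ b₂)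
    (hall : ∀ v, v = a₁ ∨ v = a₂ ∨ v = a₃ ∨ v = b₁ ∨ v = b₂ ∨ v = b₃) :
    G.IsPrism a₁ a₂ a₃ b₁ b₂ b₃ := by
  have hsym := fun v w => G.adj_comm v w
  have irr := fun v => G.irrefl (v := v)
  refine ⟨?_, ?_, ?_, ?_, ?_, ?_, hall⟩ <;>
    exact ⟨by grind, by grind, by grind, fun w => by have := hall w; grind⟩

theorem isK33_of_six {G : SimpleGraph V} {a₁ a₂ a₃ b₁ b₂ b₃ : V} (h11 : G.Adj a₁ b₁)
    (h12 : G.Adj a₁ b₂) (h13 : G.Adj a₁ b₃) (h21 : G.Adj a₂ b₁) (h22 : G.Adj a₂ b₂)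
    (h23 : G.Adj a₂ b₃) (h31 : G.Adj a₃ b₁) (h32 : G.Adj a₃ b₂) (h33 : G.Adj a₃ b₃)
    (m12 : ¬ G.Adj a₁ a₂) (m13 : ¬ G.Adj a₁ a₃) (m23 : ¬ G.Adj a₂ a₃)
    (k12 : ¬ G.Adj b₁ b₂) (k13 : ¬ G.Adj b₁ b₃) (k23 : ¬ G.Adj b₂ b₃)
    (n12 : a₁ ≠ a₂) (n13 : a₁ ≠ a₃) (n23 : a₂ ≠ a₃) (o12 : b₁ ≠ b₂) (o13 : b₁ ≠ b₃) (o23 : b₂ ≠ b₃)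
    (hall : ∀ v, v = a₁ ∨ v = a₂ ∨ v = a₃ ∨ v = b₁ ∨ v = b₂ ∨ v = b₃) :
    G.IsK33 a₁ a₂ a₃ b₁ b₂ b₃ := by
  have hsym := fun v w => G.adj_comm v w
  have irr := fun v => G.irrefl (v := v)
  refine ⟨?_, ?_, ?_, ?_, ?_, ?_, hall⟩ <;>
    exact ⟨by grind, by grind, by grind, fun w => by have := hall w; grind⟩

/-- Splitting the hub of a wheel into `x` and `y`, when no rim vertex is adjacent to both. -/
theorem wheel_hub_split_of_not_common {G : SimpleGraph V} {x y : V} (hxy : G.Adj x y)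
    (hx : G.ThreeLeDegree x) (hy : G.ThreeLeDegree y)
    (hall : ∀ v, v ≠ x → v ≠ y → G.Adj x v ∨ G.Adj y v)
    (hrim : ∀ v, v ≠ x → v ≠ y → ∃ a b, a ≠ b ∧ a ≠ x ∧ a ≠ y ∧ b ≠ x ∧ b ≠ y ∧
      ∀ w, w ≠ x → w ≠ y → (G.Adj v w ↔ w = a ∨ w = b))
    (hconn : ∀ c, ∀ C : Set V, C.Nonempty → x ∉ C → y ∉ C → c ∉ C →
      (∀ a ∈ C, ∀ d ∉ C, G.Adj a d → d = x ∨ d = y ∨ d = c) →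
      ∀ w, w ∈ C ∨ w = x ∨ w = y ∨ w = c)
    (hno : ∀ v, G.Adj x v → ¬ G.Adj y v) :
    IsGraphMinor K5DeleteEdge G ∨ G.IsWheelPrismK33 := by
  have hxney := hxy.ne
  -- an edge `b b'` of the rim with `b` adjacent to `x` and `b'` adjacent to `y`
  obtain ⟨b, b', hbx, hby, hb'x, hb'y, hxb, hyb', hbb'⟩ : ∃ b b', b ≠ x ∧ b ≠ y ∧ b' ≠ x ∧ b' ≠ y ∧
      G.Adj x b ∧ G.Adj y b' ∧ G.Adj b b' := by
    -- Otherwise no rim edge leaves the set of rim neighbours of `x`. But `y` has two rim neighbours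
    -- `c`, `c'` outside it, and the rim without `c` is connected.
    by_contra! hcon
    obtain ⟨b, hb, hby, -⟩ := hx y y
    obtain ⟨c, hc, hcx, -⟩ := hy x x
    obtain ⟨c', hc', hc'x, hc'c⟩ := hy x c
    have := hconn c {v | v ≠ x ∧ v ≠ y ∧ G.Adj x v} ⟨b, hb.ne', hby, hb⟩ (fun h => h.1 rfl)
      (fun h => h.2.1 rfl) (fun h => hno c h.2.2 hc) ?_ c'
    · rcases this with h | h | h | h
      exacts [hno c' h.2.2 hc', hc'x h, hc'.ne' h, hc'c h]
    · rintro a ⟨hax, hay, hxa⟩ d hd had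
      by_contra! hne
      have h1 : ¬ G.Adj x d := fun h => hd ⟨hne.1, hne.2.1, h⟩
      have h2 := (hall d hne.1 hne.2.1).resolve_left h1
      exact hcon a d hax hay hne.1 hne.2.1 hxa h2 had
  obtain ⟨x2, hx2, hx2y, hx2b⟩ := hx y b
  obtain ⟨y2, hy2, hy2x, hy2b'⟩ := hy x b'
  have hx2x := hx2.ne'
  have hy2y := hy2.ne'
  have hbb'ne := hbb'.ne
  have oth : ∀ b b', b ≠ x → b ≠ y → b' ≠ x → b' ≠ y → G.Adj b b' →
      ∃ f, f ≠ x ∧ f ≠ y ∧ f ≠ b' ∧ f ≠ b ∧ G.Adj b f ∧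
        ∀ w, w ≠ x → w ≠ y → G.Adj b w → w = b' ∨ w = f := by
    intro b b' hbx hby hb'x hb'y hbb'
    obtain ⟨a, c, hac, hax, hay, hcx, hcy, hb⟩ := hrim b hbx hby
    have h1 := (hb b' hb'x hb'y).1 hbb'
    have h2 := (hb a hax hay).2 (Or.inl rfl)
    have h3 := (hb c hcx hcy).2 (Or.inr rfl)
    have := h2.ne'
    have := h3.ne'
    grind
  obtain ⟨f, hfx, hfy, hfb', hfb, hbf, hbn⟩ := oth b b' hbx hby hb'x hb'y hbb'
  obtain ⟨l, hlx, hly, hlb, hlb', hb'l, hb'n⟩ := oth b' b hb'x hb'y hbx hby hbb'.symm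
  obtain ⟨g, hgx, hgy, hgb, hgf, hfg, hfn⟩ := oth f b hfx hfy hbx hby hbf.symm
  obtain ⟨g', hgx', hgy', hgb', hgl', hlg', hln⟩ := oth l b' hlx hly hb'x hb'y hb'l.symm
  have hx2b' : x2 ≠ b' := fun e => hno x2 hx2 (e ▸ hyb')
  have hy2b : y2 ≠ b := fun e => hno b hxb (e ▸ hy2)
  have hx2y2 : x2 ≠ y2 := fun e => hno x2 hx2 (e ▸ hy2)
  -- If `f = l` then the rim is the triangle `b`, `b'`, `f`, which has no room for the distinct
  -- vertices `x2`, `y2` besides `b` and `b'`.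
  have hfl : f ≠ l := by
    rintro rfl
    have hcl : ∀ c, c ∉ ({b, b', f} : Set V) →
        ∀ w, w ∈ ({b, b', f} : Set V) ∨ w = x ∨ w = y ∨ w = c := by
      intro c hc
      refine hconn c {b, b', f} ⟨b, Or.inl rfl⟩ (by simp [hbx.symm, hb'x.symm, hfx.symm])
        (by simp [hby.symm, hb'y.symm, hfy.symm]) hc ?_
      have hfb'' : G.Adj f b' := hb'l.symm
      simp only [Set.mem_insert_iff, Set.mem_singleton_iff]
      rintro a (rfl | rfl | rfl) d hd had
      · have := hbn d; grind
      · have := hb'n d; grind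
      · have := hfn d
        have := hfn b' hb'x hb'y hfb''
        grind
    by_cases h1 : x2 = f
    · have := hcl y2 (by simp [hy2b, hy2b', ← h1, hx2y2.symm]) 
      obtain ⟨p, hp⟩ : ∃ p, p = y2 := ⟨_, rfl⟩
      have hyn : ∀ w, w ≠ x → w ≠ y → G.Adj y2 w → False := by
        intro w hwx hwy hw
        have hwm := this w
        simp only [Set.mem_insert_iff, Set.mem_singleton_iff] at hwm
        have hne := hw.ne'
        rcases hwm with (rfl | rfl | rfl) | h | h | h
        · have := hbn y2 hy2x hy2y hw.symm; grind
        · have := hb'n y2 hy2x hy2y hw.symm; grind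
        · have := hfn y2 hy2x hy2y hw.symm
          have := hfn b' hb'x hb'y hb'l.symm
          grind
        all_goals contradiction
      obtain ⟨a, c, _, hax, hay, _, _, h⟩ := hrim y2 hy2x hy2y
      exact hyn a hax hay ((h a hax hay).2 (Or.inl rfl))
    · have := hcl x2 (by simp [hx2b, hx2b', h1])
      have hyn : ∀ w, w ≠ x → w ≠ y → G.Adj x2 w → False := by
        intro w hwx hwy hw
        have hwm := this w
        simp only [Set.mem_insert_iff, Set.mem_singleton_iff] at hwm
        have hne := hw.ne'
        rcases hwm with (rfl | rfl | rfl) | h | h | h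
        · have := hbn x2 hx2x hx2y hw.symm; grind
        · have := hb'n x2 hx2x hx2y hw.symm; grind
        · have := hfn x2 hx2x hx2y hw.symm
          have := hfn b' hb'x hb'y hb'l.symm
          grind
        all_goals contradiction
      obtain ⟨a, c, _, hax, hay, _, _, h⟩ := hrim x2 hx2x hx2y
      exact hyn a hax hay ((h a hax hay).2 (Or.inl rfl))
  have hP : G.ConnOn {v | v ≠ x ∧ v ≠ y ∧ v ≠ b ∧ v ≠ b'} := by
    have h0 : G.ConnOn {v | v ≠ x ∧ v ≠ y ∧ v ≠ b} := by
      refine ⟨⟨b', hb'x, hb'y, hbb'ne.symm⟩, ?_⟩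
      intro C hC hCn hcl v hv
      have := hconn b C hCn (fun h => (hC h).1 rfl) (fun h => (hC h).2.1 rfl)
        (fun h => (hC h).2.2 rfl) (fun c hc d hd hcd => by
          by_contra! hne
          exact hd (hcl c hc d hne hcd)) v
      rcases this with h | h | h | h
      exacts [h, absurd h hv.1, absurd h hv.2.1, absurd h hv.2.2]
    have := h0.diff_pendant (f := b') (g := l) (fun w hw hw' => by
      have := hb'n w hw.1 hw.2.1 hw'
      have := hw.2.2
      tauto) ⟨f, ⟨hfx, hfy, hfb⟩, hfb'⟩
    convert this using 1
    ext v
    simp only [Set.mem_ofPred_eq, Set.mem_sdiff, Set.mem_singleton_iff]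
    tauto
  -- With at least five rim vertices, `{b, b'}` and the rest of the rim give the minor. Otherwise
  -- the rim is the 4-cycle `b`, `b'`, `l`, `f`.
  by_cases hz : ∃ z, z ≠ x ∧ z ≠ y ∧ z ≠ b ∧ z ≠ b' ∧ z ≠ f ∧ z ≠ l
  · left
    obtain ⟨z, hzx, hzy, hzb, hzb', hzf, hzl⟩ := hz
    exact k5DeleteEdge_minor_of_path (S := {b, b'}) (f := f) (l := l) (z := z) hxy
      (connOn_pair hbb') hP (by simp [hbx.symm, hb'x.symm]) (by simp [hby.symm, hb'y.symm])
      (fun h => h.1 rfl) (fun h => h.2.1 rfl) (by simp)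
      ⟨hfx, hfy, hfb, hfb'⟩ ⟨hlx, hly, hlb, hlb'⟩ ⟨hzx, hzy, hzb, hzb'⟩ hfl hzf hzl
      ⟨b, by simp, hbf.symm⟩ ⟨b', by simp, hb'l.symm⟩
      ⟨g, fun w hw hfw => (hfn w hw.1 hw.2.1 hfw).resolve_left hw.2.2.1⟩
      ⟨g', fun w hw hfw => (hln w hw.1 hw.2.1 hfw).resolve_left hw.2.2.2⟩ ⟨b, by simp, hxb⟩
      ⟨b', by simp, hyb'⟩ ⟨x2, ⟨hx2x, hx2y, hx2b, hx2b'⟩, hx2⟩ ⟨y2, ⟨hy2x, hy2y, hy2b, hy2b'⟩, hy2⟩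
      (fun p hp => hall p hp.1 hp.2.1)
  · right; right
    push Not at hz
    have hfl' : G.Adj f l := by
      have h1 : g ≠ b' := by
        rintro rfl
        have := hb'n f hfx hfy hfg.symm
        grind
      have := hz g hgx hgy hgb h1 hgf
      rwa [this] at hfg
    have hfn' : ∀ w, w ≠ x → w ≠ y → G.Adj f w → w = b ∨ w = l := by
      have := hfn l hlx hly hfl'
      grind
    have hln' : ∀ w, w ≠ x → w ≠ y → G.Adj l w → w = b' ∨ w = f := by
      have := hln f hfx hfy hfl'.symm
      grind
    have hx2' : x2 = f ∨ x2 = l := by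
      have := hz x2 hx2x hx2y hx2b hx2b'
      tauto
    have nf : ¬ G.Adj f b' := fun h => by
      have := hfn' b' hb'x hb'y h
      grind
    have nl : ¬ G.Adj l b := fun h => by
      have := hln' b hbx hby h
      grind
    have hno' : ∀ v, G.Adj y v → ¬ G.Adj v x := fun v h h' => hno v h'.symm h
    have hno'' : ∀ v, G.Adj x v → ¬ G.Adj v y := fun v h h' => hno v h h'.symm
    have hz' : ∀ z, z = x ∨ z = y ∨ z = b ∨ z = b' ∨ z = f ∨ z = l := fun z => by
      have := hz z
      tauto
    -- On a rim of length four, `x` sees two rim vertices and `y` the other two. If those of `x` are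
    -- consecutive the graph is a prism, and if they are opposite it is `K₃,₃`.
    rcases hx2' with rfl | rfl
    · have hy2' : y2 = l := by
        exact hz y2 hy2x hy2y hy2b hy2b' hx2y2.symm
      subst hy2'
      exact Or.inl ⟨x, b, x2, y, b', y2, isPrism_of_six hxb hx2 hbf hyb' hy2 hb'l hxy hbb' hfl'
        (fun h => hno' b' hyb' h.symm) (fun h => hno' y2 hy2 h.symm) (hno'' b hxb)
        (fun h => nl h.symm) (hno'' x2 hx2) nf hb'x.symm hlx.symm hby hlb.symm hfy hfb'
        (fun z => by have := hz' z; tauto)⟩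
    · have hy2' : y2 = f := by
        by_contra h
        exact hx2y2 (hz y2 hy2x hy2y hy2b hy2b' h).symm
      subst hy2'
      exact Or.inr ⟨x, b', y2, y, b, x2, isK33_of_six hxy hxb hx2 hyb'.symm hbb'.symm hb'l hy2.symm
        hbf.symm hfl' (fun h => hno' b' hyb' h.symm) (fun h => hno' y2 hy2 h.symm)
        (fun h => nf h.symm) (fun h => hno'' b hxb h.symm) (fun h => hno'' x2 hx2 h.symm)
        (fun h => nl h.symm) hb'x.symm hfx.symm hfb'.symm hby.symm hly.symm hlb.symm
        (fun z => by have := hz' z; tauto)⟩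

end SimpleGraph

/-! ### Splitting a rim vertex of a wheel -/

namespace SimpleGraph

variable {V : Type*}

/-- Contracting the edge `xy` gives a wheel with hub `h`, in which the contracted vertex is on the
rim between `a` and `b`. -/
structure IsRimSplit (G : SimpleGraph V) (h x y a b : V) : Prop where
  hxy : G.Adj x y
  hhx : h ≠ x
  hhy : h ≠ y
  hax : a ≠ x
  hay : a ≠ y
  hah : a ≠ h
  hbx : b ≠ x
  hby : b ≠ y
  hbh : b ≠ h
  hab : a ≠ b
  hx : G.ThreeLeDegree x
  hy : G.ThreeLeDegree y
  hub : ∀ v, v ≠ x → v ≠ y → v ≠ h → G.Adj h v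
  hm : ∀ w, w ≠ x → w ≠ y → ((G.Adj x w ∨ G.Adj y w) ↔ w = h ∨ w = a ∨ w = b)
  ha : ∃ a', a' ≠ x ∧ a' ≠ y ∧ a' ≠ h ∧ ∀ w, w ≠ x → w ≠ y → (G.Adj a w ↔ w = h ∨ w = a')
  hb : ∃ b', b' ≠ x ∧ b' ≠ y ∧ b' ≠ h ∧ ∀ w, w ≠ x → w ≠ y → (G.Adj b w ↔ w = h ∨ w = b')
  rim : ∀ v, v ≠ x → v ≠ y → v ≠ h → v ≠ a → v ≠ b → ∃ c d, G.Nbr3 v h c d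
  conn : G.ConnOn {v | v ≠ x ∧ v ≠ y ∧ v ≠ h}

namespace IsRimSplit

variable {G : SimpleGraph V} {h x y a b : V}

theorem swap (s : G.IsRimSplit h x y a b) : G.IsRimSplit h x y b a where
  hxy := s.hxy
  hhx := s.hhx
  hhy := s.hhy
  hax := s.hbx
  hay := s.hby
  hah := s.hbh
  hbx := s.hax
  hby := s.hay
  hbh := s.hah
  hab := s.hab.symm
  hx := s.hx
  hy := s.hy
  hub := s.hub
  hm := fun w h1 h2 => by have := s.hm w h1 h2; tauto
  ha := s.hb
  hb := s.ha
  rim := fun v h1 h2 h3 h4 h5 => s.rim v h1 h2 h3 h5 h4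
  conn := s.conn

theorem flip (s : G.IsRimSplit h x y a b) : G.IsRimSplit h y x a b where
  hxy := s.hxy.symm
  hhx := s.hhy
  hhy := s.hhx
  hax := s.hay
  hay := s.hax
  hah := s.hah
  hbx := s.hby
  hby := s.hbx
  hbh := s.hbh
  hab := s.hab
  hx := s.hy
  hy := s.hx
  hub := fun v h1 h2 => s.hub v h2 h1
  hm := fun w h1 h2 => by have := s.hm w h2 h1; tauto
  ha := by
    obtain ⟨a', h1, h2, h3, h4⟩ := s.ha
    exact ⟨a', h2, h1, h3, fun w h5 h6 => h4 w h6 h5⟩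
  hb := by
    obtain ⟨a', h1, h2, h3, h4⟩ := s.hb
    exact ⟨a', h2, h1, h3, fun w h5 h6 => h4 w h6 h5⟩
  rim := fun v h1 h2 => s.rim v h2 h1
  conn := by
    convert s.conn using 1
    ext v
    simp only [Set.mem_ofPred_eq]
    tauto

/-- The rim without the contracted vertex is a path ending in `b`, so `b` is pendant there. -/
theorem conn_diff (s : G.IsRimSplit h x y a b) :
    G.ConnOn {v | v ≠ x ∧ v ≠ y ∧ v ≠ h ∧ v ≠ b} := by
  obtain ⟨b', _, _, _, hb⟩ := s.hb
  have := s.conn.diff_pendant (f := b) (g := b') (fun w hw hbw =>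
    ((hb w hw.1 hw.2.1).1 hbw).resolve_left hw.2.2) ⟨a, ⟨s.hax, s.hay, s.hah⟩, s.hab⟩
  convert this using 1
  ext v
  simp only [Set.mem_ofPred_eq, Set.mem_sdiff, Set.mem_singleton_iff]
  tauto

theorem linked_diff (s : G.IsRimSplit h x y a b) :
    G.Linked {v | v ≠ x ∧ v ≠ y ∧ v ≠ h ∧ v ≠ b} {b} := by
  obtain ⟨b', h1, h2, h3, hb⟩ := s.hb
  have := (hb b' h1 h2).2 (Or.inr rfl)
  exact ⟨b', ⟨h1, h2, h3, this.ne'⟩, b, rfl, this.symm⟩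

/-- The rim path without its end `b` is a branch set and the others are single vertices; the link
between this path and `y` is dispensable. -/
theorem minor_of_hub_hub (s : G.IsRimSplit h x y a b) (hxh : G.Adj x h) (hyh : G.Adj y h)
    (hxa : G.Adj x a) (hxb : G.Adj x b) (hyb : G.Adj y b) : IsGraphMinor K5DeleteEdge G := by
  have m : a ∈ {v | v ≠ x ∧ v ≠ y ∧ v ≠ h ∧ v ≠ b} := ⟨s.hax, s.hay, s.hah, s.hab⟩
  refine k5DeleteEdge_minor {y} {v | v ≠ x ∧ v ≠ y ∧ v ≠ h ∧ v ≠ b} {h} {x} {b}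
    (G.connOn_singleton _) s.conn_diff (G.connOn_singleton _) (G.connOn_singleton _)
    (G.connOn_singleton _) ?_ ?_ ?_ ?_ ?_ ?_ ?_ ?_ ?_ ?_ (.of_adj hyh rfl rfl)
    (.of_adj s.hxy.symm rfl rfl) (.of_adj hyb rfl rfl) (.of_adj (s.hub a s.hax s.hay s.hah).symm m rfl)
    (.of_adj hxa.symm m rfl) s.linked_diff (.of_adj hxh.symm rfl rfl)
    (.of_adj (s.hub b s.hbx s.hby s.hbh) rfl rfl) (.of_adj hxb rfl rfl)
  all_goals
    have := s.hxy.ne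
    have := s.hhx
    have := s.hhy
    have := s.hbx
    have := s.hby
    have := s.hbh
    simp only [Set.disjoint_left, Set.mem_singleton_iff, Set.mem_ofPred_eq]
    grind

/-- The same branch sets as in `minor_of_hub_hub`, but now the link between `y` and the hub is the
dispensable one. -/
theorem minor_of_hub_full (s : G.IsRimSplit h x y a b) (hxh : G.Adj x h)
    (hxa : G.Adj x a) (hxb : G.Adj x b) (hya : G.Adj y a) (hyb : G.Adj y b) :
    IsGraphMinor K5DeleteEdge G := by
  have m : a ∈ {v | v ≠ x ∧ v ≠ y ∧ v ≠ h ∧ v ≠ b} := ⟨s.hax, s.hay, s.hah, s.hab⟩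
  refine k5DeleteEdge_minor {y} {h} {x} {v | v ≠ x ∧ v ≠ y ∧ v ≠ h ∧ v ≠ b} {b}
    (G.connOn_singleton _) (G.connOn_singleton _) (G.connOn_singleton _) s.conn_diff
    (G.connOn_singleton _) ?_ ?_ ?_ ?_ ?_ ?_ ?_ ?_ ?_ ?_ (.of_adj s.hxy.symm rfl rfl)
    (.of_adj hya rfl m) (.of_adj hyb rfl rfl) (.of_adj hxh.symm rfl rfl)
    (.of_adj (s.hub a s.hax s.hay s.hah) rfl m) (.of_adj (s.hub b s.hbx s.hby s.hbh) rfl rfl)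
    (.of_adj hxa rfl m) (.of_adj hxb rfl rfl) s.linked_diff
  all_goals
    have := s.hxy.ne
    have := s.hhx
    have := s.hhy
    have := s.hbx
    have := s.hby
    have := s.hbh
    simp only [Set.disjoint_left, Set.mem_singleton_iff, Set.mem_ofPred_eq]
    grind

/-- The split only lengthens the rim, which now runs through `a`, `x`, `y`, `b`. -/
theorem isWheel_hub (s : G.IsRimSplit h x y a b) (hxh : G.Adj x h) (hyh : G.Adj y h)
    (hxa : G.Adj x a) (hxb : ¬ G.Adj x b) (hyb : G.Adj y b) (hya : ¬ G.Adj y a) : G.IsWheel h := by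
  have n1 := s.hxy.ne
  have n2 := s.hhx
  have n3 := s.hhy
  have n4 := s.hax
  have n5 := s.hay
  have n6 := s.hah
  have n7 := s.hbx
  have n8 := s.hby
  have n9 := s.hbh
  have n10 := s.hab
  have e := s.hxy
  have hm := s.hm
  have hsym := fun v w => G.adj_comm v w
  have irr := fun v => G.irrefl (v := v)
  intro v hvh
  by_cases hvx : v = x
  · subst hvx
    clear hsym
    refine ⟨y, a, n3, n6.symm, n5.symm, fun w => ⟨fun hw => ?_, by rintro (rfl | rfl | rfl) <;> assumption⟩⟩
    by_cases hwy : w = y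
    · exact Or.inr (Or.inl hwy)
    · have := (hm w hw.ne' hwy).1 (Or.inl hw)
      grind
  by_cases hvy : v = y
  · subst hvy
    refine ⟨x, b, n2, n9.symm, n7.symm, fun w => ⟨fun hw => ?_, by
      rintro (rfl | rfl | rfl)
      exacts [hyh, e.symm, hyb]⟩⟩
    by_cases hwx : w = x
    · exact Or.inr (Or.inl hwx)
    · have := (hm w hwx hw.ne').1 (Or.inr hw)
      grind
  by_cases hva : v = a
  · subst hva
    obtain ⟨a', h1, h2, h3, h4⟩ := s.ha
    refine ⟨x, a', n2, h3.symm, h1.symm, fun w => ?_⟩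
    by_cases hwx : w = x
    · subst hwx; simp [hxa.symm]
    by_cases hwy : w = y
    · subst hwy
      have : ¬ G.Adj v w := fun h => hya h.symm
      simp [this, n3.symm, n1.symm, Ne.symm h2]
    · rw [h4 w hwx hwy]; tauto
  by_cases hvb : v = b
  · subst hvb
    obtain ⟨a', h1, h2, h3, h4⟩ := s.hb
    refine ⟨y, a', n3, h3.symm, h2.symm, fun w => ?_⟩
    by_cases hwy : w = y
    · subst hwy; simp [hyb.symm]
    by_cases hwx : w = x
    · subst hwx
      have : ¬ G.Adj v w := fun h => hxb h.symm
      simp [this, n2.symm, n1, Ne.symm h1]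
    · rw [h4 w hwx hwy]; tauto
  exact s.rim v hvx hvy hvh hva hvb

theorem minor_or_isWheel (s : G.IsRimSplit h x y a b) (hxh : G.Adj x h) (hyh : ¬ G.Adj y h)
    (hxa : G.Adj x a) (hxb : ¬ G.Adj x b) (hya : G.Adj y a) (hyb : G.Adj y b) :
    IsGraphMinor K5DeleteEdge G ∨ G.IsWheel a := by
  have n1 := s.hxy.ne
  have n2 := s.hhx
  have n3 := s.hhy
  have n4 := s.hax
  have n5 := s.hay
  have n6 := s.hah
  have n7 := s.hbx
  have n8 := s.hby
  have n9 := s.hbh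
  have n10 := s.hab
  obtain ⟨a', ha1, ha2, ha3, ha⟩ := s.ha
  obtain ⟨b', hb1, hb2, hb3, hb⟩ := s.hb
  have haa' := (ha a' ha1 ha2).2 (Or.inr rfl)
  have hbb' := (hb b' hb1 hb2).2 (Or.inr rfl)
  -- A further rim vertex makes the inner part of the path from `a` to `b` a nonempty branch set,
  -- next to `{x}`, `{y, b}`, `{h}`, `{a}`. Otherwise `a` is the hub of a wheel with rim `x`, `y`,
  -- `b`, `h`.
  by_cases hz : ∃ z, z ≠ x ∧ z ≠ y ∧ z ≠ h ∧ z ≠ a ∧ z ≠ b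
  · left
    obtain ⟨z, hzx, hzy, hzh, hza, hzb⟩ := hz
    have hab' : a' ≠ b := by
      rintro rfl
      have hb'a : a = b' := by
        have := (hb a n4 n5).1 haa'.symm
        tauto
      have := s.conn.2 {a, a'} (by rintro v (rfl | rfl); exacts [⟨n4, n5, n6⟩, ⟨n7, n8, n9⟩])
        ⟨a, Or.inl rfl⟩ (by
          rintro c (rfl | rfl) d hd hcd
          · have := (ha d hd.1 hd.2.1).1 hcd
            exact Or.inr (this.resolve_left hd.2.2)
          · have := (hb d hd.1 hd.2.1).1 hcd
            exact Or.inl ((this.resolve_left hd.2.2).trans hb'a.symm)) ⟨hzx, hzy, hzh⟩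
      rcases this with h | h
      exacts [hza h, hzb h]
    have hba' : b' ≠ a := by
      rintro rfl
      have := (ha b s.hbx s.hby).1 hbb'.symm
      rcases this with h | h
      exacts [n9 h, hab' h.symm]
    have hR : G.ConnOn ({v | v ≠ x ∧ v ≠ y ∧ v ≠ h ∧ v ≠ b} \ {a}) :=
      s.conn_diff.diff_pendant (g := a') (fun w hw haw =>
        ((ha w hw.1 hw.2.1).1 haw).resolve_left hw.2.2.1) ⟨z, ⟨hzx, hzy, hzh, hzb⟩, hza⟩
    have ma : a' ∈ ({v | v ≠ x ∧ v ≠ y ∧ v ≠ h ∧ v ≠ b} \ {a} : Set V) :=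
      ⟨⟨ha1, ha2, ha3, hab'⟩, haa'.ne'⟩
    have mb : b' ∈ ({v | v ≠ x ∧ v ≠ y ∧ v ≠ h ∧ v ≠ b} \ {a} : Set V) :=
      ⟨⟨hb1, hb2, hb3, hbb'.ne'⟩, hba'⟩
    refine k5DeleteEdge_minor {x} ({v | v ≠ x ∧ v ≠ y ∧ v ≠ h ∧ v ≠ b} \ {a}) {y, b} {h} {a}
      (G.connOn_singleton _) hR (connOn_pair hyb) (G.connOn_singleton _)
      (G.connOn_singleton _) ?_ ?_ ?_ ?_ ?_ ?_ ?_ ?_ ?_ ?_ (.of_adj s.hxy rfl (Or.inl rfl))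
      (.of_adj hxh rfl rfl) (.of_adj hxa rfl rfl) (.of_adj hbb'.symm mb (Or.inr rfl))
      (.of_adj (s.hub b' hb1 hb2 hb3).symm mb rfl) (.of_adj haa'.symm ma rfl)
      (.of_adj (s.hub b n7 n8 n9).symm (Or.inr rfl) rfl) (.of_adj hya (Or.inl rfl) rfl)
      (.of_adj (s.hub a n4 n5 n6) rfl rfl)
    all_goals
      simp only [Set.disjoint_left, Set.mem_singleton_iff, Set.mem_ofPred_eq, Set.mem_sdiff,
        Set.mem_insert_iff]
      grind
  · right
    push Not at hz
    have hab : G.Adj a b := by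
      have := hz a' ha1 ha2 ha3 haa'.ne'
      rwa [this] at haa'
    refine isWheel_of_five (x := x) (y := y) (f := h) (l := b) s.hxy hxa hya hxh
      (s.hub a n4 n5 n6).symm (s.hub b n7 n8 n9) hyb hab n3 n7.symm (fun h => hyh h.symm) hxb ?_
    intro z
    have := hz z
    tauto

/-- Of the three or more neighbours of `x`, at most one is `y`; the others are inherited by the
contracted vertex. -/
theorem two_of_three (s : G.IsRimSplit h x y a b) : (G.Adj x h ∧ G.Adj x a) ∨
    (G.Adj x h ∧ G.Adj x b) ∨ (G.Adj x a ∧ G.Adj x b) := by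
  obtain ⟨w, hw, hwy, _⟩ := s.hx y y
  obtain ⟨w', hw', hw'y, hww'⟩ := s.hx y w
  have h1 := (s.hm w hw.ne' hwy).1 (Or.inl hw)
  have h2 := (s.hm w' hw'.ne' hw'y).1 (Or.inl hw')
  rcases h1 with rfl | rfl | rfl <;> rcases h2 with rfl | rfl | rfl <;> tauto

/-- If `x` and `y` share one of `a`, `b`, then an end that sees both of them yields the minor; if
they share none, the rim has just become longer. -/
theorem minor_or_wheel_of_hub_hub (s : G.IsRimSplit h x y a b) (hxh : G.Adj x h)
    (hyh : G.Adj y h) : IsGraphMinor K5DeleteEdge G ∨ ∃ h, G.IsWheel h := by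
  have t1 := s.two_of_three
  have t2 := s.flip.two_of_three
  have c2 := (s.hm a s.hax s.hay).2 (Or.inr (Or.inl rfl))
  have c3 := (s.hm b s.hbx s.hby).2 (Or.inr (Or.inr rfl))
  by_cases hxa : G.Adj x a
  · by_cases hxb : G.Adj x b
    · by_cases hyb : G.Adj y b
      · exact Or.inl (s.minor_of_hub_hub hxh hyh hxa hxb hyb)
      · exact Or.inl (s.swap.minor_of_hub_hub hxh hyh hxb hxa (by tauto))
    · have hyb := c3.resolve_left hxb
      by_cases hya : G.Adj y a
      · exact Or.inl (s.flip.swap.minor_of_hub_hub hyh hxh hyb hya hxa)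
      · exact Or.inr ⟨h, s.isWheel_hub hxh hyh hxa hxb hyb hya⟩
  · have hya := c2.resolve_left hxa
    have hxb : G.Adj x b := by tauto
    by_cases hyb : G.Adj y b
    · exact Or.inl (s.flip.minor_of_hub_hub hyh hxh hya hyb hxb)
    · exact Or.inr ⟨h, s.swap.isWheel_hub hxh hyh hxb hxa hya hyb⟩

theorem minor_or_wheel_of_hub (s : G.IsRimSplit h x y a b) (hxh : G.Adj x h)
    (hyh : ¬ G.Adj y h) : IsGraphMinor K5DeleteEdge G ∨ ∃ h, G.IsWheel h := by
  have t1 := s.two_of_three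
  obtain ⟨hya, hyb⟩ : G.Adj y a ∧ G.Adj y b := by
    have := s.flip.two_of_three
    tauto
  by_cases hxa : G.Adj x a
  · by_cases hxb : G.Adj x b
    · exact Or.inl (s.minor_of_hub_full hxh hxa hxb hya hyb)
    · exact (s.minor_or_isWheel hxh hyh hxa hxb hya hyb).imp id fun h => ⟨a, h⟩
  · exact (s.swap.minor_or_isWheel hxh hyh (by tauto) hxa hyb hya).imp id fun h => ⟨b, h⟩

theorem minor_or_wheel (s : G.IsRimSplit h x y a b) :
    IsGraphMinor K5DeleteEdge G ∨ ∃ h, G.IsWheel h := by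
  by_cases hxh : G.Adj x h
  · by_cases hyh : G.Adj y h
    · exact s.minor_or_wheel_of_hub_hub hxh hyh
    · exact s.minor_or_wheel_of_hub hxh hyh
  · exact s.flip.minor_or_wheel_of_hub (((s.hm h s.hhx s.hhy).2 (Or.inl rfl)).resolve_left hxh) hxh

end IsRimSplit

end SimpleGraph

/-! ### Splitting a vertex of a prism or of `K₃,₃` -/

set_option linter.unusedSimpArgs false

/-- Two subsets of a 3-element set that cover it and have at least two elements each share an
element, and the two other elements can be assigned to different subsets. -/
theorem exists_shared_of_three {p₁ p₂ p₃ q₁ q₂ q₃ : Prop} (c₁ : p₁ ∨ q₁) (c₂ : p₂ ∨ q₂)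
    (c₃ : p₃ ∨ q₃) (hp : (p₁ ∧ p₂) ∨ (p₁ ∧ p₃) ∨ (p₂ ∧ p₃))
    (hq : (q₁ ∧ q₂) ∨ (q₁ ∧ q₃) ∨ (q₂ ∧ q₃)) :
    (p₁ ∧ p₂ ∧ q₂ ∧ q₃) ∨ (p₃ ∧ p₂ ∧ q₂ ∧ q₁) ∨ (p₂ ∧ p₁ ∧ q₁ ∧ q₃) ∨ (p₃ ∧ p₁ ∧ q₁ ∧ q₂) ∨
      (p₁ ∧ p₃ ∧ q₃ ∧ q₂) ∨ (p₂ ∧ p₃ ∧ q₃ ∧ q₁) := by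
  by_cases p₁ <;> by_cases p₂ <;> by_cases p₃ <;> by_cases q₁ <;> by_cases q₂ <;> by_cases q₃ <;>
    simp_all

namespace SimpleGraph

variable {V : Type*}

/-- If `x` and `y` are merged to a vertex with neighbours `c₁`, `c₂`, `c₃`, then `x` and `y` share
one of these, and the other two are neighbours of different ends. -/
theorem exists_shared_neighbor {G : SimpleGraph V} {x y c₁ c₂ c₃ : V} (hx : G.ThreeLeDegree x)
    (hy : G.ThreeLeDegree y) (h1x : c₁ ≠ x) (h1y : c₁ ≠ y) (h2x : c₂ ≠ x) (h2y : c₂ ≠ y)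
    (h3x : c₃ ≠ x) (h3y : c₃ ≠ y)
    (n : ∀ w, w ≠ x → w ≠ y → ((G.Adj x w ∨ G.Adj y w) ↔ w = c₁ ∨ w = c₂ ∨ w = c₃)) :
    (G.Adj x c₁ ∧ G.Adj x c₂ ∧ G.Adj y c₂ ∧ G.Adj y c₃) ∨
    (G.Adj x c₃ ∧ G.Adj x c₂ ∧ G.Adj y c₂ ∧ G.Adj y c₁) ∨
    (G.Adj x c₂ ∧ G.Adj x c₁ ∧ G.Adj y c₁ ∧ G.Adj y c₃) ∨
    (G.Adj x c₃ ∧ G.Adj x c₁ ∧ G.Adj y c₁ ∧ G.Adj y c₂) ∨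
    (G.Adj x c₁ ∧ G.Adj x c₃ ∧ G.Adj y c₃ ∧ G.Adj y c₂) ∨
    (G.Adj x c₂ ∧ G.Adj x c₃ ∧ G.Adj y c₃ ∧ G.Adj y c₁) := by
  have two : ∀ {x y}, G.ThreeLeDegree x → (∀ w, w ≠ x → w ≠ y → ((G.Adj x w ∨ G.Adj y w) ↔
      w = c₁ ∨ w = c₂ ∨ w = c₃)) → (G.Adj x c₁ ∧ G.Adj x c₂) ∨
      (G.Adj x c₁ ∧ G.Adj x c₃) ∨ (G.Adj x c₂ ∧ G.Adj x c₃) := by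
    intro x y hx n
    obtain ⟨w, hw, hwy, _⟩ := hx y y
    obtain ⟨w', hw', hw'y, hww'⟩ := hx y w
    have h1 := (n w hw.ne' hwy).1 (Or.inl hw)
    have h2 := (n w' hw'.ne' hw'y).1 (Or.inl hw')
    clear n hx
    rcases h1 with rfl | rfl | rfl <;> rcases h2 with rfl | rfl | rfl <;> tauto
  exact exists_shared_of_three ((n c₁ h1x h1y).2 (by simp)) ((n c₂ h2x h2y).2 (by simp))
    ((n c₃ h3x h3y).2 (by simp)) (two hx n) (two hy fun w h1 h2 => by rw [← n w h2 h1, or_comm])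

/-- Contracting `x b₁` and `y b₃` leaves five vertices, of which only `a₂` and `a₃` need not be
adjacent. -/
theorem k5DeleteEdge_minor_of_K33_split {G : SimpleGraph V} {x y a₂ a₃ b₁ b₂ b₃ : V}
    (hxy : G.Adj x y) (g1 : a₂ ≠ x) (g2 : a₃ ≠ x) (g3 : a₂ ≠ y) (g4 : a₃ ≠ y) (g9 : a₂ ≠ a₃)
    (g5 : b₁ ≠ y) (g7 : b₃ ≠ x) (d1 : b₁ ≠ b₂) (d2 : b₁ ≠ b₃) (d3 : b₂ ≠ b₃)
    (p1 : G.Adj a₂ b₁) (p2 : G.Adj a₂ b₂) (p3 : G.Adj a₂ b₃) (q1 : G.Adj a₃ b₁) (q2 : G.Adj a₃ b₂)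
    (q3 : G.Adj a₃ b₃)
    (h : G.Adj x b₁ ∧ G.Adj x b₂ ∧ G.Adj y b₂ ∧ G.Adj y b₃) : IsGraphMinor K5DeleteEdge G := by
  obtain ⟨x1, x2, y2, y3⟩ := h
  refine k5DeleteEdge_minor {a₂} {a₃} {x, b₁} {y, b₃} {b₂} (G.connOn_singleton _)
    (G.connOn_singleton _) (connOn_pair x1) (connOn_pair y3) (G.connOn_singleton _)
    ?_ ?_ ?_ ?_ ?_ ?_ ?_ ?_ ?_ ?_ (.of_adj p1 rfl (by simp)) (.of_adj p3 rfl (by simp))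
    (.of_adj p2 rfl rfl) (.of_adj q1 rfl (by simp)) (.of_adj q3 rfl (by simp))
    (.of_adj q2 rfl rfl) (.of_adj hxy (by simp) (by simp)) (.of_adj x2 (by simp) rfl)
    (.of_adj y2 (by simp) rfl)
  all_goals
    simp [g1, g2, g3, g4, g5.symm, g7, d1, d2, d3.symm, p1.ne, p2.ne, p3.ne,
      q1.ne, q2.ne, q3.ne, hxy.ne, x1.ne, x2.ne, y2.ne, y3.ne, g7.symm, g9,
      hxy.ne', d1.symm, d2.symm, d3, y3.ne', y2.ne', g5, x1.ne', x2.ne']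

theorem IsK33.split_minor {G : SimpleGraph V} {x y : V} (hxy : G.Adj x y)
    (hx : G.ThreeLeDegree x) (hy : G.ThreeLeDegree y) {a₂ a₃ b₁ b₂ b₃ : V}
    {h0 : x ≠ y} {h2 : a₂ ≠ y} {h3 : a₃ ≠ y} {k1 : b₁ ≠ y} {k2 : b₂ ≠ y} {k3 : b₃ ≠ y}
    (h : (G.contractEdge x y).IsK33 ⟨x, h0⟩ ⟨a₂, h2⟩ ⟨a₃, h3⟩ ⟨b₁, k1⟩ ⟨b₂, k2⟩ ⟨b₃, k3⟩) :
    IsGraphMinor K5DeleteEdge G := by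
  obtain ⟨d1, d2, d3, n1⟩ := h.ha₁
  obtain ⟨e1, e2, e3, -⟩ := h.hb₁
  have n1' : ∀ w, w ≠ x → w ≠ y → ((G.Adj x w ∨ G.Adj y w) ↔ w = b₁ ∨ w = b₂ ∨ w = b₃) := by
    intro w hwx hwy
    rw [← contractEdge_adj_left h0 hwy hwx, n1]
    simp
  simp only [ne_eq, Subtype.mk.injEq] at d1 d2 d3 e1 e2 e3
  have f1 : b₁ ≠ x := fun e => ((n1 ⟨b₁, k1⟩).2 (Or.inl rfl)).ne (Subtype.ext e.symm)
  have f2 : b₂ ≠ x := fun e => ((n1 ⟨b₂, k2⟩).2 (Or.inr (Or.inl rfl))).ne (Subtype.ext e.symm)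
  have f3 : b₃ ≠ x := fun e => ((n1 ⟨b₃, k3⟩).2 (Or.inr (Or.inr rfl))).ne (Subtype.ext e.symm)
  have g1 : a₂ ≠ x := Ne.symm e1
  have g2 : a₃ ≠ x := Ne.symm e2
  have adj : ∀ a (ha : a ≠ y), a ≠ x → (∀ w, (G.contractEdge x y).Adj ⟨a, ha⟩ w ↔
      w = ⟨b₁, k1⟩ ∨ w = ⟨b₂, k2⟩ ∨ w = ⟨b₃, k3⟩) → G.Adj a b₁ ∧ G.Adj a b₂ ∧ G.Adj a b₃ := by
    intro a ha hax hn
    refine ⟨(contractEdge_adj_of_ne ha k1 hax f1).1 ((hn _).2 (by simp)),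
      (contractEdge_adj_of_ne ha k2 hax f2).1 ((hn _).2 (by simp)),
      (contractEdge_adj_of_ne ha k3 hax f3).1 ((hn _).2 (by simp))⟩
  obtain ⟨p1, p2, p3⟩ := adj a₂ h2 g1 h.ha₂.2.2.2
  obtain ⟨q1, q2, q3⟩ := adj a₃ h3 g2 h.ha₃.2.2.2
  have d1' := Ne.symm d1
  have d2' := Ne.symm d2
  have d3' := Ne.symm d3
  rcases exists_shared_neighbor hx hy f1 k1 f2 k2 f3 k3 n1' with h | h | h | h | h | h
  · exact k5DeleteEdge_minor_of_K33_split hxy g1 g2 h2 h3 e3 k1 f3 d1 d2 d3 p1 p2 p3 q1 q2 q3 h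
  · exact k5DeleteEdge_minor_of_K33_split hxy g1 g2 h2 h3 e3 k3 f1 d3' d2' d1' p3 p2 p1 q3 q2 q1 h
  · exact k5DeleteEdge_minor_of_K33_split hxy g1 g2 h2 h3 e3 k2 f3 d1' d3 d2 p2 p1 p3 q2 q1 q3 h
  · exact k5DeleteEdge_minor_of_K33_split hxy g1 g2 h2 h3 e3 k3 f2 d2' d3' d1 p3 p1 p2 q3 q1 q2 h
  · exact k5DeleteEdge_minor_of_K33_split hxy g1 g2 h2 h3 e3 k1 f2 d2 d1 d3' p1 p3 p2 q1 q3 q2 h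
  · exact k5DeleteEdge_minor_of_K33_split hxy g1 g2 h2 h3 e3 k2 f1 d3 d1' d2' p2 p3 p1 q2 q3 q1 h

/-- A prism with a vertex split into `x` and `y`, described by its edges. -/
structure IsSplitPrism (G : SimpleGraph V) (x y a₂ a₃ b₁ b₂ b₃ : V) : Prop where
  hxy : G.Adj x y
  e1 : G.Adj a₂ a₃
  e2 : G.Adj a₂ b₂
  e3 : G.Adj a₃ b₃
  e4 : G.Adj b₁ b₂
  e5 : G.Adj b₁ b₃
  e6 : G.Adj b₂ b₃
  x2 : a₂ ≠ x
  x3 : a₃ ≠ x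
  x4 : b₁ ≠ x
  x5 : b₂ ≠ x
  x6 : b₃ ≠ x
  y2 : a₂ ≠ y
  y3 : a₃ ≠ y
  y4 : b₁ ≠ y
  y5 : b₂ ≠ y
  y6 : b₃ ≠ y
  n1 : a₂ ≠ b₁
  n2 : a₂ ≠ b₃
  n3 : a₃ ≠ b₁
  n4 : a₃ ≠ b₂

namespace IsSplitPrism

variable {G : SimpleGraph V} {x y a₂ a₃ b₁ b₂ b₃ : V}

theorem flip (s : G.IsSplitPrism x y a₂ a₃ b₁ b₂ b₃) : G.IsSplitPrism y x a₂ a₃ b₁ b₂ b₃ :=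
  ⟨s.hxy.symm, s.e1, s.e2, s.e3, s.e4, s.e5, s.e6, s.y2, s.y3, s.y4, s.y5, s.y6, s.x2, s.x3, s.x4,
    s.x5, s.x6, s.n1, s.n2, s.n3, s.n4⟩

theorem swap (s : G.IsSplitPrism x y a₂ a₃ b₁ b₂ b₃) : G.IsSplitPrism x y a₃ a₂ b₁ b₃ b₂ :=
  ⟨s.hxy, s.e1.symm, s.e3, s.e2, s.e5, s.e4, s.e6.symm, s.x3, s.x2, s.x4, s.x6, s.x5, s.y3, s.y2,
    s.y4, s.y6, s.y5, s.n3, s.n4, s.n1, s.n2⟩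

/-- The shared neighbour is the one in the opposite triangle. Contract `y a₃` and `a₂ b₂`; the pair
`x`, `b₃` may stay nonadjacent. -/
theorem minor_of_shared_b (s : G.IsSplitPrism x y a₂ a₃ b₁ b₂ b₃)
    (h : G.Adj x a₂ ∧ G.Adj x b₁ ∧ G.Adj y b₁ ∧ G.Adj y a₃) : IsGraphMinor K5DeleteEdge G := by
  obtain ⟨h1, h2, h3, h4⟩ := h
  refine k5DeleteEdge_minor {x} {b₃} {y, a₃} {a₂, b₂} {b₁} (G.connOn_singleton _)
    (G.connOn_singleton _) (connOn_pair h4) (connOn_pair s.e2) (G.connOn_singleton _)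
    ?_ ?_ ?_ ?_ ?_ ?_ ?_ ?_ ?_ ?_ (.of_adj s.hxy rfl (by simp)) (.of_adj h1 rfl (by simp))
    (.of_adj h2 rfl rfl) (.of_adj s.e3.symm rfl (by simp)) (.of_adj s.e6.symm rfl (by simp))
    (.of_adj s.e5.symm rfl rfl) (.of_adj s.e1.symm (by simp) (by simp)) (.of_adj h3 (by simp) rfl)
    (.of_adj s.e4.symm (by simp) rfl)
  all_goals
    simp [s.x6.symm, s.hxy.ne, s.x3.symm, s.x2.symm, s.x5.symm, s.x4.symm, s.y6, s.e3.ne', s.n2,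
      s.n2.symm, s.e6.ne', s.e5.ne', s.y2.symm, s.y2, s.y5, s.e1.ne, s.e1.ne', s.n4, s.n4.symm, s.y4, s.n3,
      s.n3.symm, s.n1.symm, s.e4.ne, s.n1, s.e4.ne', s.y5.symm, s.y4.symm]

/-- The shared neighbour is in the triangle of the split vertex. Contract `x b₁` and `a₃ b₃`; the
pair `y`, `b₂` may stay nonadjacent. -/
theorem minor_of_shared_a (s : G.IsSplitPrism x y a₂ a₃ b₁ b₂ b₃)
    (h : G.Adj x b₁ ∧ G.Adj x a₂ ∧ G.Adj y a₂ ∧ G.Adj y a₃) : IsGraphMinor K5DeleteEdge G := by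
  obtain ⟨h1, h2, h3, h4⟩ := h
  refine k5DeleteEdge_minor {y} {b₂} {x, b₁} {a₃, b₃} {a₂} (G.connOn_singleton _)
    (G.connOn_singleton _) (connOn_pair h1) (connOn_pair s.e3) (G.connOn_singleton _)
    ?_ ?_ ?_ ?_ ?_ ?_ ?_ ?_ ?_ ?_ (.of_adj s.hxy.symm rfl (by simp)) (.of_adj h4 rfl (by simp))
    (.of_adj h3 rfl rfl) (.of_adj s.e4.symm rfl (by simp)) (.of_adj s.e6 rfl (by simp))
    (.of_adj s.e2.symm rfl rfl) (.of_adj s.e5 (by simp) (by simp)) (.of_adj h2 (by simp) rfl)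
    (.of_adj s.e1.symm (by simp) rfl)
  all_goals
    simp [s.x6.symm, s.hxy.ne, s.hxy.ne', s.x3.symm, s.x2.symm, s.x5.symm, s.x4.symm, s.y6, s.e3.ne', s.n2,
      s.n2.symm, s.e6.ne', s.e6.ne, s.e5.ne', s.y2.symm, s.y2, s.y5, s.e1.ne, s.e1.ne', s.n4, s.n4.symm, s.y4, s.n3,
      s.n3.symm, s.n1.symm, s.e4.ne, s.n1, s.e4.ne', s.y5.symm, s.y4.symm, s.y3.symm, s.y6.symm,
      s.x5, s.x3, s.x6, s.x2, s.x4, s.e2.ne, s.e2.ne', s.e5.ne]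

end IsSplitPrism

theorem IsPrism.split_minor {G : SimpleGraph V} {x y : V} (hxy : G.Adj x y)
    (hx : G.ThreeLeDegree x) (hy : G.ThreeLeDegree y) {a₂ a₃ b₁ b₂ b₃ : V}
    {h0 : x ≠ y} {h2 : a₂ ≠ y} {h3 : a₃ ≠ y} {k1 : b₁ ≠ y} {k2 : b₂ ≠ y} {k3 : b₃ ≠ y}
    (h : (G.contractEdge x y).IsPrism ⟨x, h0⟩ ⟨a₂, h2⟩ ⟨a₃, h3⟩ ⟨b₁, k1⟩ ⟨b₂, k2⟩ ⟨b₃, k3⟩) :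
    IsGraphMinor K5DeleteEdge G := by
  obtain ⟨d1, d2, d3, n1⟩ := h.ha₁
  obtain ⟨e1, e2, e3, n2⟩ := h.hb₁
  obtain ⟨i1, i2, i3, n3⟩ := h.ha₂
  obtain ⟨j1, j2, j3, n4⟩ := h.ha₃
  have n5 := h.hb₂.2.2.2
  have n1' : ∀ w, w ≠ x → w ≠ y → ((G.Adj x w ∨ G.Adj y w) ↔ w = a₂ ∨ w = a₃ ∨ w = b₁) := by
    intro w hwx hwy
    rw [← contractEdge_adj_left h0 hwy hwx, n1]
    simp
  simp only [ne_eq, Subtype.mk.injEq] at d1 d2 d3 e1 e2 e3 i1 i2 i3 j1 j2 j3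
  have f3 : b₁ ≠ x := fun e => ((n1 ⟨b₁, k1⟩).2 (Or.inr (Or.inr rfl))).ne (Subtype.ext e.symm)
  have x2 : a₂ ≠ x := Ne.symm j1
  have x5 : b₂ ≠ x := Ne.symm i3
  have x6 : b₃ ≠ x := Ne.symm j2
  have s : G.IsSplitPrism x y a₂ a₃ b₁ b₂ b₃ :=
    ⟨hxy, (contractEdge_adj_of_ne h2 h3 x2 i1).1 ((n3 _).2 (by simp)),
      (contractEdge_adj_of_ne h2 k2 x2 x5).1 ((n3 _).2 (by simp)),
      (contractEdge_adj_of_ne h3 k3 i1 x6).1 ((n4 _).2 (by simp)),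
      (contractEdge_adj_of_ne k1 k2 f3 x5).1 ((n2 _).2 (by simp)),
      (contractEdge_adj_of_ne k1 k3 f3 x6).1 ((n2 _).2 (by simp)),
      (contractEdge_adj_of_ne k2 k3 x5 x6).1 ((n5 _).2 (by simp)),
      x2, i1, f3, x5, x6, h2, h3, k1, k2, k3, d2, j3, d3, i2⟩
  rcases exists_shared_neighbor hx hy x2 h2 i1 h3 f3 k1 n1' with h | h | h | h | h | h
  · exact s.flip.swap.minor_of_shared_a (by tauto)
  · exact s.swap.minor_of_shared_a (by tauto)
  · exact s.flip.minor_of_shared_a (by tauto)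
  · exact s.minor_of_shared_a (by tauto)
  · exact s.minor_of_shared_b (by tauto)
  · exact s.flip.minor_of_shared_b (by tauto)

end SimpleGraph

/-! ### Undoing a contraction: the induction for the structure theorem -/

namespace SimpleGraph

theorem IsWheel.of_card_eq_four {V : Type*} [Fintype V] {G : SimpleGraph V} (h4 : Fintype.card V = 4)
    (hdeg : ∀ v, G.ThreeLeDegree v) (h : V) : G.IsWheel h := by
  classical
  intro v hv
  have hc : (({h, v} : Finset V)ᶜ).card = 2 := by
    rw [Finset.card_compl, Finset.card_pair hv.symm, h4]
  obtain ⟨a, b, hab, he⟩ := Finset.card_eq_two.1 hc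
  have hall : ∀ z, z ≠ h → z ≠ v → z = a ∨ z = b := by
    intro z h1 h2
    have : z ∈ ({h, v} : Finset V)ᶜ := by simp [h1, h2]
    rw [he] at this
    simpa using this
  have ha : a ∈ ({h, v} : Finset V)ᶜ := by simp [he]
  have hb : b ∈ ({h, v} : Finset V)ᶜ := by simp [he]
  simp only [Finset.mem_compl, Finset.mem_insert, Finset.mem_singleton, not_or] at ha hb
  have adj : ∀ p q r, p ≠ v → q ≠ v → r ≠ v → (∀ z, z ≠ v → z = p ∨ z = q ∨ z = r) → G.Adj v p := by
    intro p q r hp hq hr hz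
    obtain ⟨w, hw, hwq, hwr⟩ := hdeg v q r
    rcases hz w hw.ne' with rfl | h | h
    exacts [hw, absurd h hwq, absurd h hwr]
  have hz : ∀ z, z ≠ v → z = h ∨ z = a ∨ z = b := fun z hz => by
    have := hall z
    tauto
  refine ⟨a, b, Ne.symm ha.1, Ne.symm hb.1, hab, fun w => ⟨fun hw => hz w hw.ne', ?_⟩⟩
  rintro (rfl | rfl | rfl)
  · exact adj w a b hv.symm ha.2 hb.2 hz
  · exact adj w h b ha.2 hv.symm hb.2 fun z h => by have := hz z h; tauto
  · exact adj w h a hb.2 hv.symm ha.2 fun z h => by have := hz z h; tauto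

variable {V : Type*} {G : SimpleGraph V} {x y : V}

theorem minor_or_of_contractEdge_wheel_hub (hxy : G.Adj x y) (hx : G.ThreeLeDegree x)
    (hy : G.ThreeLeDegree y) (hc : (G.contractEdge x y).NoTwoSep)
    (hw : (G.contractEdge x y).IsWheel ⟨x, hxy.ne⟩) :
    IsGraphMinor K5DeleteEdge G ∨ G.IsWheelPrismK33 := by
  have hall : ∀ v, v ≠ x → v ≠ y → G.Adj x v ∨ G.Adj y v := by
    intro v hvx hvy
    obtain ⟨c, d, -, -, -, h⟩ := hw ⟨v, hvy⟩ (fun e => hvx (Subtype.ext_iff.1 e))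
    exact (contractEdge_adj_left hxy.ne hvy hvx).1 ((h _).2 (Or.inl rfl)).symm
  have hrim : ∀ v, v ≠ x → v ≠ y → ∃ a b, a ≠ b ∧ a ≠ x ∧ a ≠ y ∧ b ≠ x ∧ b ≠ y ∧
      ∀ w, w ≠ x → w ≠ y → (G.Adj v w ↔ w = a ∨ w = b) := by
    intro v hvx hvy
    obtain ⟨⟨c, hcy⟩, ⟨d, hdy⟩, h1, h2, h3, h⟩ := hw ⟨v, hvy⟩ (fun e => hvx (Subtype.ext_iff.1 e))
    simp only [ne_eq, Subtype.mk.injEq] at h1 h2 h3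
    refine ⟨c, d, h3, Ne.symm h1, hcy, Ne.symm h2, hdy, fun w hwx hwy => ?_⟩
    rw [← contractEdge_adj_of_ne hvy hwy hvx hwx, h]
    simp [hwx]
  have hconn : ∀ c, ∀ C : Set V, C.Nonempty → x ∉ C → y ∉ C → c ∉ C →
      (∀ a ∈ C, ∀ d ∉ C, G.Adj a d → d = x ∨ d = y ∨ d = c) →
      ∀ w, w ∈ C ∨ w = x ∨ w = y ∨ w = c := by
    rintro c C ⟨u, hu⟩ hxC hyC hcC hcl w
    -- In the contraction the vertices `x`, `y`, `c` become a pair, to which 3-connectivity applies.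
    -- If `c = y` this pair degenerates to the single vertex `x`.
    obtain ⟨c', hc'C, hc'⟩ : ∃ c' : {v // v ≠ y}, c'.1 ∉ C ∧ ∀ w : {v // v ≠ y}, w.1 = c → w = c' := by
      by_cases h : c = y
      · exact ⟨⟨x, hxy.ne⟩, hxC, fun w hw => absurd (hw.trans h) w.2⟩
      · exact ⟨⟨c, h⟩, hcC, fun w hw => Subtype.ext hw⟩
    by_cases hwy : w = y
    · exact Or.inr (Or.inr (Or.inl hwy))
    have := hc.all (x := ⟨x, hxy.ne⟩) (y := c') (C := {v | v.1 ∈ C})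
      ⟨⟨u, fun e => hyC (e ▸ hu)⟩, hu⟩ hxC hc'C ?_ ⟨w, hwy⟩
    · rcases this with h | h | h
      · exact Or.inl h
      · exact Or.inr (Or.inl (Subtype.ext_iff.1 h))
      · by_cases hcy : c = y
        · have := hc.all (x := ⟨x, hxy.ne⟩) (y := ⟨x, hxy.ne⟩) (C := {v | v.1 ∈ C})
            ⟨⟨u, fun e => hyC (e ▸ hu)⟩, hu⟩ hxC hxC ?_ ⟨w, hwy⟩
          · rcases this with h | h | h
            · exact Or.inl h
            · exact Or.inr (Or.inl (Subtype.ext_iff.1 h))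
            · exact Or.inr (Or.inl (Subtype.ext_iff.1 h))
          · rintro ⟨a, hay⟩ haC ⟨d, hdy⟩ hdC had
            by_cases hdx : d = x
            · exact Or.inl (Subtype.ext hdx)
            · have hax : a ≠ x := fun e => hxC (e ▸ haC)
              have := hcl a haC d hdC ((contractEdge_adj_of_ne hay hdy hax hdx).1 had)
              rcases this with h | h | h
              exacts [absurd h hdx, absurd h hdy, absurd (h.trans hcy) hdy]
        · exact Or.inr (Or.inr (Or.inr ((Subtype.ext_iff.1 h).trans
            (Subtype.ext_iff.1 (hc' ⟨c, hcy⟩ rfl)).symm)))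
    · rintro ⟨a, hay⟩ haC ⟨d, hdy⟩ hdC had
      by_cases hdx : d = x
      · exact Or.inl (Subtype.ext hdx)
      · have hax : a ≠ x := fun e => hxC (e ▸ haC)
        have := hcl a haC d hdC ((contractEdge_adj_of_ne hay hdy hax hdx).1 had)
        rcases this with h | h | h
        exacts [absurd h hdx, absurd h hdy, Or.inr (hc' _ h)]
  by_cases hb : ∃ b, G.Adj x b ∧ G.Adj y b
  · obtain ⟨b, h1, h2⟩ := hb
    exact wheel_hub_split_of_common hxy hx hy hall hrim hconn h1 h2
  · exact wheel_hub_split_of_not_common hxy hx hy hall hrim hconn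
      fun v h1 h2 => hb ⟨v, h1, h2⟩

theorem isRimSplit_of_contractEdge (hxy : G.Adj x y) (hx : G.ThreeLeDegree x)
    (hy : G.ThreeLeDegree y) (hc : (G.contractEdge x y).NoTwoSep) {h : V} (hhy : h ≠ y)
    (hhx : h ≠ x) (hw : (G.contractEdge x y).IsWheel ⟨h, hhy⟩) :
    ∃ a b, G.IsRimSplit h x y a b := by
  obtain ⟨⟨a, hay⟩, ⟨b, hby⟩, h1, h2, h3, hN⟩ :=
    hw ⟨x, hxy.ne⟩ (fun e => hhx (Subtype.ext_iff.1 e).symm)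
  have hax : a ≠ x := fun e => ((hN ⟨a, hay⟩).2 (by simp)).ne (Subtype.ext e.symm)
  have hbx : b ≠ x := fun e => ((hN ⟨b, hby⟩).2 (by simp)).ne (Subtype.ext e.symm)
  simp only [ne_eq, Subtype.mk.injEq] at h1 h2 h3
  have hm : ∀ w, w ≠ x → w ≠ y → ((G.Adj x w ∨ G.Adj y w) ↔ w = h ∨ w = a ∨ w = b) := by
    intro w hwx hwy
    rw [← contractEdge_adj_left hxy.ne hwy hwx, hN]
    simp
  have side : ∀ a (hay : a ≠ y), a ≠ x → a ≠ h → (G.contractEdge x y).Adj ⟨x, hxy.ne⟩ ⟨a, hay⟩ →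
      ∃ a', a' ≠ x ∧ a' ≠ y ∧ a' ≠ h ∧
        ∀ w, w ≠ x → w ≠ y → (G.Adj a w ↔ w = h ∨ w = a') := by
    intro a hay hax hah hadj
    obtain ⟨⟨c, hcy⟩, ⟨d, hdy⟩, g1, g2, g3, hA⟩ := hw ⟨a, hay⟩ (fun e => hah (Subtype.ext_iff.1 e))
    have hxA := (hA _).1 hadj.symm
    simp only [ne_eq, Subtype.mk.injEq] at g1 g2 g3 hxA
    have hA' : ∀ w, w ≠ x → w ≠ y → (G.Adj a w ↔ w = h ∨ w = c ∨ w = d) := by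
      intro w hwx hwy
      rw [← contractEdge_adj_of_ne hay hwy hax hwx, hA]
      simp
    rcases hxA with e | e | e
    · exact absurd e.symm hhx
    · refine ⟨d, fun e' => g3 (e.symm.trans e'.symm), hdy, Ne.symm g2, fun w hwx hwy => ?_⟩
      rw [hA' w hwx hwy, ← e]
      simp [hwx]
    · refine ⟨c, fun e' => g3 (e'.trans e), hcy, Ne.symm g1, fun w hwx hwy => ?_⟩
      rw [hA' w hwx hwy, ← e]
      simp [hwx]
  refine ⟨a, b, hxy, hhx, hhy, hax, hay, Ne.symm h1, hbx, hby, Ne.symm h2, h3, hx, hy, ?_, hm,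
    side a hay hax (Ne.symm h1) ((hN _).2 (by simp)),
    side b hby hbx (Ne.symm h2) ((hN _).2 (by simp)), ?_, ?_⟩
  · intro v hvx hvy hvh
    obtain ⟨c, d, -, -, -, hA⟩ := hw ⟨v, hvy⟩ (fun e => hvh (Subtype.ext_iff.1 e))
    exact ((contractEdge_adj_of_ne hvy hhy hvx hhx).1 ((hA _).2 (Or.inl rfl))).symm
  · intro v hvx hvy hvh hva hvb
    obtain ⟨⟨c, hcy⟩, ⟨d, hdy⟩, g1, g2, g3, hA⟩ := hw ⟨v, hvy⟩ (fun e => hvh (Subtype.ext_iff.1 e))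
    have hno : ¬ (G.Adj x v ∨ G.Adj y v) := by
      rw [hm v hvx hvy]
      tauto
    have hcx : c ≠ x := by
      rintro rfl
      exact hno ((contractEdge_adj_left hxy.ne hvy hvx).1 ((hA _).2 (by simp)).symm)
    have hdx : d ≠ x := by
      rintro rfl
      exact hno ((contractEdge_adj_left hxy.ne hvy hvx).1 ((hA _).2 (by simp)).symm)
    simp only [ne_eq, Subtype.mk.injEq] at g1 g2 g3
    refine ⟨c, d, g1, g2, g3, fun w => ?_⟩
    by_cases hwx : w = x
    · subst hwx
      simp only [Ne.symm hhx, Ne.symm hcx, Ne.symm hdx, or_false, iff_false]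
      exact fun h => hno (Or.inl h.symm)
    by_cases hwy : w = y
    · subst hwy
      simp only [Ne.symm hhy, Ne.symm hcy, Ne.symm hdy, or_false, iff_false]
      exact fun h => hno (Or.inr h.symm)
    rw [← contractEdge_adj_of_ne hvy hwy hvx hwx, hA]
    simp
  -- The rim without the contracted vertex is connected because the hub and the contracted vertex do
  -- not separate the contraction.
  · refine ⟨⟨a, hax, hay, Ne.symm h1⟩, ?_⟩
    rintro C hC ⟨u, hu⟩ hcl v ⟨hvx, hvy, hvh⟩
    have := hc.all (x := ⟨x, hxy.ne⟩) (y := ⟨h, hhy⟩) (C := {v | v.1 ∈ C})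
      ⟨⟨u, (hC hu).2.1⟩, hu⟩ (fun h => (hC h).1 rfl) (fun h => (hC h).2.2 rfl) ?_ ⟨v, hvy⟩
    · rcases this with h | h | h
      exacts [h, absurd (Subtype.ext_iff.1 h) hvx, absurd (Subtype.ext_iff.1 h) hvh]
    · rintro ⟨a, hay⟩ haC ⟨d, hdy⟩ hdC had
      by_contra! hne
      have hdx : d ≠ x := fun e => hne.1 (Subtype.ext e)
      have hdh : d ≠ h := fun e => hne.2 (Subtype.ext e)
      exact hdC (hcl a haC d ⟨hdx, hdy, hdh⟩
        ((contractEdge_adj_of_ne hay hdy (hC haC).1 hdx).1 had))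

/-- A 3-connected graph without a minor `K₅` minus an edge is a wheel, a prism, or `K₃,₃`. -/
theorem NoTwoSep.isWheelPrismK33 {V : Type*} [Fintype V] {G : SimpleGraph V} (h : G.NoTwoSep)
    (h4 : 4 ≤ Fintype.card V) (hminor : ¬ IsGraphMinor K5DeleteEdge G) : G.IsWheelPrismK33 := by
  classical
  obtain ⟨k, hk⟩ : ∃ k, Fintype.card V = k + 4 := ⟨_, (Nat.sub_add_cancel h4).symm⟩
  induction k generalizing V with
  | zero =>
    have : Nonempty V := Fintype.card_pos_iff.1 (by omega)
    exact Or.inl ⟨Classical.arbitrary V, IsWheel.of_card_eq_four hk (h.threeLeDegree h4) _⟩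
  | succ k ih =>
    obtain ⟨x, y, hxy, hc⟩ := h.exists_contractible h4
    have hcard : Fintype.card {v : V // v ≠ y} = k + 4 := by
      rw [Fintype.card_subtype_compl, Fintype.card_subtype_eq, hk]
      rfl
    have hx := h.threeLeDegree h4 x
    have hy := h.threeLeDegree h4 y
    -- Splitting a prism or `K₃,₃` always creates the minor; prisms and `K₃,₃` arise only from
    -- splitting the hub of a wheel.
    rcases ih hc (by omega) (fun hm => hminor (hm.trans (contractEdge_minor hxy))) hcard with
      ⟨⟨w, hwy⟩, hw⟩ | ⟨a₁, a₂, a₃, b₁, b₂, b₃, hp⟩ | ⟨a₁, a₂, a₃, b₁, b₂, b₃, hp⟩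
    · by_cases hwx : w = x
      · subst hwx
        exact (minor_or_of_contractEdge_wheel_hub hxy hx hy hc hw).resolve_left hminor
      · obtain ⟨a, b, hs⟩ := isRimSplit_of_contractEdge hxy hx hy hc hwy hwx hw
        exact Or.inl (hs.minor_or_wheel.resolve_left hminor)
    · obtain ⟨c₂, c₃, d₁, d₂, d₃, hq⟩ := hp.exists_first ⟨x, hxy.ne⟩
      exact absurd (IsPrism.split_minor hxy hx hy hq) hminor
    · obtain ⟨c₂, c₃, d₁, d₂, d₃, hq⟩ := hp.exists_first ⟨x, hxy.ne⟩
      exact absurd (IsK33.split_minor hxy hx hy hq) hminor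

end SimpleGraph

/-! ### Pairs of cubic vertices away from a given edge -/

namespace SimpleGraph

variable {V : Type*} {G : SimpleGraph V}

/-- The vertex `v` has degree three. -/
def DegreeThree (G : SimpleGraph V) (v : V) : Prop :=
  ∃ a b c, G.Nbr3 v a b c

/-- There are two vertices of degree three different from `x` and `y` that are adjacent and have a
common neighbour, or that have the same neighbours, one of which has degree three and is different
from `x` and `y`. -/
def HasPairAvoiding (G : SimpleGraph V) (x y : V) : Prop :=
  ∃ u v, u ≠ x ∧ u ≠ y ∧ v ≠ x ∧ v ≠ y ∧ u ≠ v ∧ G.DegreeThree u ∧ G.DegreeThree v ∧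
    ((G.Adj u v ∧ ∃ z, G.Adj u z ∧ G.Adj v z) ∨
      ((∀ w, G.Adj u w ↔ G.Adj v w) ∧ ∃ a, a ≠ x ∧ a ≠ y ∧ G.Adj u a ∧ G.DegreeThree a))

/-- If the edge lies in a triangle, use two vertices of the other triangle; otherwise use the rest
of the triangle of `a₁`. The common neighbour itself may be an end of the edge. -/
theorem IsPrism.hasPairAvoiding {a₁ a₂ a₃ b₁ b₂ b₃ y : V}
    (h : G.IsPrism a₁ a₂ a₃ b₁ b₂ b₃) (hxy : G.Adj a₁ y) : G.HasPairAvoiding a₁ y := by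
  obtain ⟨p1, p2, p3, n1⟩ := h.ha₁
  obtain ⟨q1, q2, q3, n2⟩ := h.hb₁
  have A2 := h.ha₂
  have A3 := h.ha₃
  have B2 := h.hb₂
  have B3 := h.hb₃
  have e1 : G.Adj a₁ a₂ := (n1 _).2 (by simp)
  have e2 : G.Adj a₁ a₃ := (n1 _).2 (by simp)
  rcases (n1 y).1 hxy with rfl | rfl | rfl
  · exact ⟨b₁, b₂, ((n1 _).2 (by simp)).ne', Ne.symm p2, (A2.2.2.1).symm,
      ((A2.2.2.2 _).2 (by simp)).ne', ((n2 b₂).2 (by simp)).ne, ⟨_, _, _, h.hb₁⟩, ⟨_, _, _, h.hb₂⟩,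
      Or.inl ⟨(n2 _).2 (by simp), b₃, (n2 _).2 (by simp), (B2.2.2.2 _).2 (by simp)⟩⟩
  · exact ⟨b₁, b₂, ((n1 _).2 (by simp)).ne', Ne.symm p3, (A2.2.2.1).symm,
      A2.2.1.symm, ((n2 b₂).2 (by simp)).ne, ⟨_, _, _, h.hb₁⟩, ⟨_, _, _, h.hb₂⟩,
      Or.inl ⟨(n2 _).2 (by simp), b₃, (n2 _).2 (by simp), (B2.2.2.2 _).2 (by simp)⟩⟩
  · exact ⟨a₂, a₃, e1.ne', p2, e2.ne', p3, p1, ⟨_, _, _, h.ha₂⟩, ⟨_, _, _, h.ha₃⟩,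
      Or.inl ⟨(A2.2.2.2 _).2 (by simp), a₁, e1.symm, e2.symm⟩⟩

/-- The other two vertices in the class of `a₁` are twins, and the class of `y` has a further cubic
vertex. -/
theorem IsK33.hasPairAvoiding {a₁ a₂ a₃ b₁ b₂ b₃ y : V}
    (h : G.IsK33 a₁ a₂ a₃ b₁ b₂ b₃) (hxy : G.Adj a₁ y) : G.HasPairAvoiding a₁ y := by
  have key : ∀ b₁ b₂ b₃, G.IsK33 a₁ a₂ a₃ b₁ b₂ b₃ → G.HasPairAvoiding a₁ b₁ := by
    intro b₁ b₂ b₃ h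
    obtain ⟨p1, p2, p3, n1⟩ := h.ha₁
    obtain ⟨q1, q2, q3, n2⟩ := h.hb₁
    have n3 := h.ha₂.2.2.2
    have n4 := h.ha₃.2.2.2
    exact ⟨a₂, a₃, Ne.symm q1, ((n3 _).2 (by simp)).ne, Ne.symm q2, ((n4 _).2 (by simp)).ne, q3,
      ⟨_, _, _, h.ha₂⟩, ⟨_, _, _, h.ha₃⟩, Or.inr ⟨fun w => by rw [n3, n4], b₂,
        ((n1 _).2 (by simp)).ne', Ne.symm p1, (n3 _).2 (by simp), ⟨_, _, _, h.hb₂⟩⟩⟩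
  rcases (h.ha₁.2.2.2 y).1 hxy with rfl | rfl | rfl
  · exact key _ _ _ h
  · exact key _ _ _ h.swap.rotate.swap
  · exact key _ _ _ h.swap.rotate.rotate.swap

theorem HasPairAvoiding.symm {x y : V} (h : G.HasPairAvoiding x y) : G.HasPairAvoiding y x := by
  obtain ⟨u, v, h1, h2, h3, h4, h5, h6, h7, h8⟩ := h
  refine ⟨u, v, h2, h1, h4, h3, h5, h6, h7, h8.imp id ?_⟩
  rintro ⟨h, a, h1, h2, h3⟩
  exact ⟨h, a, h2, h1, h3⟩

/-- Two consecutive rim vertices have the hub as common neighbour. They can avoid the edge unless it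
lies on a triangular rim; then the graph is `K₄`, whose hub is cubic too. -/
theorem IsWheel.hasPairAvoiding {h x y : V} (hw : G.IsWheel h) (hsep : G.NoTwoSep)
    (hxy : G.Adj x y) : G.HasPairAvoiding x y := by
  have hub : ∀ y, G.Adj h y → G.HasPairAvoiding h y := by
    intro y hhy
    obtain ⟨a, b, p1, p2, p3, n1⟩ := hw y hhy.ne'
    have hya : G.Adj y a := (n1 _).2 (by simp)
    obtain ⟨v, hvh, hav, hvy⟩ : ∃ v, v ≠ h ∧ G.Adj a v ∧ v ≠ y := by
      obtain ⟨c, d, q1, q2, q3, n2⟩ := hw a (Ne.symm p1)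
      rcases (n2 y).1 hya.symm with rfl | rfl | rfl
      · exact absurd rfl hhy.ne
      · exact ⟨d, Ne.symm q2, (n2 _).2 (by simp), Ne.symm q3⟩
      · exact ⟨c, Ne.symm q1, (n2 _).2 (by simp), q3⟩
    have A := hw a (Ne.symm p1)
    have B := hw v hvh
    obtain ⟨_, _, A'⟩ := A
    obtain ⟨_, _, B'⟩ := B
    exact ⟨a, v, Ne.symm p1, hya.ne', hvh, hvy, hav.ne, ⟨_, _, _, A'⟩, ⟨_, _, _, B'⟩,
      Or.inl ⟨hav, h, (A'.2.2.2 _).2 (by simp), (B'.2.2.2 _).2 (by simp)⟩⟩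
  by_cases hxh : x = h
  · subst hxh
    exact hub y hxy
  by_cases hyh : y = h
  · subst hyh
    exact (hub x hxy.symm).symm
  obtain ⟨c, X⟩ : ∃ c, G.Nbr3 x h y c := by
    obtain ⟨c, d, X⟩ := hw x hxh
    rcases (X.2.2.2 y).1 hxy with rfl | rfl | rfl
    · exact absurd rfl hyh
    · exact ⟨_, X⟩
    · exact ⟨_, X.rotate.swap.rotate.rotate⟩
  obtain ⟨p1, p2, p3, n1⟩ := X
  have hxc : G.Adj x c := (n1 _).2 (by simp)
  have hc := hw c (Ne.symm p2)
  obtain ⟨d, hdh, hcd, hdx, n2⟩ : ∃ d, d ≠ h ∧ G.Adj c d ∧ d ≠ x ∧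
      ∀ w, G.Adj c w → w = h ∨ w = x ∨ w = d := by
    obtain ⟨e, f, q1, q2, q3, n⟩ := hc
    rcases (n x).1 hxc.symm with rfl | rfl | rfl
    · exact absurd rfl hxh
    · exact ⟨f, Ne.symm q2, (n _).2 (by simp), Ne.symm q3, fun w => (n w).1⟩
    · exact ⟨e, Ne.symm q1, (n _).2 (by simp), q3, fun w hw => by have := (n w).1 hw; tauto⟩
  have hch : G.Adj c h := by
    obtain ⟨e, f, q1, q2, q3, n⟩ := hc
    exact (n _).2 (by simp)
  have hc3 : G.DegreeThree c := by
    obtain ⟨e, f, q⟩ := hc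
    exact ⟨_, _, _, q⟩
  by_cases hdy : d = y
  · subst hdy
    obtain ⟨e, f, q1, q2, q3, n3⟩ := hw d hyh
    have hh : ∀ w, w ≠ h → G.Adj h w := by
      intro w hw'
      obtain ⟨e, f, q1, q2, q3, n⟩ := hw w hw'
      exact ((n _).2 (by simp)).symm
    have hdn : ∀ w, G.Adj d w → w = h ∨ w = x ∨ w = c := by
      have h1 := (n3 x).1 hxy.symm
      have h2 := (n3 c).1 hcd.symm
      have h3 := hxc.ne
      intro w hw'
      have := (n3 w).1 hw'
      grind
    -- The rim is the triangle `x`, `d`, `c`, and nothing but the hub lies outside it.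
    have all := hsep.all (x := h) (y := h) (C := {x, d, c}) ⟨x, by simp⟩
      (by simp [Ne.symm hxh, Ne.symm hyh, p2]) (by simp [Ne.symm hxh, Ne.symm hyh, p2]) (by
        simp only [Set.mem_insert_iff, Set.mem_singleton_iff]
        rintro w (rfl | rfl | rfl) e he hwe
        · have := (n1 e).1 hwe; tauto
        · have := hdn e hwe; tauto
        · have := n2 e hwe; tauto)
    refine ⟨c, h, hxc.ne', hcd.ne, Ne.symm hxh, Ne.symm hyh, hch.ne, hc3,
      ⟨x, d, c, hxy.ne, hxc.ne, hcd.ne', fun w => ⟨fun hw' => ?_, ?_⟩⟩,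
      Or.inl ⟨hch, x, hxc.symm, hh x hxh⟩⟩
    · have := all w
      have := hw'.ne'
      simp only [Set.mem_insert_iff, Set.mem_singleton_iff] at *
      tauto
    · rintro (rfl | rfl | rfl)
      exacts [hh _ hxh, hh _ hyh, hch.symm]
  · obtain ⟨e, f, D⟩ := hw d hdh
    exact ⟨c, d, hxc.ne', Ne.symm p3, hdx, hdy, hcd.ne, hc3, ⟨_, _, _, D⟩,
      Or.inl ⟨hcd, h, hch, (D.2.2.2 _).2 (by simp)⟩⟩

/-- The side `C` of a separation with an additional edge between the separating vertices. -/
def torso (G : SimpleGraph V) (C : Set V) (s t : V) :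
    SimpleGraph {v : V // v ∈ C ∨ v = s ∨ v = t} where
  Adj a b := G.Adj a b ∨ (a ≠ b ∧ ((a.1 = s ∧ b.1 = t) ∨ (a.1 = t ∧ b.1 = s)))
  symm := ⟨fun a b h => by
    rcases h with h | ⟨h, h'⟩
    · exact Or.inl h.symm
    · exact Or.inr ⟨h.symm, by tauto⟩⟩
  loopless := ⟨fun a h => by
    rcases h with h | h
    · exact G.irrefl h
    · exact h.1 rfl⟩

theorem torso_adj_of_ne {C : Set V} {s t : V} {a b : {v : V // v ∈ C ∨ v = s ∨ v = t}}
    (hs : a.1 ≠ s) (ht : a.1 ≠ t) : (G.torso C s t).Adj a b ↔ G.Adj a b := by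
  simp [torso, hs, ht]

theorem torso_minor_of_eq {C : Set V} {s : V} : IsGraphMinor (G.torso C s s) G := by
  refine ⟨fun a => {a.1}, fun a => (G.connOn_singleton _).connected, ?_, ?_⟩
  · intro a b hab
    simpa [Subtype.ext_iff] using hab
  · rintro a b (h | ⟨hne, h⟩)
    · exact ⟨a, rfl, b, rfl, h⟩
    · refine absurd (Subtype.ext ?_) hne
      rcases h with h | h <;> rw [h.1, h.2]

/-- The added edge is realized by a connected set on the other side: `K` is absorbed into the branch
set of `t`. -/
theorem torso_minor {C K : Set V} {s t : V} (hK : G.ConnOn K) (hst : s ≠ t) (hKC : Disjoint K C)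
    (hsK : s ∉ K) (htK : t ∉ K) (hs : ∃ k ∈ K, G.Adj s k) (ht : ∃ k ∈ K, G.Adj t k) :
    IsGraphMinor (G.torso C s t) G := by
  obtain ⟨k, hk, hsk⟩ := hs
  obtain ⟨l, hl, htl⟩ := ht
  have hnot : ∀ a : {v : V // v ∈ C ∨ v = s ∨ v = t}, a.1 ∉ K := by
    rintro ⟨a, ha | rfl | rfl⟩ h
    exacts [Set.disjoint_left.1 hKC h ha, hsK h, htK h]
  refine ⟨fun a => {v | v = a.1 ∨ (a.1 = t ∧ v ∈ K)}, fun a => ?_, ?_, ?_⟩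
  · by_cases ha : a.1 = t
    · have : {v | v = a.1 ∨ (a.1 = t ∧ v ∈ K)} = insert t K := by
        ext v; simp [ha]
      beta_reduce
      rw [this]
      exact (hK.insert hl htl).connected
    · have : {v | v = a.1 ∨ (a.1 = t ∧ v ∈ K)} = {a.1} := by
        ext v; simp [ha]
      beta_reduce
      rw [this]
      exact (G.connOn_singleton _).connected
  · intro a b hab
    rw [Set.disjoint_left]
    rintro v (rfl | ⟨h1, h2⟩) (h | ⟨h3, h4⟩)
    · exact hab (Subtype.ext h)
    · exact hnot _ h4
    · exact hnot _ (h ▸ h2)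
    · exact hab (Subtype.ext (h1.trans h3.symm))
  · rintro a b (h | ⟨hne, h | h⟩)
    · exact ⟨a, Or.inl rfl, b, Or.inl rfl, h⟩
    · exact ⟨a, Or.inl rfl, k, Or.inr ⟨h.2, hk⟩, by rw [h.1]; exact hsk⟩
    · exact ⟨k, Or.inr ⟨h.1, hk⟩, b, Or.inl rfl, by rw [h.2]; exact hsk.symm⟩

/-- Vertices inside `C` have the same neighbours in the torso and in `G`, so the properties of a
pair carry over if it avoids `s` and `t`. -/
theorem IsSep.hasPairAvoiding_of_torso {C : Set V} {s t x y : V} (hC : G.IsSep s t t C)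
    (hx : x ∉ C) (hy : y ∉ C)
    (h : (G.torso C s t).HasPairAvoiding ⟨s, Or.inr (Or.inl rfl)⟩ ⟨t, Or.inr (Or.inr rfl)⟩) :
    G.HasPairAvoiding x y := by
  have mem : ∀ a : {v : V // v ∈ C ∨ v = s ∨ v = t}, a ≠ ⟨s, Or.inr (Or.inl rfl)⟩ →
      a ≠ ⟨t, Or.inr (Or.inr rfl)⟩ → a.1 ∈ C ∧ a.1 ≠ s ∧ a.1 ≠ t ∧ a.1 ≠ x ∧ a.1 ≠ y := by
    rintro ⟨a, ha⟩ h1 h2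
    have h1' : a ≠ s := fun e => h1 (Subtype.ext e)
    have h2' : a ≠ t := fun e => h2 (Subtype.ext e)
    have haC : a ∈ C := by tauto
    exact ⟨haC, h1', h2', fun e => hx (e ▸ haC), fun e => hy (e ▸ haC)⟩
  have nb : ∀ a ∈ C, ∀ w, G.Adj a w → w ∈ C ∨ w = s ∨ w = t := by
    intro a ha w haw
    by_cases hw : w ∈ C
    · exact Or.inl hw
    · have := hC.closed a ha w hw haw
      tauto
  have deg : ∀ a : {v : V // v ∈ C ∨ v = s ∨ v = t}, a.1 ∈ C → a.1 ≠ s → a.1 ≠ t →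
      (G.torso C s t).DegreeThree a → G.DegreeThree a.1 := by
    rintro a ha hs ht ⟨b, c, d, h1, h2, h3, h4⟩
    refine ⟨b, c, d, fun e => h1 (Subtype.ext e), fun e => h2 (Subtype.ext e),
      fun e => h3 (Subtype.ext e), fun w => ⟨fun haw => ?_, fun hw => ?_⟩⟩
    · have := (h4 ⟨w, nb _ ha _ haw⟩).1 ((torso_adj_of_ne hs ht).2 haw)
      simpa [Subtype.ext_iff] using this
    · rcases hw with rfl | rfl | rfl
      · exact (torso_adj_of_ne hs ht).1 ((h4 b).2 (by simp))
      · exact (torso_adj_of_ne hs ht).1 ((h4 c).2 (by simp))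
      · exact (torso_adj_of_ne hs ht).1 ((h4 d).2 (by simp))
  obtain ⟨u, v, h1, h2, h3, h4, h5, h6, h7, h8⟩ := h
  obtain ⟨huC, hus, hut, hux, huy⟩ := mem u h1 h2
  obtain ⟨hvC, hvs, hvt, hvx, hvy⟩ := mem v h3 h4
  refine ⟨u, v, hux, huy, hvx, hvy, fun e => h5 (Subtype.ext e), deg u huC hus hut h6,
    deg v hvC hvs hvt h7, ?_⟩
  rcases h8 with ⟨h8, z, h9, h10⟩ | ⟨h8, a, h9, h10, h11, h12⟩
  · exact Or.inl ⟨(torso_adj_of_ne hus hut).1 h8, z, (torso_adj_of_ne hus hut).1 h9,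
      (torso_adj_of_ne hvs hvt).1 h10⟩
  · obtain ⟨haC, has, hat, hax, hay⟩ := mem a h9 h10
    refine Or.inr ⟨fun w => ⟨fun hw => ?_, fun hw => ?_⟩, a, hax, hay,
      (torso_adj_of_ne hus hut).1 h11, deg a haC has hat h12⟩
    · exact (torso_adj_of_ne hvs hvt).1
        ((h8 ⟨w, nb _ huC _ hw⟩).1 ((torso_adj_of_ne hus hut).2 hw))
    · exact (torso_adj_of_ne hus hut).1
        ((h8 ⟨w, nb _ hvC _ hw⟩).2 ((torso_adj_of_ne hvs hvt).2 hw))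

/-- The torso of a side is a minor if no single vertex separates the graph. -/
theorem IsSep.torso_minor [Finite V] {C : Set V} {s t : V} (hC : G.IsSep s t t C)
    (h1 : ∀ s C, ¬ G.IsSep s s s C) : IsGraphMinor (G.torso C s t) G := by
  by_cases hst : s = t
  · subst hst
    exact torso_minor_of_eq
  -- A smallest such set is connected: it is a component of the other side.
  let P : Set V → Prop := fun K => K.Nonempty ∧ (∀ k ∈ K, k ∉ C ∧ k ≠ s ∧ k ≠ t) ∧
    ∀ c ∈ K, ∀ d ∉ K, G.Adj c d → d = s ∨ d = t
  have hex : ∃ k, ∃ K, P K ∧ K.ncard = k := by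
    refine ⟨_, {v | v ∉ C ∧ v ≠ s ∧ v ≠ t}, ⟨?_, fun k hk => hk, ?_⟩, rfl⟩
    · obtain ⟨w, h1, h2, h3, _⟩ := hC.other
      exact ⟨w, h1, h2, h3⟩
    · rintro c ⟨hcC, hcs, hct⟩ d hd hcd
      simp only [Set.mem_ofPred_eq, not_and_or, not_not] at hd
      rcases hd with hd | hd
      · have := hC.closed d hd c hcC hcd.symm
        tauto
      · exact hd
  classical
  obtain ⟨K, ⟨hKn, hKC, hKcl⟩, hK⟩ := Nat.find_spec hex
  have hmin : ∀ K', P K' → K.ncard ≤ K'.ncard := fun K' h => by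
    rw [hK]
    exact Nat.find_min' hex ⟨K', h, rfl⟩
  -- If one of `s`, `t` had no neighbour in `K`, the other would be a cut vertex.
  have link : ∀ s t, t ∉ C → (∀ k ∈ K, k ≠ s ∧ k ≠ t) → (∀ c ∈ K, ∀ d ∉ K, G.Adj c d → d = s ∨ d = t) →
      ∃ k ∈ K, G.Adj s k := by
    intro s t htC hne hcl
    by_contra! hno
    obtain ⟨c, hc⟩ := hC.nonempty
    refine h1 t K ⟨hKn, fun h => (hne t h).2 rfl, fun h => (hne t h).2 rfl,
      fun h => (hne t h).2 rfl, ?_, ?_⟩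
    · intro c hc d hd hcd
      rcases hcl c hc d hd hcd with rfl | h
      · exact absurd hcd.symm (hno c hc)
      · exact Or.inl h
    · have hct : c ≠ t := fun e => htC (e ▸ hc)
      exact ⟨c, fun h => (hKC c h).1 hc, hct, hct, hct⟩
  refine SimpleGraph.torso_minor (K := K) ⟨hKn, ?_⟩ hst (Set.disjoint_left.2 fun k hk => (hKC k hk).1)
    (fun h => (hKC s h).2.1 rfl) (fun h => (hKC t h).2.2 rfl)
    (link s t hC.hy (fun k hk => (hKC k hk).2) hKcl)
    (link t s hC.hx (fun k hk => (hKC k hk).2.symm) fun c hc d hd h => (hKcl c hc d hd h).symm)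
  intro D hDK hDn hDcl
  have := hmin D ⟨hDn, fun k hk => hKC k (hDK hk), fun c hc d hd hcd =>
    hKcl c (hDK hc) d (fun hdK => hd (hDcl c hc d hdK hcd)) hcd⟩
  exact (Set.eq_of_subset_of_ncard_le hDK this (Set.toFinite K)).ge

/-- A graph without a minor `K₅` minus an edge in which all vertices, except perhaps the ends of one
edge, have at least three neighbours, has a pair of mergeable vertices. -/
theorem hasPairAvoiding_of_not_minor [Fintype V] (hminor : ¬ IsGraphMinor K5DeleteEdge G) {x y : V}
    (hxy : x = y ∨ G.Adj x y) (hne : ∃ v, v ≠ x ∧ v ≠ y)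
    (hdeg : ∀ v, v ≠ x → v ≠ y → G.ThreeLeDegree v) : G.HasPairAvoiding x y := by
  classical
  obtain ⟨k, hk⟩ : ∃ k, Fintype.card V = k := ⟨_, rfl⟩
  induction k using Nat.strong_induction_on generalizing V with
  | _ k ih =>
    -- In the torso of a side that avoids `x` and `y`, only `s` and `t` may have lost neighbours, so
    -- they take over the role of the exceptional edge in the induction.
    have step : ∀ s t C, G.IsSep s t t C → (∀ D, G.IsSep s t t D → IsGraphMinor (G.torso D s t) G) →
        G.HasPairAvoiding x y := by
      intro s t C hC hm
      obtain ⟨D, hD, hxD, hyD⟩ := hC.exists_avoiding hxy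
      refine hD.hasPairAvoiding_of_torso hxD hyD ?_
      refine ih _ ?_ (fun h => hminor (h.trans (hm D hD))) ?_ ?_ ?_ rfl
      · rw [← hk]
        obtain ⟨w, h1, h2, h3, _⟩ := hD.other
        exact Fintype.card_subtype_lt (x := w) (by tauto)
      · by_cases hst : s = t
        · exact Or.inl (Subtype.ext hst)
        · exact Or.inr (Or.inr ⟨fun e => hst (Subtype.ext_iff.1 e), Or.inl ⟨rfl, rfl⟩⟩)
      · obtain ⟨c, hc⟩ := hD.nonempty
        exact ⟨⟨c, Or.inl hc⟩, fun e => hD.hx ((Subtype.mk.inj e) ▸ hc),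
          fun e => hD.hy ((Subtype.mk.inj e) ▸ hc)⟩
      · rintro ⟨v, hv⟩ hvs hvt a b
        have hvs' : v ≠ s := fun e => hvs (Subtype.ext e)
        have hvt' : v ≠ t := fun e => hvt (Subtype.ext e)
        have hvD : v ∈ D := by tauto
        obtain ⟨w, hw, hwa, hwb⟩ := hdeg v (fun e => hxD (e ▸ hvD)) (fun e => hyD (e ▸ hvD)) a b
        have hwD : w ∈ D ∨ w = s ∨ w = t := by
          by_cases h : w ∈ D
          · exact Or.inl h
          · have := hD.closed v hvD w h hw
            tauto
        exact ⟨⟨w, hwD⟩, Or.inl hw, fun e => hwa (congrArg Subtype.val e),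
          fun e => hwb (congrArg Subtype.val e)⟩
    by_cases h1 : ∃ s C, G.IsSep s s s C
    · obtain ⟨s, C, hC⟩ := h1
      exact step s s C hC fun D _ => torso_minor_of_eq
    push Not at h1
    by_cases h2 : ∃ s t C, G.IsSep s t t C
    · obtain ⟨s, t, C, hC⟩ := h2
      exact step s t C hC fun D hD => hD.torso_minor h1
    have hsep : G.NoTwoSep := fun s t C hC => h2 ⟨s, t, C, hC⟩
    obtain ⟨v, hvx, hvy⟩ := hne
    have h4 : 4 ≤ Fintype.card V := by
      obtain ⟨a, ha, _⟩ := hdeg v hvx hvy v v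
      obtain ⟨b, hb, hba, _⟩ := hdeg v hvx hvy a a
      obtain ⟨c, hc, hca, hcb⟩ := hdeg v hvx hvy a b
      have : ({v, a, b, c} : Finset V).card = 4 := by
        simp [ha.ne, hb.ne, hc.ne, hba.symm, hca.symm, hcb.symm]
      rw [← this]
      exact Finset.card_le_univ _
    have key : ∀ y, G.Adj x y → G.HasPairAvoiding x y := by
      intro y hxy
      rcases hsep.isWheelPrismK33 h4 hminor with
        ⟨w, hw⟩ | ⟨a₁, a₂, a₃, b₁, b₂, b₃, hp⟩ | ⟨a₁, a₂, a₃, b₁, b₂, b₃, hp⟩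
      · exact hw.hasPairAvoiding hsep hxy
      · obtain ⟨c₂, c₃, d₁, d₂, d₃, hq⟩ := hp.exists_first x
        exact hq.hasPairAvoiding hxy
      · obtain ⟨c₂, c₃, d₁, d₂, d₃, hq⟩ := hp.exists_first x
        exact hq.hasPairAvoiding hxy
    -- If `x = y`, avoid the ends of an arbitrary edge at `x`, which is more than required.
    rcases hxy with rfl | hxy
    · obtain ⟨y, hy, _⟩ := hsep.threeLeDegree h4 x x x
      obtain ⟨u, v, h1, h2, h3, h4, h5, h6, h7, h8⟩ := key y hy
      refine ⟨u, v, h1, h1, h3, h3, h5, h6, h7, h8.imp id ?_⟩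
      rintro ⟨h, a, h1, h2, h3⟩
      exact ⟨h, a, h1, h1, h3⟩
    · exact key y hxy

end SimpleGraph

/-! ### A program logic for the machine -/

namespace RAM

namespace State

variable (s : State) (x a i v : ℕ) (r : ℝ)

@[simp] theorem setReg_reg (y : ℕ) : (s.setReg x v).reg y = if y = x then v else s.reg y := by
  simp [setReg, Function.update_apply]

@[simp] theorem setReg_arr : (s.setReg x v).arr = s.arr := rfl
@[simp] theorem setReg_wreg : (s.setReg x v).wreg = s.wreg := rfl
@[simp] theorem setReg_warr : (s.setReg x v).warr = s.warr := rfl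
@[simp] theorem setArr_reg : (s.setArr a i v).reg = s.reg := rfl
@[simp] theorem setArr_wreg : (s.setArr a i v).wreg = s.wreg := rfl
@[simp] theorem setArr_warr : (s.setArr a i v).warr = s.warr := rfl

@[simp] theorem setArr_arr (b j : ℕ) :
    (s.setArr a i v).arr b j = if b = a ∧ j = i then v else s.arr b j := by
  by_cases h : b = a
  · subst h; simp [setArr, Function.update_apply]
  · simp [setArr, Function.update_apply, h]

@[simp] theorem setWReg_reg : (s.setWReg x r).reg = s.reg := rfl
@[simp] theorem setWReg_arr : (s.setWReg x r).arr = s.arr := rfl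
@[simp] theorem setWReg_warr : (s.setWReg x r).warr = s.warr := rfl

@[simp] theorem setWReg_wreg (y : ℕ) : (s.setWReg x r).wreg y = if y = x then r else s.wreg y := by
  simp [setWReg, Function.update_apply]

@[simp] theorem setWArr_reg : (s.setWArr a i r).reg = s.reg := rfl
@[simp] theorem setWArr_arr : (s.setWArr a i r).arr = s.arr := rfl
@[simp] theorem setWArr_wreg : (s.setWArr a i r).wreg = s.wreg := rfl

@[simp] theorem setWArr_warr (b j : ℕ) :
    (s.setWArr a i r).warr b j = if b = a ∧ j = i then r else s.warr b j := by
  by_cases h : b = a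
  · subst h; simp [setWArr, Function.update_apply]
  · simp [setWArr, Function.update_apply, h]

end State

variable {I : Input} {B : ℕ}

/-- From `s` the program `p` halts within `T` steps in a state with property `Q`. -/
def Ok (I : Input) (B : ℕ) (p : Program) (s : State) (T : ℕ) (Q : State → Prop) : Prop :=
  ∃ s' t, Run I B p s s' t ∧ t ≤ T ∧ Q s'

theorem Ok.mono {p : Program} {s : State} {T T' : ℕ} {Q Q' : State → Prop}
    (h : Ok I B p s T Q) (hT : T ≤ T') (hQ : ∀ s, Q s → Q' s) : Ok I B p s T' Q' := by
  obtain ⟨s', t, h1, h2, h3⟩ := h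
  exact ⟨s', t, h1, h2.trans hT, hQ _ h3⟩

theorem Ok.seq {p q : Program} {s : State} {T T' : ℕ} {Q R : State → Prop}
    (hp : Ok I B p s T R) (hq : ∀ s, R s → Ok I B q s T' Q) :
    Ok I B (.seq p q) s (T + T') Q := by
  obtain ⟨s', t, h1, h2, h3⟩ := hp
  obtain ⟨s'', t', h4, h5, h6⟩ := hq s' h3
  exact ⟨s'', t + t', .seq h1 h4, by omega, h6⟩

theorem Ok.ite {c : Test} {p q : Program} {s : State} {T : ℕ} {Q : State → Prop}
    (hp : c.Holds I s → Ok I B p s T Q) (hq : ¬ c.Holds I s → Ok I B q s T Q) :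
    Ok I B (.ite c p q) s (T + 1) Q := by
  by_cases hc : c.Holds I s
  · obtain ⟨s', t, h1, h2, h3⟩ := hp hc
    exact ⟨s', t + 1, .ite_true hc h1, by omega, h3⟩
  · obtain ⟨s', t, h1, h2, h3⟩ := hq hc
    exact ⟨s', t + 1, .ite_false hc h1, by omega, h3⟩

/-- The weakest precondition of a program without loops. -/
def wp (I : Input) (B : ℕ) : Program → (State → Prop) → State → Prop
  | .skip, Q, s => Q s
  | .const x k, Q, s => k ≤ B ∧ Q (s.setReg x k)
  | .copy x y, Q, s => Q (s.setReg x (s.reg y))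
  | .arith o x y z, Q, s =>
      o.eval (s.reg y) (s.reg z) ≤ B ∧ Q (s.setReg x (o.eval (s.reg y) (s.reg z)))
  | .load x a y, Q, s => Q (s.setReg x (s.arr a (s.reg y)))
  | .store a x y, Q, s => Q (s.setArr a (s.reg x) (s.reg y))
  | .weight x y z, Q, s => Q (s.setWReg x (I.weightAt (s.reg y) (s.reg z)))
  | .wzero x, Q, s => Q (s.setWReg x 0)
  | .wcopy x y, Q, s => Q (s.setWReg x (s.wreg y))
  | .wadd x y z, Q, s => Q (s.setWReg x (s.wreg y + s.wreg z))
  | .wload x a y, Q, s => Q (s.setWReg x (s.warr a (s.reg y)))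
  | .wstore a x y, Q, s => Q (s.setWArr a (s.reg x) (s.wreg y))
  | .seq p q, Q, s => wp I B p (wp I B q Q) s
  | .ite c p q, Q, s => (c.Holds I s → wp I B p Q s) ∧ (¬ c.Holds I s → wp I B q Q s)
  | .loop _ _, _, _ => False

/-- A bound for the number of steps of a program without loops. -/
def cost : Program → ℕ
  | .seq p q => cost p + cost q
  | .ite _ p q => cost p + cost q + 1
  | _ => 1

/-- Code without loops is verified by evaluating `wp`, and `cost` then gives a constant bound for
its running time. Loops have a false precondition and are treated by `ok_forUp`. -/
theorem ok_of_wp {p : Program} {s : State} {Q : State → Prop} (h : wp I B p Q s) :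
    Ok I B p s (cost p) Q := by
  induction p generalizing s Q with
  | skip => exact ⟨_, _, .skip s, le_rfl, h⟩
  | const x k => exact ⟨_, _, .const s x k h.1, le_rfl, h.2⟩
  | copy x y => exact ⟨_, _, .copy s x y, le_rfl, h⟩
  | arith o x y z => exact ⟨_, _, .arith s o x y z h.1, le_rfl, h.2⟩
  | load x a y => exact ⟨_, _, .load s x a y, le_rfl, h⟩
  | store a x y => exact ⟨_, _, .store s a x y, le_rfl, h⟩
  | weight x y z => exact ⟨_, _, .weight s x y z, le_rfl, h⟩
  | wzero x => exact ⟨_, _, .wzero s x, le_rfl, h⟩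
  | wcopy x y => exact ⟨_, _, .wcopy s x y, le_rfl, h⟩
  | wadd x y z => exact ⟨_, _, .wadd s x y z, le_rfl, h⟩
  | wload x a y => exact ⟨_, _, .wload s x a y, le_rfl, h⟩
  | wstore a x y => exact ⟨_, _, .wstore s a x y, le_rfl, h⟩
  | seq p q ihp ihq => exact (ihp h).seq fun s hs => ihq hs
  | ite c p q ihp ihq =>
    exact (Ok.ite (T := cost p + cost q) (fun hc => (ihp (h.1 hc)).mono (by omega) fun _ h => h)
      fun hc => (ihq (h.2 hc)).mono (by omega) fun _ h => h)
  | loop c p _ => exact h.elim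

/-- The program that runs the programs of a list one after another. -/
def block : List Program → Program
  | [] => .skip
  | [p] => p
  | p :: q :: l => .seq p (block (q :: l))

/-- Run `p` with register `i` counting from `0` to `n - 1`; register `0` contains `n` and register
`1` contains `1`. -/
def forUp (i : ℕ) (p : Program) : Program :=
  .seq (.const i 0) (.loop (.lt i 0) (.seq p (.arith .add i i 1)))

/-- The invariant must not depend on the counter. Each round costs the body, a test and an
increment; the final summand `2` pays for the initialization and the last test. -/
theorem ok_forUp {i n T : ℕ} {p : Program} {s : State} (Inv : ℕ → State → Prop) (hn : n ≤ B)
    (hreg : ∀ k s, Inv k s → s.reg 0 = n ∧ s.reg 1 = 1)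
    (hset : ∀ k s v, Inv k s → Inv k (s.setReg i v))
    (hbody : ∀ k < n, ∀ s, Inv k s → s.reg i = k →
      Ok I B p s T fun s' => Inv (k + 1) s' ∧ s'.reg i = k)
    (h0 : Inv 0 s) : Ok I B (forUp i p) s (n * (T + 2) + 2) (Inv n) := by
  have main : ∀ m k s, k + m = n → Inv k s → s.reg i = k →
      Ok I B (.loop (.lt i 0) (.seq p (.arith .add i i 1))) s (m * (T + 2) + 1) (Inv n) := by
    intro m
    induction m with
    | zero =>
      intro k s hk hs hsi
      have hk' : k = n := by omega
      subst hk'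
      refine ⟨s, 1, .loop_false ?_, by omega, hs⟩
      simp [Test.Holds, hsi, (hreg k s hs).1]
    | succ m ih =>
      intro k s hk hs hsi
      obtain ⟨s1, t1, r1, b1, hs1, hi1⟩ := hbody k (by omega) s hs hsi
      have h1 := hreg _ _ hs1
      have hv : Op.add.eval (s1.reg i) (s1.reg 1) = k + 1 := by simp [Op.eval, hi1, h1.2]
      obtain ⟨s2, t2, r2, b2, hs2⟩ := ih (k + 1) (s1.setReg i (k + 1)) (by omega)
        (hset _ _ _ hs1) (by simp)
      have r3 : Run I B (.arith .add i i 1) s1 (s1.setReg i (k + 1)) 1 := by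
        have := Run.arith (I := I) (B := B) s1 .add i i 1 (by rw [hv]; omega)
        rwa [hv] at this
      refine ⟨s2, _, .loop_true (by simp [Test.Holds, hsi, (hreg k s hs).1]; omega) (.seq r1 r3) r2,
        ?_, hs2⟩
      have : (m + 1) * (T + 2) = m * (T + 2) + T + 2 := by ring
      omega
  obtain ⟨s', t, r, b, hs'⟩ := main n 0 (s.setReg i 0) (by omega) (hset _ _ _ h0) (by simp)
  exact ⟨s', _, .seq (.const s i 0 (Nat.zero_le B)) r, by omega, hs'⟩

end RAM

/-! ### Cuts of weight matrices and merging of two rows -/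

open Finset

section Sums

variable {n : ℕ}

open Classical in
/-- The weight of the cut given by `U`, for a weight matrix on the vertices `0, …, n - 1`. -/
noncomputable def cutM (n : ℕ) (W : ℕ → ℕ → ℝ) (U : Set ℕ) : ℝ :=
  ∑ a ∈ range n, ∑ b ∈ range n, if a ∈ U ∧ b ∉ U then W a b else 0

/-- The sum of the entries of row `x`. -/
def rowSum (n : ℕ) (W : ℕ → ℕ → ℝ) (x : ℕ) : ℝ :=
  ∑ b ∈ range n, W x b

/-- The positive entries of row `x`. -/
noncomputable def nbrs (n : ℕ) (W : ℕ → ℕ → ℝ) (x : ℕ) : Finset ℕ :=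
  open Classical in (range n).filter fun b => 0 < W x b

open Classical in
/-- The total weight of the entries of row `x` in the columns `U`. -/
noncomputable def rowSumOn (n : ℕ) (W : ℕ → ℕ → ℝ) (x : ℕ) (U : Set ℕ) : ℝ :=
  ∑ b ∈ range n, if b ∈ U then W x b else 0

/-- The map that sends `u` to `v`. -/
def foldMap (u v i : ℕ) : ℕ :=
  if i = u then v else i

/-- The weight matrix where the vertex `u` is merged into `v`. -/
noncomputable def mergeW (W : ℕ → ℕ → ℝ) (u v a b : ℕ) : ℝ :=
  if a = u ∨ b = u ∨ a = b then 0
  else W a b + (if a = v then W u b else 0) + (if b = v then W a u else 0)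

/-- The term of `u` is moved to `v`. Applied to rows and to columns, this gives `cutM_mergeW`. -/
theorem sum_foldMap {u v : ℕ} (hu : u < n) (hv : v < n) (huv : u ≠ v) (F : ℕ → ℕ → ℝ) :
    ∑ i ∈ range n, F (foldMap u v i) i =
      ∑ i ∈ range n, if i = u then 0 else (F i i + if i = v then F v u else 0) := by
  rw [← add_sum_erase _ _ (mem_range.2 hu),
    ← add_sum_erase _ (fun i => if i = u then 0 else (F i i + if i = v then F v u else 0))
      (mem_range.2 hu)]
  have h1 : ∑ x ∈ (range n).erase u, F (foldMap u v x) x = ∑ x ∈ (range n).erase u, F x x :=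
    sum_congr rfl fun x hx => by simp [foldMap, (mem_erase.1 hx).1]
  have h2 : (∑ x ∈ (range n).erase u, if x = u then 0 else (F x x + if x = v then F v u else 0)) =
      ∑ x ∈ (range n).erase u, (F x x + if x = v then F v u else 0) :=
    sum_congr rfl fun x hx => by simp [(mem_erase.1 hx).1]
  rw [h1, h2, sum_add_distrib, sum_ite_eq']
  simp [foldMap, huv.symm, hv]
  ring

/-- Merging keeps exactly those cuts that do not separate `u` from `v`: a preimage under `foldMap`
contains both vertices or neither. -/
theorem cutM_mergeW {W : ℕ → ℕ → ℝ} {u v : ℕ} (hu : u < n) (hv : v < n) (huv : u ≠ v)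
    (U : Set ℕ) : cutM n (mergeW W u v) U = cutM n W (foldMap u v ⁻¹' U) := by
  classical
  have hin : ∀ a i, (∑ j ∈ range n, if a ∈ U ∧ foldMap u v j ∉ U then W i j else 0) =
      ∑ j ∈ range n, if j = u then 0 else ((if a ∈ U ∧ j ∉ U then W i j else 0) +
        if j = v then (if a ∈ U ∧ v ∉ U then W i u else 0) else 0) := fun a i =>
    sum_foldMap hu hv huv fun b j => if a ∈ U ∧ b ∉ U then W i j else 0
  have hout := sum_foldMap hu hv huv fun a i =>
    ∑ j ∈ range n, if a ∈ U ∧ foldMap u v j ∉ U then W i j else 0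
  unfold cutM
  simp only [Set.mem_preimage]
  rw [hout]
  refine sum_congr rfl fun a ha => ?_
  by_cases hau : a = u
  · simp [hau, mergeW]
  rw [if_neg hau, hin]
  by_cases hav : a = v
  · rw [if_pos hav, hin, ← sum_add_distrib]
    refine sum_congr rfl fun b hb => ?_
    by_cases hbu : b = u
    · simp [hbu, mergeW]
    by_cases hbv : b = v
    · subst hbv; subst hav
      simp [mergeW]
    · subst hav
      have : ¬ a = b := fun h => hbv h.symm
      simp only [mergeW, hau, hbu, this, or_self, if_false, if_true, hbv, add_zero]
      split_ifs <;> simp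
  · rw [if_neg hav, add_zero]
    refine sum_congr rfl fun b hb => ?_
    by_cases hbu : b = u
    · simp [hbu, mergeW]
    by_cases hab : a = b
    · subst hab
      simp [mergeW, hav]
    · simp only [mergeW, hau, hbu, hab, hav, or_self, if_false]
      by_cases hbv : b = v
      · subst hbv
        simp only [if_true]
        split_ifs <;> simp
      · simp [hbv]

end Sums

/-- `W` is a nonnegative symmetric matrix with zero diagonal on the vertices `A`. -/
structure IsWeight (n : ℕ) (A : Finset ℕ) (W : ℕ → ℕ → ℝ) : Prop where
  lt : ∀ a ∈ A, a < n
  symm : ∀ a b, W a b = W b a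
  nonneg : ∀ a b, 0 ≤ W a b
  diag : ∀ a, W a a = 0
  supp : ∀ a b, 0 < W a b → a ∈ A

/-- `U` splits `A`. -/
def Splits (A : Finset ℕ) (U : Set ℕ) : Prop :=
  (∃ a ∈ A, a ∈ U) ∧ ∃ b ∈ A, b ∉ U

/-- Moving `u` to the other side does not increase the cut given by `U`. -/
def Movable (n : ℕ) (W : ℕ → ℕ → ℝ) (U : Set ℕ) (u : ℕ) : Prop :=
  cutM n W (U \ {u}) ≤ cutM n W U

/-- In each cut separating `u` and `v`, one of the two vertices is movable. -/
def SafePair (n : ℕ) (W : ℕ → ℕ → ℝ) (u v : ℕ) : Prop :=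
  ∀ U : Set ℕ, u ∈ U → v ∉ U → Movable n W U u ∨ Movable n W Uᶜ v

/-- The graph of the positive entries of `W`. -/
def weightGraph (A : Finset ℕ) (W : ℕ → ℕ → ℝ) : SimpleGraph A :=
  SimpleGraph.fromRel fun a b => 0 < W a b

/-! ### Movable vertices and safe pairs -/

namespace IsWeight

variable {n : ℕ} {A : Finset ℕ} {W : ℕ → ℕ → ℝ}

theorem supp' (h : IsWeight n A W) {a b : ℕ} (hab : 0 < W a b) : b ∈ A :=
  h.supp b a (h.symm a b ▸ hab)

theorem ne (h : IsWeight n A W) {a b : ℕ} (hab : 0 < W a b) : a ≠ b := by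
  rintro rfl
  simp [h.diag] at hab

theorem eq_zero_left (h : IsWeight n A W) {a b : ℕ} (ha : a ∉ A) : W a b = 0 :=
  le_antisymm (not_lt.1 fun hab => ha (h.supp a b hab)) (h.nonneg a b)

theorem eq_zero_right (h : IsWeight n A W) {a b : ℕ} (hb : b ∉ A) : W a b = 0 :=
  (h.symm a b).trans (h.eq_zero_left hb)

theorem adj (h : IsWeight n A W) (a b : A) : (weightGraph A W).Adj a b ↔ 0 < W a b := by
  simp only [weightGraph, SimpleGraph.fromRel_adj, h.symm b a, or_self]
  exact ⟨fun h => h.2, fun hab => ⟨fun e => h.ne hab (congrArg Subtype.val e), hab⟩⟩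

theorem mem_nbrs (h : IsWeight n A W) {a b : ℕ} : b ∈ nbrs n W a ↔ 0 < W a b := by
  simp only [nbrs, mem_filter, mem_range, and_iff_right_iff_imp]
  exact fun hab => h.lt _ (h.supp' hab)

theorem cutM_nonneg (h : IsWeight n A W) (U : Set ℕ) : 0 ≤ cutM n W U := by
  refine sum_nonneg fun a _ => sum_nonneg fun b _ => ?_
  split_ifs
  exacts [h.nonneg a b, le_rfl]

theorem cutM_compl (h : IsWeight n A W) (U : Set ℕ) : cutM n W Uᶜ = cutM n W U := by
  unfold cutM
  rw [sum_comm]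
  refine sum_congr rfl fun a _ => sum_congr rfl fun b _ => ?_
  by_cases ha : a ∈ U <;> by_cases hb : b ∈ U <;> simp [h.symm b a, ha, hb]

/-- When `u` leaves `U`, its entries towards the complement leave the cut and its entries inside `U`
enter it. -/
theorem movable_of_le (h : IsWeight n A W) {U : Set ℕ} {u : ℕ} (hu : u ∈ U) (hun : u < n)
    (hle : rowSumOn n W u U ≤ rowSumOn n W u Uᶜ) : Movable n W U u := by
  classical
  have key : cutM n W U = cutM n W (U \ {u}) + rowSumOn n W u Uᶜ - rowSumOn n W u U := by
    have e1 : rowSumOn n W u Uᶜ = ∑ a ∈ range n, ∑ b ∈ range n,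
        if a = u then (if b ∈ Uᶜ then W u b else 0) else 0 := by
      rw [sum_comm]
      refine sum_congr rfl fun b _ => ?_
      rw [sum_ite_eq']
      simp [hun]
    have e2 : rowSumOn n W u U = ∑ a ∈ range n, ∑ b ∈ range n,
        if b = u then (if a ∈ U then W u a else 0) else 0 := by
      refine sum_congr rfl fun a _ => ?_
      rw [sum_ite_eq']
      simp [hun]
    rw [e1, e2]
    unfold cutM
    rw [← sum_add_distrib, ← sum_sub_distrib]
    refine sum_congr rfl fun a _ => ?_
    rw [← sum_add_distrib, ← sum_sub_distrib]
    refine sum_congr rfl fun b _ => ?_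
    by_cases ha : a = u
    · subst ha
      by_cases hb : b = a
      · subst hb; simp [hu, h.diag]
      · simp [hu, hb]
    · by_cases hb : b = u
      · subst hb; simp [hu, ha, h.symm b a]
      · simp [ha, hb]
  unfold Movable
  linarith

/-- A cut with a single vertex on one side. -/
theorem cutM_eq_rowSum (h : IsWeight n A W) {U : Set ℕ} {u : ℕ} (hu : u ∈ U) (huA : u ∈ A)
    (hone : ∀ a ∈ A, a ∈ U → a = u) : cutM n W U = rowSum n W u := by
  unfold cutM
  rw [sum_eq_single u]
  · refine sum_congr rfl fun b _ => ?_
    by_cases hb : b ∈ U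
    · rw [if_neg (by tauto)]
      by_cases hbA : b ∈ A
      · rw [hone b hbA hb, h.diag]
      · rw [h.eq_zero_right hbA]
    · rw [if_pos ⟨hu, hb⟩]
  · intro a _ hau
    refine sum_eq_zero fun b _ => ?_
    split_ifs with hab
    · refine h.eq_zero_left fun haA => hau (hone a haA hab.1)
    · rfl
  · exact fun hun => absurd (mem_range.2 (h.lt u huA)) hun

theorem merge (h : IsWeight n A W) {u v : ℕ} (hv : v ∈ A) :
    IsWeight n (A.erase u) (mergeW W u v) := by
  refine ⟨fun a ha => h.lt a (mem_of_mem_erase ha), fun a b => ?_, fun a b => ?_, fun a => ?_,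
    fun a b hab => ?_⟩
  · by_cases ha : a = u
    · simp [mergeW, ha]
    by_cases hb : b = u
    · simp [mergeW, hb]
    by_cases hab : a = b
    · rw [hab]
    have hba : ¬ b = a := fun e => hab e.symm
    simp only [mergeW, ha, hb, hab, hba, or_self, if_false, h.symm b a, h.symm u b, h.symm a u]
    ring
  · unfold mergeW
    split_ifs <;> first | rfl | linarith [h.nonneg a b, h.nonneg u b, h.nonneg a u]
  · simp [mergeW]
  · by_cases ha : a = u
    · simp [mergeW, ha] at hab
    refine mem_erase.2 ⟨ha, ?_⟩
    by_contra haA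
    have hav : a ≠ v := fun e => haA (e ▸ hv)
    simp [mergeW, hav, h.eq_zero_left haA] at hab

/-- Either `p` is alone on its side and the cut is its row sum, or moving `p` gives a cut with `p`
and `q` together that still splits `A`. -/
theorem le_cut_of_movable (h : IsWeight n A W) {c : ℝ} {p q : ℕ} (hp : p ∈ A)
    (hle : c ≤ rowSum n W p) (hboth : ∀ U : Set ℕ, p ∉ U → q ∉ U → (∃ a ∈ A, a ∈ U) → c ≤ cutM n W U)
    {U : Set ℕ} (hpU : p ∈ U) (hqU : q ∉ U) (hm : Movable n W U p) : c ≤ cutM n W U := by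
  by_cases hone : ∀ a ∈ A, a ∈ U → a = p
  · rwa [h.cutM_eq_rowSum hpU hp hone]
  · push Not at hone
    obtain ⟨a, haA, haU, hap⟩ := hone
    exact (hboth (U \ {p}) (by simp) (fun h => hqU h.1) ⟨a, haA, haU, hap⟩).trans hm

/-- The correctness of merging: a lower bound for the two single-vertex cuts and for the cuts after
the merge bounds all cuts. -/
theorem le_cut_of_merge (h : IsWeight n A W) {c : ℝ} {u v : ℕ} (hu : u ∈ A) (hv : v ∈ A)
    (huv : u ≠ v) (hs : SafePair n W u v) (hcu : c ≤ rowSum n W u) (hcv : c ≤ rowSum n W v)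
    (hc : ∀ U, Splits (A.erase u) U → c ≤ cutM n (mergeW W u v) U) {U : Set ℕ}
    (hU : Splits A U) : c ≤ cutM n W U := by
  have same : ∀ U : Set ℕ, (u ∈ U ↔ v ∈ U) → Splits A U → c ≤ cutM n W U := by
    intro U hiff hU
    have e : foldMap u v ⁻¹' U = U := by
      ext i
      by_cases hi : i = u
      · simp [foldMap, hi, hiff]
      · simp [foldMap, hi]
    rw [← e, ← cutM_mergeW (h.lt u hu) (h.lt v hv) huv]
    refine hc U ⟨?_, ?_⟩
    · obtain ⟨a, ha, haU⟩ := hU.1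
      by_cases hau : a = u
      · exact ⟨v, mem_erase.2 ⟨huv.symm, hv⟩, hiff.1 (hau ▸ haU)⟩
      · exact ⟨a, mem_erase.2 ⟨hau, ha⟩, haU⟩
    · obtain ⟨a, ha, haU⟩ := hU.2
      by_cases hau : a = u
      · exact ⟨v, mem_erase.2 ⟨huv.symm, hv⟩, fun h => haU (hau ▸ hiff.2 h)⟩
      · exact ⟨a, mem_erase.2 ⟨hau, ha⟩, haU⟩
  have both : ∀ U : Set ℕ, u ∉ U → v ∉ U → (∃ a ∈ A, a ∈ U) → c ≤ cutM n W U :=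
    fun U h1 h2 h3 => same U (by tauto) ⟨h3, u, hu, h1⟩
  have main : ∀ U : Set ℕ, u ∈ U → v ∉ U → c ≤ cutM n W U := by
    intro U huU hvU
    rcases hs U huU hvU with hm | hm
    · exact h.le_cut_of_movable hu hcu both huU hvU hm
    · rw [← h.cutM_compl]
      exact h.le_cut_of_movable hv hcv (fun U h1 h2 => both U h2 h1) hvU (by simpa using huU) hm
  by_cases huU : u ∈ U <;> by_cases hvU : v ∈ U
  · exact same U (by tauto) hU
  · exact main U huU hvU
  · rw [← h.cutM_compl]
    exact main _ huU (by simpa using hvU)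
  · exact same U (by tauto) hU

theorem rowSum_eq (h : IsWeight n A W) (x : ℕ) : rowSum n W x = ∑ b ∈ nbrs n W x, W x b := by
  unfold rowSum nbrs
  rw [sum_filter]
  refine sum_congr rfl fun b _ => ?_
  split_ifs with hb
  exacts [rfl, le_antisymm (not_lt.1 hb) (h.nonneg _ _)]

open Classical in
theorem rowSumOn_eq (h : IsWeight n A W) (x : ℕ) (U : Set ℕ) :
    rowSumOn n W x U = ∑ b ∈ nbrs n W x, if b ∈ U then W x b else 0 := by
  unfold rowSumOn nbrs
  rw [sum_filter]
  refine sum_congr rfl fun b _ => ?_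
  split_ifs with hb hb'
  exacts [rfl, le_antisymm (not_lt.1 hb') (h.nonneg _ _), rfl, rfl]

theorem rowSumOn_add_compl (x : ℕ) (U : Set ℕ) :
    rowSumOn n W x U + rowSumOn n W x Uᶜ = rowSum n W x := by
  unfold rowSumOn rowSum
  rw [← sum_add_distrib]
  refine sum_congr rfl fun b _ => ?_
  by_cases hb : b ∈ U <;> simp [hb]

theorem le_rowSumOn (h : IsWeight n A W) {x a : ℕ} (ha : a < n) {U : Set ℕ} (haU : a ∈ U) :
    W x a ≤ rowSumOn n W x U := by
  classical
  have := single_le_sum (f := fun b => if b ∈ U then W x b else 0) (s := range n)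
    (fun b _ => by split_ifs; exacts [h.nonneg x b, le_rfl]) (mem_range.2 ha)
  simpa [rowSumOn, haU] using this

/-- In a cut separating the pair, the entry of `uv` crosses and is at least half of the row of `u`.
-/
theorem safePair_of_dominated (h : IsWeight n A W) {u v : ℕ} (hu : u ∈ A) (hv : v ∈ A)
    (hd : rowSum n W u ≤ 2 * W u v) : SafePair n W u v := by
  intro U huU hvU
  refine Or.inl (h.movable_of_le huU (h.lt u hu) ?_)
  have h1 := rowSumOn_add_compl (n := n) (W := W) u U
  have h2 := h.le_rowSumOn (x := u) (h.lt v hv) (U := Uᶜ) hvU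
  linarith

/-- A vertex of degree three with two neighbours on the other side is movable, unless its third
neighbour dominates. -/
theorem movable_of_two (h : IsWeight n A W) {u a b : ℕ} (hu : u ∈ A) (hab : a ≠ b)
    (h3 : (nbrs n W u).card = 3) (hnd : ∀ c, 2 * W u c ≤ rowSum n W u) (ha : 0 < W u a)
    (hb : 0 < W u b) {U : Set ℕ} (huU : u ∈ U) (haU : a ∉ U) (hbU : b ∉ U) : Movable n W U u := by
  classical
  refine h.movable_of_le huU (h.lt u hu) ?_
  obtain ⟨c, hc⟩ : ∃ c, c ∈ ((nbrs n W u).erase a).erase b := by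
    rw [← Finset.Nonempty, ← card_pos, card_erase_of_mem, card_erase_of_mem, h3]
    · norm_num
    · exact h.mem_nbrs.2 ha
    · exact mem_erase.2 ⟨hab.symm, h.mem_nbrs.2 hb⟩
  simp only [mem_erase] at hc
  have hN : nbrs n W u = {a, b, c} := by
    refine (eq_of_subset_of_card_le ?_ ?_).symm
    · intro x hx
      simp only [mem_insert, mem_singleton] at hx
      rcases hx with rfl | rfl | rfl
      exacts [h.mem_nbrs.2 ha, h.mem_nbrs.2 hb, hc.2.2]
    · rw [h3]
      simp [hab, hc.1.symm, hc.2.1.symm]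
  have e1 : rowSumOn n W u U ≤ W u c := by
    rw [h.rowSumOn_eq, hN, sum_insert (by simp [hab, hc.2.1.symm]),
      sum_insert (by simp [hc.1.symm]), sum_singleton, if_neg haU, if_neg hbU]
    split_ifs <;> linarith [h.nonneg u c]
  linarith [rowSumOn_add_compl (n := n) (W := W) u U, hnd c]

/-- Whichever of `u`, `v` is separated from `z` has two neighbours across the cut. -/
theorem safePair_of_triangle (h : IsWeight n A W) {u v z : ℕ} (hu : u ∈ A) (hv : v ∈ A)
    (hu3 : (nbrs n W u).card = 3) (hv3 : (nbrs n W v).card = 3)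
    (hnu : ∀ c, 2 * W u c ≤ rowSum n W u) (hnv : ∀ c, 2 * W v c ≤ rowSum n W v)
    (huv : 0 < W u v) (huz : 0 < W u z) (hvz : 0 < W v z) : SafePair n W u v := by
  intro U huU hvU
  by_cases hz : z ∈ U
  · exact Or.inr (h.movable_of_two hv (h.ne huz) hv3 hnv (h.symm u v ▸ huv) hvz hvU
      (by simpa using huU) (by simpa using hz))
  · exact Or.inl (h.movable_of_two hu (h.ne hvz) hu3 hnu huv huz huU hvU hz)

/-- Two of the three common neighbours lie on the same side, and the twin on the other side is
movable. -/
theorem safePair_of_twins (h : IsWeight n A W) {u v : ℕ} (hu : u ∈ A) (hv : v ∈ A)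
    (hu3 : (nbrs n W u).card = 3)
    (hnu : ∀ c, 2 * W u c ≤ rowSum n W u) (hnv : ∀ c, 2 * W v c ≤ rowSum n W v)
    (huv : ∀ w, 0 < W u w ↔ 0 < W v w) : SafePair n W u v := by
  intro U huU hvU
  have hv3 : (nbrs n W v).card = 3 := by
    rw [← hu3]
    congr 1
    ext w
    rw [h.mem_nbrs, h.mem_nbrs, huv]
  obtain ⟨a, b, c, hab, hac, hbc, hN⟩ := card_eq_three.1 hu3
  have ha : 0 < W u a := h.mem_nbrs.1 (by simp [hN])
  have hb : 0 < W u b := h.mem_nbrs.1 (by simp [hN])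
  have hc : 0 < W u c := h.mem_nbrs.1 (by simp [hN])
  have out : ∀ p q, p ≠ q → 0 < W u p → 0 < W u q → p ∉ U → q ∉ U → Movable n W U u :=
    fun p q hpq hp hq h1 h2 => h.movable_of_two hu hpq hu3 hnu hp hq huU h1 h2
  have inn : ∀ p q, p ≠ q → 0 < W u p → 0 < W u q → p ∈ U → q ∈ U → Movable n W Uᶜ v :=
    fun p q hpq hp hq h1 h2 => h.movable_of_two hv hpq hv3 hnv ((huv p).1 hp) ((huv q).1 hq) hvU
      (by simpa using h1) (by simpa using h2)
  by_cases h1 : a ∈ U <;> by_cases h2 : b ∈ U <;> by_cases h3 : c ∈ U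
  · exact Or.inr (inn a b hab ha hb h1 h2)
  · exact Or.inr (inn a b hab ha hb h1 h2)
  · exact Or.inr (inn a c hac ha hc h1 h3)
  · exact Or.inl (out b c hbc hb hc h2 h3)
  · exact Or.inr (inn b c hbc hb hc h2 h3)
  · exact Or.inl (out a c hac ha hc h1 h3)
  · exact Or.inl (out a b hab ha hb h1 h2)
  · exact Or.inl (out a b hab ha hb h1 h2)

end IsWeight

/-! ### Merges that preserve the excluded minor, and their existence -/

theorem IsGraphMinor.of_injective {V W : Type*} {H : SimpleGraph W} {G : SimpleGraph V} (f : W → V)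
    (hf : Function.Injective f) (hadj : ∀ a b, H.Adj a b → G.Adj (f a) (f b)) :
    IsGraphMinor H G :=
  ⟨fun a => {f a}, fun a => (G.connOn_singleton (f a)).connected,
    fun a b hab => by simpa using fun e => hab (hf e),
    fun a b hab => ⟨f a, rfl, f b, rfl, hadj a b hab⟩⟩

namespace IsWeight

variable {n : ℕ} {A : Finset ℕ} {W : ℕ → ℕ → ℝ}

theorem minor_of_adj (h : IsWeight n A W) {u v : ℕ} (huv : 0 < W u v) :
    IsGraphMinor (weightGraph (A.erase u) (mergeW W u v)) (weightGraph A W) := by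
  have hu := h.supp u v huv
  have hv := h.supp' huv
  have hm := h.merge (u := u) hv
  refine ⟨fun a => {x | x.1 = a.1 ∨ (a.1 = v ∧ x.1 = u)}, fun a => ?_, fun a b hab => ?_,
    fun a b hab => ?_⟩
  · refine SimpleGraph.ConnOn.connected ?_
    beta_reduce
    by_cases hav : a.1 = v
    · have e : {x : A | x.1 = a.1 ∨ (a.1 = v ∧ x.1 = u)} = {⟨u, hu⟩, ⟨v, hv⟩} := by
        ext x
        simp only [Set.mem_ofPred_eq, Set.mem_insert_iff, Set.mem_singleton_iff, Subtype.ext_iff,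
          hav, true_and]
        tauto
      rw [e]
      exact SimpleGraph.connOn_pair ((h.adj _ _).2 huv)
    · have e : {x : A | x.1 = a.1 ∨ (a.1 = v ∧ x.1 = u)} = {⟨a.1, mem_of_mem_erase a.2⟩} := by
        ext x
        simp [Subtype.ext_iff, hav]
      rw [e]
      exact SimpleGraph.connOn_singleton _ _
  · refine Set.disjoint_left.2 ?_
    rintro x hxa hxb
    have hab' : a.1 ≠ b.1 := fun e => hab (Subtype.ext e)
    have ha := (mem_erase.1 a.2).1
    have hb := (mem_erase.1 b.2).1
    simp only [Set.mem_ofPred_eq] at hxa hxb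
    rcases hxa with h1 | ⟨h1, h2⟩ <;> rcases hxb with h3 | ⟨h3, h4⟩
    · exact hab' (h1.symm.trans h3)
    · exact ha (h1.symm.trans h4)
    · exact hb (h3.symm.trans h2)
    · exact hab' (h1.trans h3.symm)
  · have ha := (mem_erase.1 a.2)
    have hb := (mem_erase.1 b.2)
    have hab' := (hm.adj a b).1 hab
    have hne : a.1 ≠ b.1 := hm.ne hab'
    simp only [mergeW, ha.1, hb.1, hne, or_self, if_false] at hab'
    by_cases h1 : 0 < W a b
    · exact ⟨⟨a, ha.2⟩, Or.inl rfl, ⟨b, hb.2⟩, Or.inl rfl, (h.adj _ _).2 h1⟩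
    have h1' : W a b = 0 := le_antisymm (not_lt.1 h1) (h.nonneg _ _)
    rw [h1'] at hab'
    split_ifs at hab' with h3 h4 h4
    · exact absurd (h3.trans h4.symm) hne
    · exact ⟨⟨u, hu⟩, Or.inr ⟨h3, rfl⟩, ⟨b, hb.2⟩, Or.inl rfl, (h.adj _ _).2 (by simpa using hab')⟩
    · exact ⟨⟨a, ha.2⟩, Or.inl rfl, ⟨u, hu⟩, Or.inr ⟨h4, rfl⟩, (h.adj _ _).2 (by simpa using hab')⟩
    · simp at hab'

/-- All entries of `u` are added to entries of `v` that are positive already, so the merged graph is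
`G` without `u`. Adjacency of `u` and `v` is not needed. -/
theorem minor_of_twins (h : IsWeight n A W) {u v : ℕ} (hv : v ∈ A)
    (huv : ∀ w, 0 < W u w ↔ 0 < W v w) :
    IsGraphMinor (weightGraph (A.erase u) (mergeW W u v)) (weightGraph A W) := by
  have hm := h.merge (u := u) hv
  refine IsGraphMinor.of_injective (fun a => ⟨a.1, mem_of_mem_erase a.2⟩) (fun a b e => ?_) ?_
  · exact Subtype.ext (Subtype.mk.inj e)
  intro a b hab
  have hab' := (hm.adj a b).1 hab
  have ha := (mem_erase.1 a.2)
  have hb := (mem_erase.1 b.2)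
  have hne : a.1 ≠ b.1 := hm.ne hab'
  refine (h.adj _ _).2 ?_
  by_contra h1
  have h1 : W a b = 0 := le_antisymm (not_lt.1 h1) (h.nonneg _ _)
  simp only [mergeW, ha.1, hb.1, hne, or_self, if_false] at hab'
  have e1 : a.1 = v → W u b = 0 := fun e =>
    le_antisymm (not_lt.1 fun hp => ((huv b).1 hp).ne' (e ▸ h1)) (h.nonneg _ _)
  have e2 : b.1 = v → W a u = 0 := fun e =>
    le_antisymm (not_lt.1 fun hp => ((huv a).1 (h.symm a u ▸ hp)).ne' (h.symm a v ▸ e ▸ h1))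
      (h.nonneg _ _)
  split_ifs at hab' with h3 h4 h4
  · exact hne (h3.trans h4.symm)
  · simp [h1, e1 h3] at hab'
  · simp [h1, e2 h4] at hab'
  · simp [h1] at hab'

end IsWeight

/-- The vertices `u` and `v` have degree three, and they are adjacent with a common neighbour, or
they have the same neighbours, one of which has degree three. -/
structure IsBuddyPair (n : ℕ) (A : Finset ℕ) (W : ℕ → ℕ → ℝ) (u v : ℕ) : Prop where
  left : u ∈ A
  right : v ∈ A
  ne : u ≠ v
  card_left : (nbrs n W u).card = 3
  card_right : (nbrs n W v).card = 3
  or : (0 < W u v ∧ ∃ z, 0 < W u z ∧ 0 < W v z) ∨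
    ((∀ w, 0 < W u w ↔ 0 < W v w) ∧ ∃ a, 0 < W u a ∧ (nbrs n W a).card = 3)

/-- Merging `u` into `v` is safe and keeps the class of graphs. -/
structure Mergeable (n : ℕ) (A : Finset ℕ) (W : ℕ → ℕ → ℝ) (u v : ℕ) : Prop where
  left : u ∈ A
  right : v ∈ A
  ne : u ≠ v
  card : (nbrs n W u).card ≤ 3
  safe : SafePair n W u v
  minor : IsGraphMinor (weightGraph (A.erase u) (mergeW W u v)) (weightGraph A W)

namespace IsWeight

variable {n : ℕ} {A : Finset ℕ} {W : ℕ → ℕ → ℝ}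

theorem mergeable_of_buddyPair (h : IsWeight n A W) {u v : ℕ} (hb : IsBuddyPair n A W u v)
    (hd : ∀ x ∈ A, (nbrs n W x).card ≤ 3 → ∀ c, 2 * W x c ≤ rowSum n W x) :
    Mergeable n A W u v := by
  have hu := hd u hb.left hb.card_left.le
  have hv := hd v hb.right hb.card_right.le
  refine ⟨hb.left, hb.right, hb.ne, hb.card_left.le, ?_, ?_⟩
  · rcases hb.or with ⟨h1, z, h2, h3⟩ | ⟨h1, _⟩
    · exact h.safePair_of_triangle hb.left hb.right hb.card_left hb.card_right hu hv h1 h2 h3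
    · exact h.safePair_of_twins hb.left hb.right hb.card_left hu hv h1
  · rcases hb.or with ⟨h1, z, h2, h3⟩ | ⟨h1, _⟩
    · exact h.minor_of_adj h1
    · exact h.minor_of_twins hb.right h1

theorem mergeable_of_dominated (h : IsWeight n A W) {u v : ℕ} (hu : u ∈ A)
    (hcard : (nbrs n W u).card ≤ 3) (hpos : 0 < rowSum n W u)
    (hd : rowSum n W u ≤ 2 * W u v) : Mergeable n A W u v := by
  have huv : 0 < W u v := by linarith
  exact ⟨hu, h.supp' huv, h.ne huv, hcard, h.safePair_of_dominated hu (h.supp' huv) hd,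
    h.minor_of_adj huv⟩

/-- With one or two neighbours, the heavier entry is at least half of the row sum. -/
theorem three_le_card (h : IsWeight n A W) {u : ℕ} (hpos : 0 < rowSum n W u)
    (hd : (nbrs n W u).card ≤ 3 → ∀ c, 2 * W u c < rowSum n W u) : 3 ≤ (nbrs n W u).card := by
  by_contra hlt
  have hlt' : (nbrs n W u).card = 0 ∨ (nbrs n W u).card = 1 ∨ (nbrs n W u).card = 2 := by omega
  have hd := hd (by omega)
  have hs := h.rowSum_eq u
  rcases hlt' with h0 | h1 | h2
  · rw [card_eq_zero.1 h0, sum_empty] at hs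
    linarith
  · obtain ⟨a, ha⟩ := card_eq_one.1 h1
    rw [ha, sum_singleton] at hs
    linarith [hd a, h.nonneg u a]
  · obtain ⟨a, b, hab, hN⟩ := card_eq_two.1 h2
    rw [hN, sum_pair hab] at hs
    linarith [hd a, hd b]

theorem degreeThree_iff (h : IsWeight n A W) (u : A) (hu : (weightGraph A W).DegreeThree u) :
    (nbrs n W u).card = 3 := by
  obtain ⟨a, b, c, hab, hac, hbc, hN⟩ := hu
  refine card_eq_three.2 ⟨a, b, c, fun e => hab (Subtype.ext e), fun e => hac (Subtype.ext e),
    fun e => hbc (Subtype.ext e), ?_⟩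
  ext w
  rw [h.mem_nbrs]
  simp only [mem_insert, mem_singleton]
  constructor
  · intro hw
    have := (hN ⟨w, h.supp' hw⟩).1 ((h.adj _ _).2 hw)
    simpa [Subtype.ext_iff] using this
  · rintro (rfl | rfl | rfl)
    · exact (h.adj _ _).1 ((hN _).2 (Or.inl rfl))
    · exact (h.adj _ _).1 ((hN _).2 (Or.inr (Or.inl rfl)))
    · exact (h.adj _ _).1 ((hN _).2 (Or.inr (Or.inr rfl)))

/-- No exceptional edge is needed at the top level, so `hasPairAvoiding_of_not_minor` is applied
with both ends equal to an arbitrary vertex. -/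
theorem exists_buddyPair (h : IsWeight n A W) (hm : ¬ IsGraphMinor K5DeleteEdge (weightGraph A W))
    (hA : 2 ≤ A.card) (hpos : ∀ x ∈ A, 0 < rowSum n W x)
    (hd : ∀ x ∈ A, (nbrs n W x).card ≤ 3 → ∀ c, 2 * W x c < rowSum n W x) :
    ∃ u v, IsBuddyPair n A W u v := by
  have hdeg : ∀ x : A, (weightGraph A W).ThreeLeDegree x := by
    intro x s t
    have h3 := h.three_le_card (hpos x x.2) (hd x x.2)
    have : (((nbrs n W x).erase s).erase t).Nonempty := by
      have h1 := pred_card_le_card_erase (s := nbrs n W x) (a := s.1)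
      have h2 := pred_card_le_card_erase (s := (nbrs n W x).erase s) (a := t.1)
      exact card_pos.1 (by omega)
    obtain ⟨w, hw⟩ := this
    simp only [mem_erase, h.mem_nbrs] at hw
    exact ⟨⟨w, h.supp' hw.2.2⟩, (h.adj _ _).2 hw.2.2, fun e => hw.2.1 (congrArg Subtype.val e),
      fun e => hw.1 (congrArg Subtype.val e)⟩
  obtain ⟨x, hx, y, hy, hxy⟩ := one_lt_card.1 hA
  obtain ⟨u, v, _, _, _, _, huv, hu3, hv3, hor⟩ :=
    SimpleGraph.hasPairAvoiding_of_not_minor hm (x := ⟨x, hx⟩) (y := ⟨x, hx⟩) (Or.inl rfl)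
      ⟨⟨y, hy⟩, fun e => hxy (congrArg Subtype.val e).symm,
        fun e => hxy (congrArg Subtype.val e).symm⟩ fun v _ _ => hdeg v
  refine ⟨u, v, u.2, v.2, fun e => huv (Subtype.ext e), h.degreeThree_iff u hu3,
    h.degreeThree_iff v hv3, hor.imp ?_ ?_⟩
  · rintro ⟨h1, z, h2, h3⟩
    exact ⟨(h.adj _ _).1 h1, z, (h.adj _ _).1 h2, (h.adj _ _).1 h3⟩
  · rintro ⟨h1, a, _, _, h2, h3⟩
    refine ⟨fun w => ?_, a, (h.adj _ _).1 h2, h.degreeThree_iff a h3⟩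
    constructor
    · intro hw
      exact (h.adj v ⟨w, h.supp' hw⟩).1 ((h1 _).1 ((h.adj u ⟨w, h.supp' hw⟩).2 hw))
    · intro hw
      exact (h.adj u ⟨w, h.supp' hw⟩).1 ((h1 _).2 ((h.adj v ⟨w, h.supp' hw⟩).2 hw))

/-- The entry of column `u` moves to column `v`. With `nbrs_mergeW` this shows that only `v` and the
neighbours of `u` can have stale records. -/
theorem rowSum_mergeW (h : IsWeight n A W) {u v x : ℕ} (hu : u ∈ A) (hv : v ∈ A) (huv : u ≠ v)
    (hxu : x ≠ u) (hxv : x ≠ v) : rowSum n (mergeW W u v) x = rowSum n W x := by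
  unfold rowSum
  have hun : u ∈ range n := mem_range.2 (h.lt u hu)
  rw [← add_sum_erase _ _ hun, ← add_sum_erase _ (fun b => W x b) hun]
  have : ∑ b ∈ (range n).erase u, mergeW W u v x b =
      ∑ b ∈ (range n).erase u, (W x b + if b = v then W x u else 0) := by
    refine sum_congr rfl fun b hb => ?_
    have hbu := (mem_erase.1 hb).1
    by_cases hxb : x = b
    · subst hxb
      simp [mergeW, hxv, h.diag]
    · simp [mergeW, hxu, hbu, hxb, hxv]
  rw [this, sum_add_distrib, sum_ite_eq',
    if_pos (mem_erase.2 ⟨huv.symm, mem_range.2 (h.lt v hv)⟩)]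
  simp [mergeW]
  ring

theorem nbrs_mergeW (h : IsWeight n A W) {u v x : ℕ} (hxu : x ≠ u) (hxv : x ≠ v)
    (hnu : ¬ 0 < W u x) : nbrs n (mergeW W u v) x = nbrs n W x := by
  have h0 : W x u = 0 := le_antisymm (not_lt.1 fun hp => hnu (h.symm x u ▸ hp)) (h.nonneg _ _)
  ext b
  simp only [nbrs, mem_filter, and_congr_right_iff]
  intro _
  by_cases hbu : b = u
  · simp [mergeW, hbu, h0]
  by_cases hxb : x = b
  · subst hxb
    simp [mergeW, h.diag]
  · simp [mergeW, hxu, hbu, hxb, hxv, h0]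

end IsWeight

/-- The matrix `W` on the vertices `A` arises from `W₀` by merging each vertex `i` into `ρ i`. -/
structure IsMerged (n : ℕ) (W₀ : ℕ → ℕ → ℝ) (ρ : ℕ → ℕ) (A : Finset ℕ) (W : ℕ → ℕ → ℝ) : Prop where
  isWeight : IsWeight n A W
  map : ∀ i < n, ρ i ∈ A
  fix : ∀ a ∈ A, ρ a = a
  cut : ∀ U, cutM n W U = cutM n W₀ (ρ ⁻¹' U)
  minor : ¬ IsGraphMinor K5DeleteEdge (weightGraph A W)

/-- No cut of `W₀` is smaller than `best` and smaller than all cuts of `W`. -/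
def Dominates (n : ℕ) (W₀ : ℕ → ℕ → ℝ) (A : Finset ℕ) (W : ℕ → ℕ → ℝ) (best : ℝ) : Prop :=
  ∀ c ≤ best, (∀ U, Splits A U → c ≤ cutM n W U) → ∀ U, Splits (range n) U → c ≤ cutM n W₀ U

/-! ### Cuts of the merged matrix and cuts of the input -/

namespace IsMerged

variable {n : ℕ} {W₀ W : ℕ → ℕ → ℝ} {ρ : ℕ → ℕ} {A : Finset ℕ}

theorem mem_iff (h : IsMerged n W₀ ρ A W) {a : ℕ} (ha : a < n) : a ∈ A ↔ ρ a = a :=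
  ⟨h.fix a, fun e => e ▸ h.map a ha⟩

theorem init (hW : IsWeight n (range n) W₀)
    (hm : ¬ IsGraphMinor K5DeleteEdge (weightGraph (range n) W₀)) :
    IsMerged n W₀ id (range n) W₀ :=
  ⟨hW, fun _ hi => mem_range.2 hi, fun _ _ => rfl, fun _ => rfl, hm⟩

theorem merge (h : IsMerged n W₀ ρ A W) {u v : ℕ} (hm : Mergeable n A W u v) :
    IsMerged n W₀ (fun i => foldMap u v (ρ i)) (A.erase u) (mergeW W u v) := by
  refine ⟨h.isWeight.merge hm.right, fun i hi => ?_, fun a ha => ?_, fun U => ?_,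
    fun hK => h.minor (hK.trans hm.minor)⟩
  · by_cases e : ρ i = u
    · simpa [foldMap, e] using ⟨hm.ne.symm, hm.right⟩
    · simpa [foldMap, e] using h.map i hi
  · obtain ⟨h1, h2⟩ := mem_erase.1 ha
    simp [foldMap, h.fix a h2, h1]
  · rw [cutM_mergeW (h.isWeight.lt u hm.left) (h.isWeight.lt v hm.right) hm.ne, h.cut]
    rfl

theorem splits_class (h : IsMerged n W₀ ρ A W) (hA : 2 ≤ A.card) {x : ℕ} (hx : x ∈ A) :
    Splits (range n) {i | ρ i = x} := by
  obtain ⟨y, hy, hyx⟩ := exists_mem_ne hA x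
  exact ⟨⟨x, mem_range.2 (h.isWeight.lt x hx), h.fix x hx⟩,
    ⟨y, mem_range.2 (h.isWeight.lt y hy), fun e => hyx ((h.fix y hy).symm.trans e)⟩⟩

/-- Row sums of the current matrix are weights of actual cuts of the input, so the program can
output the class of `x`. -/
theorem cutM_class (h : IsMerged n W₀ ρ A W) {x : ℕ} (hx : x ∈ A) :
    cutM n W₀ {i | ρ i = x} = rowSum n W x :=
  (h.cut {x}).symm.trans (h.isWeight.cutM_eq_rowSum rfl hx fun _ _ e => e)

theorem dominates_merge (h : IsMerged n W₀ ρ A W) {u v : ℕ} (hm : Mergeable n A W u v) {best : ℝ}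
    (hrow : ∀ x ∈ A, best ≤ rowSum n W x) (hd : Dominates n W₀ A W best) :
    Dominates n W₀ (A.erase u) (mergeW W u v) best := fun c hc hcut =>
  hd c hc fun _ hU => h.isWeight.le_cut_of_merge hm.left hm.right hm.ne hm.safe
    (hc.trans (hrow u hm.left)) (hc.trans (hrow v hm.right)) hcut hU

theorem le_cutM_of_nonpos (h : IsMerged n W₀ ρ A W) {best : ℝ} (hb : best ≤ 0)
    (hd : Dominates n W₀ A W best) {U : Set ℕ} (hU : Splits (range n) U) : best ≤ cutM n W₀ U :=
  hd best le_rfl (fun _ _ => hb.trans (h.isWeight.cutM_nonneg _)) U hU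

/-- On two vertices every cut has a single vertex on one side, so its weight is a row sum. -/
theorem le_cutM_of_card (h : IsMerged n W₀ ρ A W) {best : ℝ} (hA : A.card ≤ 2)
    (hrow : ∀ x ∈ A, best ≤ rowSum n W x) (hd : Dominates n W₀ A W best) {U : Set ℕ}
    (hU : Splits (range n) U) : best ≤ cutM n W₀ U := by
  refine hd best le_rfl (fun U hU => ?_) U hU
  obtain ⟨⟨a, ha, haU⟩, b, hb, hbU⟩ := hU
  rw [h.isWeight.cutM_eq_rowSum haU ha]
  · exact hrow a ha
  · intro c hc hcU
    by_contra hca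
    have hab : a ≠ b := fun e => hbU (e ▸ haU)
    have hcb : c ≠ b := fun e => hbU (e ▸ hcU)
    have : ({a, b, c} : Finset ℕ).card = 3 := by simp [hab, Ne.symm hca, hcb.symm]
    have h3 : ({a, b, c} : Finset ℕ) ⊆ A := by
      intro x hx
      simp only [mem_insert, mem_singleton] at hx
      rcases hx with rfl | rfl | rfl <;> assumption
    have := card_le_card h3
    omega

end IsMerged

/-! ### The weight matrix of the input graph -/

namespace RAM.Input

variable (I : Input)

theorem weightAt_of_adj {i j : ℕ} (hi : i < I.n) (hj : j < I.n)
    (h : I.graph.Adj ⟨i, hi⟩ ⟨j, hj⟩) : I.weightAt i j = I.weight s(⟨i, hi⟩, ⟨j, hj⟩) :=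
  dif_pos ⟨hi, hj, h⟩

theorem weightAt_of_not_adj {i j : ℕ} (h : ¬ I.Adj i j) : I.weightAt i j = 0 :=
  dif_neg h

theorem isWeight_weightAt (hw : ∀ e ∈ I.graph.edgeSet, 0 < I.weight e) :
    IsWeight I.n (range I.n) I.weightAt := by
  refine ⟨fun a ha => mem_range.1 ha, fun a b => ?_, fun a b => ?_, fun a => ?_, fun a b hab => ?_⟩
  · by_cases h : I.Adj a b
    · obtain ⟨ha, hb, hab⟩ := h
      rw [I.weightAt_of_adj ha hb hab, I.weightAt_of_adj hb ha hab.symm, Sym2.eq_swap]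
    · have h' : ¬ I.Adj b a := fun ⟨hb, ha, hba⟩ => h ⟨ha, hb, hba.symm⟩
      rw [I.weightAt_of_not_adj h, I.weightAt_of_not_adj h']
  · by_cases h : I.Adj a b
    · obtain ⟨ha, hb, hab⟩ := h
      rw [I.weightAt_of_adj ha hb hab]
      exact (hw _ hab).le
    · rw [I.weightAt_of_not_adj h]
  · exact I.weightAt_of_not_adj fun ⟨_, _, h⟩ => h.ne rfl
  · by_contra ha
    rw [I.weightAt_of_not_adj fun ⟨h, _⟩ => ha (mem_range.2 h)] at hab
    exact lt_irrefl _ hab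

theorem weightGraph_minor (hw : ∀ e ∈ I.graph.edgeSet, 0 < I.weight e) :
    IsGraphMinor (weightGraph (range I.n) I.weightAt) I.graph := by
  refine IsGraphMinor.of_injective (fun a => ⟨a.1, mem_range.1 a.2⟩)
    (fun a b e => Subtype.ext (Fin.mk.inj e)) fun a b hab => ?_
  have hab' := ((I.isWeight_weightAt hw).adj a b).1 hab
  by_contra h
  rw [I.weightAt_of_not_adj fun ⟨_, _, h'⟩ => h h'] at hab'
  exact lt_irrefl _ hab'

/-- Each edge of the cut has exactly one orientation that leads out of `U`, so unordered edges
correspond to ordered pairs. -/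
theorem cutWeight_eq (U : Set ℕ) :
    cutWeight I.graph I.weight {v | v.1 ∈ U} = cutM I.n I.weightAt U := by
  classical
  have h1 : cutM I.n I.weightAt U = ∑ p : Fin I.n × Fin I.n,
      if I.graph.Adj p.1 p.2 ∧ p.1.1 ∈ U ∧ p.2.1 ∉ U then I.weight s(p.1, p.2) else 0 := by
    unfold cutM
    rw [Finset.sum_range, Fintype.sum_prod_type]
    refine sum_congr rfl fun a _ => ?_
    rw [Finset.sum_range]
    refine sum_congr rfl fun b _ => ?_
    by_cases hab : I.graph.Adj a b
    · simp only [hab, true_and]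
      rw [I.weightAt_of_adj a.2 b.2 hab]
    · rw [I.weightAt_of_not_adj fun ⟨_, _, h⟩ => hab h]
      simp [hab]
  have h2 : cutWeight I.graph I.weight {v | v.1 ∈ U} =
      ∑ e : Sym2 (Fin I.n), if e ∈ edgeCut I.graph {v | v.1 ∈ U} then I.weight e else 0 := by
    unfold cutWeight
    exact sum_congr rfl fun e _ => Set.indicator_apply _ _ _
  rw [h1, h2, ← sum_filter, ← sum_filter]
  symm
  refine sum_nbij (fun p => s(p.1, p.2)) ?_ ?_ ?_ fun _ _ => rfl
  · rintro ⟨a, b⟩ h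
    simp only [mem_filter, mem_univ, true_and] at h ⊢
    exact ⟨h.1, a, h.2.1, b, h.2.2, rfl⟩
  · rintro ⟨a, b⟩ h ⟨c, d⟩ h' e
    simp only [coe_filter, mem_univ, true_and, Set.mem_ofPred_eq] at h h'
    rcases Sym2.eq_iff.1 e with ⟨rfl, rfl⟩ | ⟨rfl, rfl⟩
    · rfl
    · exact absurd h.2.1 h'.2.2
  · intro e he
    simp only [coe_filter, mem_univ, true_and, Set.mem_ofPred_eq] at he
    obtain ⟨h1, a, ha, b, hb, rfl⟩ := he
    refine ⟨(a, b), ?_, rfl⟩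
    simp only [coe_filter, mem_univ, true_and, Set.mem_ofPred_eq]
    exact ⟨h1, ha, hb⟩

theorem isMinCut_of_le {U : Set ℕ} (hU : Splits (range I.n) U)
    (hle : ∀ U', Splits (range I.n) U' → cutM I.n I.weightAt U ≤ cutM I.n I.weightAt U') :
    IsMinCut I.graph I.weight {v | v.1 ∈ U} := by
  obtain ⟨⟨a, ha, haU⟩, b, hb, hbU⟩ := hU
  refine ⟨⟨⟨a, mem_range.1 ha⟩, haU⟩, fun e => hbU ?_, fun U' hne hun => ?_⟩
  · have : (⟨b, mem_range.1 hb⟩ : Fin I.n) ∈ {v : Fin I.n | v.1 ∈ U} := e ▸ Set.mem_univ _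
    exact this
  · have e : U' = {v | v.1 ∈ Fin.val '' U'} := by
      ext v
      simp [Fin.val_inj]
    rw [e, cutWeight_eq, cutWeight_eq]
    obtain ⟨c, hc⟩ := hne
    obtain ⟨d, hd⟩ := (Set.ne_univ_iff_exists_notMem U').1 hun
    refine hle _ ⟨⟨c, mem_range.2 c.2, c, hc, rfl⟩, d, mem_range.2 d.2, ?_⟩
    rintro ⟨d', hd', e'⟩
    exact hd (Fin.ext e' ▸ hd')

end RAM.Input

/-! ### The program -/

theorem nbrs_succ (k : ℕ) (W : ℕ → ℕ → ℝ) (x : ℕ) [Decidable (0 < W x k)] :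
    nbrs (k + 1) W x = if 0 < W x k then insert k (nbrs k W x) else nbrs k W x := by
  unfold nbrs
  rw [range_add_one, filter_insert]
  split_ifs <;> rfl

theorem rowSum_succ (k : ℕ) (W : ℕ → ℕ → ℝ) (x : ℕ) :
    rowSum (k + 1) W x = rowSum k W x + W x k :=
  sum_range_succ _ _

theorem notMem_nbrs_self (k : ℕ) (W : ℕ → ℕ → ℝ) (x : ℕ) : k ∉ nbrs k W x := by
  simp [nbrs]

/-- The set `S` has `c` elements. If these are at most three then they are listed by `p`, `q`, `r`,
where the rest of the list is filled up with `x`. -/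
structure IsRecord (n : ℕ) (S : Finset ℕ) (x c p q r : ℕ) : Prop where
  card : c = S.card
  lt : p < n ∧ q < n ∧ r < n
  zero : c = 0 → p = x ∧ q = x ∧ r = x
  one : c = 1 → S = {p} ∧ q = x ∧ r = x
  two : c = 2 → S = {p, q} ∧ r = x
  three : c = 3 → S = {p, q, r}

theorem IsRecord.empty {n x : ℕ} (hx : x < n) : IsRecord n ∅ x 0 x x x :=
  ⟨rfl, ⟨hx, hx, hx⟩, fun _ => ⟨rfl, rfl, rfl⟩, by simp, by simp, by simp⟩

theorem IsRecord.insert {n x c p q r k : ℕ} {S : Finset ℕ} (h : IsRecord n S x c p q r)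
    (hk : k < n) (hkS : k ∉ S) : IsRecord n (Insert.insert k S) x (c + 1) k p q := by
  refine ⟨by rw [card_insert_of_notMem hkS, h.card], ⟨hk, h.lt.1, h.lt.2.1⟩, by omega,
    fun hc => ?_, fun hc => ?_, fun hc => ?_⟩
  · have hc : c = 0 := by omega
    have hS := card_eq_zero.1 (h.card.symm.trans hc)
    obtain ⟨h1, h2, -⟩ := h.zero hc
    exact ⟨by simp [hS], h1, h2⟩
  · obtain ⟨h1, h2, -⟩ := h.one (by omega)
    exact ⟨by rw [h1], h2⟩
  · obtain ⟨h1, -⟩ := h.two (by omega)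
    rw [h1]

namespace RAM

/-- Read the row of the vertex in register `12`. Then its degree is in register `15`, up to three
neighbours are in the registers `16`, `17`, `18`, and its sum is in weight register `2`. -/
def scanRow : Program :=
  .seq (block [.const 15 0, .copy 16 12, .copy 17 12, .copy 18 12, .wzero 2, .arith .mul 14 12 0])
    (forUp 13 (block [.arith .add 19 14 13, .wload 3 0 19,
      .ite (.wle 3 0) .skip (block [.copy 18 17, .copy 17 16, .copy 16 13, .arith .add 15 15 1]),
      .wadd 2 2 3]))

/-- Compute the record of the vertex in register `12`, if it is alive, and compare its row sum with
the weight of the best cut. -/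
def refresh : Program :=
  .seq (.load 13 1 12) (.ite (.eq 13 12)
    (.seq scanRow (.seq (block [.store 3 12 15, .store 4 12 16, .store 5 12 17, .store 6 12 18])
      (.ite (.wle 2 1)
        (.seq (.wcopy 1 2) (forUp 13 (.seq (.load 14 1 13)
          (.ite (.eq 14 12) (.store 0 13 1) (block [.const 15 0, .store 0 13 15])))))
        .skip)))
    .skip)

/-- Choose the vertex in register `5` and the vertex in register `x` to be merged. -/
def choosePair (x : ℕ) : Program :=
  block [.copy 9 5, .copy 10 x, .const 11 1]

/-- Read the entries in the columns of the registers `6`, `7`, `8` of the row of the vertex in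
register `x`. -/
def readEntries (x : ℕ) : Program :=
  block [.arith .mul 13 x 0, .arith .add 14 13 6, .wload 2 0 14, .arith .add 14 13 7, .wload 3 0 14,
    .arith .add 14 13 8, .wload 4 0 14]

/-- Load the listed neighbours of the vertex in register `x`. -/
def loadRecord (x : ℕ) : Program :=
  block [.load 6 4 x, .load 7 5 x, .load 8 6 x]

/-- Look for a neighbour that dominates the row of the vertex in register `5`. -/
def findDominated : Program :=
  block [.load 13 1 5, .ite (.eq 13 5)
    (block [.load 13 3 5, .ite (.lt 3 13) .skip (block [loadRecord 5, readEntries 5,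
      .wadd 5 3 4, .ite (.wle 5 2) (choosePair 6)
        (block [.wadd 5 2 4, .ite (.wle 5 3) (choosePair 7)
          (block [.wadd 5 2 3, .ite (.wle 5 4) (choosePair 8) .skip])])])])
    .skip]

/-- If the vertex in register `x` has degree three and a common neighbour with the vertex in
register `5`, choose the two. -/
def tryAdjacent (x : ℕ) : Program :=
  block [.load 13 3 x, .ite (.eq 13 3)
    (block [readEntries x, .ite (.wle 2 0) (.ite (.wle 3 0) (.ite (.wle 4 0) .skip
      (choosePair x)) (choosePair x)) (choosePair x)])
    .skip]

/-- If the vertex in register `15` has degree three and the same neighbours as the vertex in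
register `5`, choose the two. -/
def tryTwin : Program :=
  .ite (.eq 15 5) .skip (block [.load 13 3 15, .ite (.eq 13 3)
    (block [readEntries 15, .ite (.wle 2 0) .skip (.ite (.wle 3 0) .skip (.ite (.wle 4 0) .skip
      (choosePair 15)))])
    .skip])

/-- Look for a twin of the vertex in register `5` among the neighbours of the vertex in register
`x`. -/
def tryTwins (x : ℕ) : Program :=
  .seq (.load 13 3 x) (.ite (.eq 13 3)
    (.seq (.seq (.load 15 4 x) tryTwin) (.seq (.seq (.load 15 5 x) tryTwin)
      (.seq (.load 15 6 x) tryTwin)))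
    .skip)

/-- Look for a vertex that can be merged with the vertex in register `5`, which has to have degree
three. -/
def findBuddy : Program :=
  .seq (block [.load 13 1 5, .load 14 3 5]) (.ite (.eq 13 5) (.ite (.eq 14 3) (.seq (loadRecord 5)
      (.seq (tryAdjacent 6) (.seq (tryAdjacent 7) (.seq (tryAdjacent 8)
        (.seq (tryTwins 6) (.seq (tryTwins 7) (tryTwins 8))))))) .skip)
    .skip)

/-- Merge the vertex in register `9` into the vertex in register `10`. -/
def mergePair : Program :=
  .seq (block [.arith .mul 15 9 0, .arith .mul 16 10 0, .arith .add 17 15 10, .wstore 0 17 0,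
      .arith .add 17 16 9, .wstore 0 17 0])
    (forUp 13 (block [.arith .add 17 15 13, .wload 2 0 17, .wstore 0 17 0,
      .arith .add 17 16 13, .wload 3 0 17, .wadd 3 3 2, .wstore 0 17 3,
      .arith .mul 18 13 0, .arith .add 17 18 10, .wstore 0 17 3,
      .arith .add 17 18 9, .wstore 0 17 0,
      .load 14 1 13, .ite (.eq 14 9) (.store 1 13 10) .skip]))

/-- Compute again the records of the vertices in the registers `10`, `6`, `7`, `8`. -/
def refreshAll : Program :=
  .seq (.seq (.copy 12 10) refresh) (.seq (.seq (.copy 12 6) refresh)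
    (.seq (.seq (.copy 12 7) refresh) (.seq (.copy 12 8) refresh)))

/-- Find two vertices that can be merged. -/
def findPair : Program :=
  .seq (forUp 5 findDominated) (.ite (.eq 11 1) .skip (forUp 5 findBuddy))

/-- Find two vertices and merge them, unless the best cut has no edges. -/
def reduceStep : Program :=
  .ite (.wle 1 0) (.copy 4 2)
    (.seq (.const 11 0) (.seq findPair
      (.seq (loadRecord 9) (.seq mergePair (.seq (.arith .sub 4 4 1) refreshAll)))))

/-- Copy the weight matrix, and start with the cut given by vertex `0`. -/
def prepare : Program :=
  .seq (block [.const 1 1, .const 2 2, .const 3 3, .copy 4 0])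
    (.seq (forUp 5 (.seq (block [.store 1 5 5, .arith .mul 14 5 0])
        (forUp 13 (block [.arith .add 15 14 13, .weight 2 5 13, .wstore 0 15 2]))))
      (.seq (.seq (.const 12 0) scanRow) (.seq (block [.const 13 0, .store 0 13 1, .wcopy 1 2])
        (forUp 5 (.seq (.copy 12 5) refresh)))))

/-- The program for MIN CUT. -/
def minCutProgram : Program :=
  .seq prepare (.loop (.lt 2 4) reduceStep)

/-- From `s` to `s'` the arrays, the word registers below `k` and the first two weight registers
are kept. -/
structure Keeps (k : ℕ) (s s' : State) : Prop where
  arr : s'.arr = s.arr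
  warr : s'.warr = s.warr
  reg : ∀ r < k, s'.reg r = s.reg r
  wreg : ∀ r < 2, s'.wreg r = s.wreg r

theorem Keeps.refl (k : ℕ) (s : State) : Keeps k s s :=
  ⟨rfl, rfl, fun _ _ => rfl, fun _ _ => rfl⟩

theorem Keeps.trans {k : ℕ} {s s' s'' : State} (h : Keeps k s s') (h' : Keeps k s' s'') :
    Keeps k s s'' :=
  ⟨h'.arr.trans h.arr, h'.warr.trans h.warr, fun r hr => (h'.reg r hr).trans (h.reg r hr),
    fun r hr => (h'.wreg r hr).trans (h.wreg r hr)⟩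

theorem Keeps.mono {k l : ℕ} {s s' : State} (h : Keeps k s s') (hl : l ≤ k) : Keeps l s s' :=
  ⟨h.arr, h.warr, fun r hr => h.reg r (hr.trans_le hl), h.wreg⟩

@[simp] theorem keeps_setReg {k : ℕ} {s s' : State} {x : ℕ} (hx : k ≤ x) (v : ℕ) :
    Keeps k s (s'.setReg x v) ↔ Keeps k s s' := by
  constructor <;> refine fun h => ⟨h.arr, h.warr, fun r hr => ?_, h.wreg⟩
  · rw [← h.reg r hr, State.setReg_reg, if_neg (by omega)]
  · rw [State.setReg_reg, if_neg (by omega), h.reg r hr]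

@[simp] theorem keeps_setWReg {k : ℕ} {s s' : State} {x : ℕ} (hx : 2 ≤ x) (v : ℝ) :
    Keeps k s (s'.setWReg x v) ↔ Keeps k s s' := by
  constructor <;> refine fun h => ⟨h.arr, h.warr, h.reg, fun r hr => ?_⟩
  · rw [← h.wreg r hr, State.setWReg_wreg, if_neg (by omega)]
  · rw [State.setWReg_wreg, if_neg (by omega), h.wreg r hr]

@[simp] theorem keeps_self (k : ℕ) (s : State) : Keeps k s s := Keeps.refl k s

/-- The matrix is stored by rows; this is why words up to `n * n` are needed. -/
theorem idx_lt {n a b : ℕ} (ha : a < n) (hb : b < n) : a * n + b < n * n := by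
  have : (a + 1) * n ≤ n * n := Nat.mul_le_mul_right n ha
  nlinarith

theorem idx_inj {n a b c d : ℕ} (hb : b < n) (hd : d < n) :
    a * n + b = c * n + d ↔ a = c ∧ b = d := by
  constructor
  · intro h
    have hn : 0 < n := by omega
    have h1 := congrArg (· / n) h
    have h2 := congrArg (· % n) h
    simp only [Nat.mul_comm _ n, Nat.mul_add_div hn, Nat.div_eq_of_lt hb,
      Nat.div_eq_of_lt hd, Nat.mul_add_mod, Nat.mod_eq_of_lt hb, Nat.mod_eq_of_lt hd] at h1 h2
    exact ⟨by simpa using h1, h2⟩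
  · rintro ⟨rfl, rfl⟩
    rfl

variable {I : Input} {B : ℕ} {n : ℕ} {W : ℕ → ℕ → ℝ}

/-- The registers form a queue of the three neighbours found last, initially filled with `x`. A
longer row spoils the list, but then only the degree matters. -/
theorem ok_scanRow (hB : n * n ≤ B) {x : ℕ} (hx : x < n) {s : State} (h0 : s.reg 0 = n)
    (h1 : s.reg 1 = 1) (hx' : s.reg 12 = x) (hz : s.wreg 0 = 0)
    (hM : ∀ b < n, s.warr 0 (x * n + b) = W x b) :
    Ok I B scanRow s (n * 20 + 20) fun s' => Keeps 13 s s' ∧ s'.wreg 2 = rowSum n W x ∧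
      IsRecord n (nbrs n W x) x (s'.reg 15) (s'.reg 16) (s'.reg 17) (s'.reg 18) := by
  classical
  have hnB : n ≤ B := le_trans (by nlinarith) hB
  refine (Ok.seq (R := fun s' => Keeps 13 s s' ∧ s'.reg 14 = x * n ∧ s'.wreg 2 = 0 ∧
    s'.reg 15 = 0 ∧ s'.reg 16 = x ∧ s'.reg 17 = x ∧ s'.reg 18 = x) (ok_of_wp ?_)
    fun s1 hs1 => ok_forUp (T := 9) (n := n) (fun k s' => Keeps 13 s s' ∧ s'.reg 14 = x * n ∧
      s'.wreg 2 = rowSum k W x ∧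
      IsRecord n (nbrs k W x) x (s'.reg 15) (s'.reg 16) (s'.reg 17) (s'.reg 18))
      hnB ?_ ?_ ?_ ?_).mono ?_ ?_
  · have : x * n ≤ B := by nlinarith
    simp [wp, block, Op.eval, h0, hx', this]
  · rintro k s' ⟨hk, -⟩
    exact ⟨(hk.reg 0 (by norm_num)).trans h0, (hk.reg 1 (by norm_num)).trans h1⟩
  · rintro k s' v h
    simpa using h
  · rintro k hk s' ⟨hK, h14, hd, hr⟩ h13
    refine (ok_of_wp ?_).mono (by decide) fun _ h => h
    have hz' : s'.wreg 0 = 0 := (hK.wreg 0 (by norm_num)).trans hz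
    have h1' : s'.reg 1 = 1 := (hK.reg 1 (by norm_num)).trans h1
    have hw : s'.warr 0 (x * n + k) = W x k := by rw [hK.warr, hM k hk]
    have hle : x * n + k ≤ B := (idx_lt hx hk).le.trans hB
    have hc : s'.reg 15 + 1 ≤ B := by
      have : (nbrs k W x).card ≤ k := (card_filter_le _ _).trans (card_range k).le
      rw [hr.card]
      omega
    simp only [wp, block, Op.eval, Test.Holds]
    refine ⟨by simpa [h14, h13] using hle, ?_⟩
    simp [h14, h13, hw, hz', h1', hc, hK, hd, rowSum_succ, nbrs_succ]
    constructor
    · intro hle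
      simpa [hle.not_gt] using hr
    · intro hlt
      simpa [hlt] using hr.insert hk (notMem_nbrs_self k W x)
  · obtain ⟨h2, h3, h4, h5, h6, h7, h8⟩ := hs1
    refine ⟨h2, h3, by simpa [rowSum] using h4, ?_⟩
    rw [h5, h6, h7, h8]
    exact IsRecord.empty hx
  · simp [cost, block]
    omega
  · exact fun s' ⟨h2, _, h3⟩ => ⟨h2, h3⟩

end RAM

theorem cutM_congr {n : ℕ} {W : ℕ → ℕ → ℝ} {U V : Set ℕ} (h : ∀ i < n, i ∈ U ↔ i ∈ V) :
    cutM n W U = cutM n W V := by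
  unfold cutM
  refine sum_congr rfl fun a ha => sum_congr rfl fun b hb => ?_
  have h1 := h a (mem_range.1 ha)
  have h2 := h b (mem_range.1 hb)
  by_cases h3 : a ∈ V <;> by_cases h4 : b ∈ V <;> simp [h1, h2, h3, h4]

theorem splits_congr {n : ℕ} {U V : Set ℕ} (h : ∀ i < n, i ∈ U ↔ i ∈ V)
    (hU : Splits (range n) U) : Splits (range n) V := by
  obtain ⟨⟨a, ha, haU⟩, b, hb, hbU⟩ := hU
  exact ⟨⟨a, ha, (h a (mem_range.1 ha)).1 haU⟩, b, hb, fun e => hbU ((h b (mem_range.1 hb)).2 e)⟩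

/-- The quantifier over all bounds `c ≤ best` lets the best weight decrease later without revisiting
the lost cuts. -/
theorem Dominates.mono {n : ℕ} {W₀ W : ℕ → ℕ → ℝ} {A : Finset ℕ} {b b' : ℝ}
    (h : Dominates n W₀ A W b) (hb : b' ≤ b) : Dominates n W₀ A W b' :=
  fun c hc => h c (hc.trans hb)

/-! ### The invariant of the program, and the update of records -/

namespace RAM

/-- The registers that are never changed, and the number of vertices that are left. -/
structure Fixed (n m : ℕ) (s : State) : Prop where
  reg0 : s.reg 0 = n
  reg1 : s.reg 1 = 1
  reg2 : s.reg 2 = 2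
  reg3 : s.reg 3 = 3
  reg4 : s.reg 4 = m
  zero : s.wreg 0 = 0

/-- The memory represents the merged graph. -/
structure Graph (I : Input) (ρ : ℕ → ℕ) (A : Finset ℕ) (W : ℕ → ℕ → ℝ) (s : State) : Prop where
  merged : IsMerged I.n I.weightAt ρ A W
  mat : ∀ a < I.n, ∀ b < I.n, s.warr 0 (a * I.n + b) = W a b
  rep : ∀ i < I.n, s.arr 1 i = ρ i

/-- The output array represents a cut of weight `best` that is at least as good as all cuts that
were lost. -/
structure Best (I : Input) (A : Finset ℕ) (W : ℕ → ℕ → ℝ) (s : State) : Prop where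
  dom : Dominates I.n I.weightAt A W (s.wreg 1)
  splits : Splits (range I.n) {i | s.arr 0 i = 1}
  cut : cutM I.n I.weightAt {i | s.arr 0 i = 1} = s.wreg 1

/-- The record of `x` is up to date, and the best cut is not worse than the row sum of `x`. -/
structure Fresh (I : Input) (W : ℕ → ℕ → ℝ) (s : State) (x : ℕ) : Prop where
  record : IsRecord I.n (nbrs I.n W x) x (s.arr 3 x) (s.arr 4 x) (s.arr 5 x) (s.arr 6 x)
  row : s.wreg 1 ≤ rowSum I.n W x

/-- The invariant of the program, where the vertices in `X` need not be up to date. -/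
structure Inv (I : Input) (ρ : ℕ → ℕ) (A : Finset ℕ) (W : ℕ → ℕ → ℝ) (X : Set ℕ) (s : State) :
    Prop where
  fixed : Fixed I.n A.card s
  two_le : 2 ≤ A.card
  graph : Graph I ρ A W s
  best : Best I A W s
  fresh : ∀ x ∈ A, x ∉ X → Fresh I W s x

variable {I : Input} {B : ℕ} {ρ : ℕ → ℕ} {A : Finset ℕ} {W : ℕ → ℕ → ℝ} {X : Set ℕ}

/-- Word registers from `5` on and weight registers from `2` on are scratch space. -/
theorem Inv.of_keeps {s s' : State} (h : Inv I ρ A W X s) (hk : Keeps 5 s s') :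
    Inv I ρ A W X s' := by
  have hw := hk.wreg 1 (by norm_num)
  refine ⟨⟨?_, ?_, ?_, ?_, ?_, ?_⟩, h.two_le, ⟨h.graph.merged, ?_, ?_⟩, ⟨?_, ?_, ?_⟩, ?_⟩
  · rw [hk.reg 0 (by norm_num), h.fixed.reg0]
  · rw [hk.reg 1 (by norm_num), h.fixed.reg1]
  · rw [hk.reg 2 (by norm_num), h.fixed.reg2]
  · rw [hk.reg 3 (by norm_num), h.fixed.reg3]
  · rw [hk.reg 4 (by norm_num), h.fixed.reg4]
  · rw [hk.wreg 0 (by norm_num), h.fixed.zero]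
  · rw [hk.warr]
    exact h.graph.mat
  · rw [hk.arr]
    exact h.graph.rep
  · rw [hw]
    exact h.best.dom
  · rw [hk.arr]
    exact h.best.splits
  · rw [hk.arr, hw]
    exact h.best.cut
  · intro x hx hxX
    have := h.fresh x hx hxX
    exact ⟨by rw [hk.arr]; exact this.record, by rw [hw]; exact this.row⟩

theorem Inv.weaken {s : State} {Y : Set ℕ} (h : Inv I ρ A W X s) (hXY : ∀ x ∈ A, x ∈ X → x ∈ Y) :
    Inv I ρ A W Y s :=
  ⟨h.fixed, h.two_le, h.graph, h.best, fun x hx hxY => h.fresh x hx fun hxX => hxY (hXY x hx hxX)⟩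

/-- Registers below `13` and everything permanent is kept, except for the output array, where the
vertices `i < k` with `ρ i = x` are marked. -/
structure Marks (ρ : ℕ → ℕ) (x k : ℕ) (s s' : State) : Prop where
  arr : ∀ a j, a ≠ 0 → s'.arr a j = s.arr a j
  warr : s'.warr = s.warr
  reg : ∀ r < 13, s'.reg r = s.reg r
  wreg : ∀ r < 2, s'.wreg r = s.wreg r
  mark : ∀ i < k, s'.arr 0 i = 1 ↔ ρ i = x

theorem ok_mark {n x : ℕ} (hn : n ≤ B) {s : State} (h0 : s.reg 0 = n) (h1 : s.reg 1 = 1)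
    (hx : s.reg 12 = x) (hrep : ∀ i < n, s.arr 1 i = ρ i) :
    Ok I B (forUp 13 (.seq (.load 14 1 13)
      (.ite (.eq 14 12) (.store 0 13 1) (block [.const 15 0, .store 0 13 15])))) s (n * 20 + 2)
      (Marks ρ x n s) := by
  refine (ok_forUp (T := 5) (n := n) (Marks ρ x · s) hn ?_ ?_ ?_ ?_).mono
    (by omega) fun _ h => h
  · exact fun k s' h => ⟨(h.reg 0 (by norm_num)).trans h0, (h.reg 1 (by norm_num)).trans h1⟩
  · intro k s' v h
    refine ⟨h.arr, h.warr, fun r hr => ?_, h.wreg, h.mark⟩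
    rw [State.setReg_reg, if_neg (by omega), h.reg r hr]
  · intro k hk s' h h13
    refine (ok_of_wp ?_).mono (by decide) fun _ h => h
    have h12 : s'.reg 12 = x := (h.reg 12 (by norm_num)).trans hx
    have h1' : s'.reg 1 = 1 := (h.reg 1 (by norm_num)).trans h1
    have hr : s'.arr 1 k = ρ k := (h.arr 1 k (by norm_num)).trans (hrep k hk)
    have mk : ∀ (t : State) v, t.arr = (s'.setArr 0 k v).arr → t.warr = s'.warr →
        (∀ r < 13, t.reg r = s'.reg r) → t.wreg = s'.wreg → (v = 1 ↔ ρ k = x) →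
        Marks ρ x (k + 1) s t := by
      intro t v e1 e2 e3 e4 e5
      refine ⟨fun a j ha => ?_, e2.trans h.warr, fun r hr => (e3 r hr).trans (h.reg r hr),
        fun r hr => by rw [e4]; exact h.wreg r hr, fun i hi => ?_⟩
      · rw [e1, State.setArr_arr, if_neg (fun h => ha h.1), h.arr a j ha]
      · rw [e1, State.setArr_arr]
        by_cases hik : i = k
        · simpa [hik] using e5
        · rw [if_neg (fun h => hik h.2)]
          exact h.mark i (by omega)
    simp only [wp, block, Test.Holds]
    simp [h13, h12, h1', hr]
    constructor
    · intro e
      exact mk _ 1 rfl rfl (fun r hr => by simp [show r ≠ 14 by omega]) rfl (by simp [e])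
    · intro e
      exact mk _ 0 rfl rfl (fun r hr => by simp [show r ≠ 14 by omega, show r ≠ 15 by omega]) rfl (by simp [e])
  · exact ⟨fun _ _ _ => rfl, rfl, fun _ _ => rfl, fun _ _ => rfl, by simp⟩

/-- The two alternatives for the best cut are to keep it or to replace it by the class of `x`. In
both cases its weight does not increase, so the other fresh vertices remain fresh. -/
theorem Inv.refresh {x : ℕ} (hx : x ∈ A) {s s' : State} (h : Inv I ρ A W X s)
    (hreg : ∀ r < 13, s'.reg r = s.reg r) (hzero : s'.wreg 0 = s.wreg 0) (hwarr : s'.warr = s.warr)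
    (harr : ∀ a j, a ≠ 0 → (a = 1 ∨ j ≠ x) → s'.arr a j = s.arr a j)
    (hrec : IsRecord I.n (nbrs I.n W x) x (s'.arr 3 x) (s'.arr 4 x) (s'.arr 5 x) (s'.arr 6 x))
    (hbest : (s'.wreg 1 = s.wreg 1 ∧ s.wreg 1 ≤ rowSum I.n W x ∧ ∀ i, s'.arr 0 i = s.arr 0 i) ∨
      (s'.wreg 1 = rowSum I.n W x ∧ rowSum I.n W x ≤ s.wreg 1 ∧
        ∀ i < I.n, s'.arr 0 i = 1 ↔ ρ i = x)) : Inv I ρ A W (X \ {x}) s' := by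
  have hle : s'.wreg 1 ≤ s.wreg 1 := by rcases hbest with h | h <;> linarith
  have hlx : s'.wreg 1 ≤ rowSum I.n W x := by rcases hbest with h | h <;> linarith
  refine ⟨⟨?_, ?_, ?_, ?_, ?_, ?_⟩, h.two_le, ⟨h.graph.merged, ?_, ?_⟩,
    ⟨h.best.dom.mono hle, ?_, ?_⟩, ?_⟩
  · rw [hreg 0 (by norm_num), h.fixed.reg0]
  · rw [hreg 1 (by norm_num), h.fixed.reg1]
  · rw [hreg 2 (by norm_num), h.fixed.reg2]
  · rw [hreg 3 (by norm_num), h.fixed.reg3]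
  · rw [hreg 4 (by norm_num), h.fixed.reg4]
  · rw [hzero, h.fixed.zero]
  · rw [hwarr]
    exact h.graph.mat
  · intro i hi
    rw [harr 1 i (by norm_num) (Or.inl rfl), h.graph.rep i hi]
  · rcases hbest with ⟨_, _, h3⟩ | ⟨_, _, h3⟩
    · simpa only [h3] using h.best.splits
    · exact splits_congr (fun i hi => (h3 i hi).symm) (h.graph.merged.splits_class h.two_le hx)
  · rcases hbest with ⟨h1, _, h3⟩ | ⟨h1, _, h3⟩
    · simpa only [h3, h1] using h.best.cut
    · rw [h1, ← h.graph.merged.cutM_class hx]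
      exact cutM_congr h3
  · intro y hy hyX
    by_cases hyx : y = x
    · subst hyx
      exact ⟨hrec, hlx⟩
    · have := h.fresh y hy fun e => hyX ⟨e, hyx⟩
      refine ⟨?_, hle.trans this.row⟩
      rw [harr 3 y (by norm_num) (Or.inr hyx), harr 4 y (by norm_num) (Or.inr hyx),
        harr 5 y (by norm_num) (Or.inr hyx), harr 6 y (by norm_num) (Or.inr hyx)]
      exact this.record

theorem ok_refresh (hB : I.n * I.n ≤ B) {x : ℕ} (hx : x < I.n) {s : State} (h : Inv I ρ A W X s)
    (h12 : s.reg 12 = x) :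
    Ok I B refresh s (I.n * 40 + 40) fun s' =>
      Inv I ρ A W (X \ {x}) s' ∧ ∀ r < 13, s'.reg r = s.reg r := by
  have hnB : I.n ≤ B := le_trans (by nlinarith) hB
  have hrep := h.graph.rep x hx
  refine Ok.mono (T := 1 + (I.n * 40 + 32 + 1)) ?_ (by omega) fun _ h => h
  refine Ok.seq (R := fun s' => Keeps 13 s s' ∧ s'.reg 13 = ρ x) (ok_of_wp ?_) ?_
  · simp [wp, h12, hrep]
  rintro s1 ⟨hk1, h13⟩
  have h12' : s1.reg 12 = x := (hk1.reg 12 (by norm_num)).trans h12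
  have hI1 := h.of_keeps (hk1.mono (by norm_num))
  refine Ok.ite ?_ ?_
  · intro hc
    have hxA : x ∈ A := by
      refine (h.graph.merged.mem_iff hx).2 ?_
      simpa [Test.Holds, h13, h12'] using hc
    refine Ok.mono (T := (I.n * 20 + 20) + (4 + ((1 + (I.n * 20 + 2)) + 1))) ?_ (by omega)
      fun _ h => h
    refine (ok_scanRow hB hx hI1.fixed.reg0 hI1.fixed.reg1 h12' hI1.fixed.zero
      (hI1.graph.mat x hx)).seq ?_
    rintro s2 ⟨hk2, hd, hr⟩
    have h12'' : s2.reg 12 = x := (hk2.reg 12 (by norm_num)).trans h12'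
    have hk := hk1.trans hk2
    refine Ok.seq (R := fun s' => s'.reg = s2.reg ∧ s'.wreg = s2.wreg ∧ s'.warr = s2.warr ∧
      (∀ a j, (a < 2 ∨ j ≠ x) → s'.arr a j = s2.arr a j) ∧
      IsRecord I.n (nbrs I.n W x) x (s'.arr 3 x) (s'.arr 4 x) (s'.arr 5 x) (s'.arr 6 x))
      ((ok_of_wp ?_).mono (by decide) fun _ h => h) ?_
    · simp only [wp, block]
      refine ⟨rfl, rfl, rfl, fun a j haj => ?_, ?_⟩
      · simp only [State.setArr_arr, State.setArr_reg, h12'']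
        rw [if_neg (by omega), if_neg (by omega), if_neg (by omega), if_neg (by omega)]
      · simpa [h12''] using hr
    rintro s3 ⟨e1, e2, e3, e4, e5⟩
    have hreg3 : ∀ r < 13, s3.reg r = s.reg r := fun r hr => by rw [e1, hk.reg r hr]
    refine Ok.ite ?_ ?_
    · intro hc
      have hc' : rowSum I.n W x ≤ s.wreg 1 := by
        simpa [Test.Holds, e2, hd, hk.wreg 1 (by norm_num)] using hc
      refine Ok.seq (R := fun s' => s'.reg = s3.reg ∧ s'.arr = s3.arr ∧ s'.warr = s3.warr ∧
        s'.wreg 0 = s3.wreg 0 ∧ s'.wreg 1 = rowSum I.n W x) (ok_of_wp ?_) ?_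
      · simp [wp, e2, hd]
      rintro s4 ⟨f1, f2, f3, f4, f5⟩
      have hreg4 : ∀ r < 13, s4.reg r = s.reg r := fun r hr => by rw [f1, hreg3 r hr]
      refine (ok_mark hnB ((hreg4 0 (by norm_num)).trans h.fixed.reg0)
        ((hreg4 1 (by norm_num)).trans h.fixed.reg1) ((hreg4 12 (by norm_num)).trans h12)
        (ρ := ρ) fun i hi => ?_).mono le_rfl ?_
      · rw [f2, e4 1 i (Or.inl (by norm_num)), hk.arr, h.graph.rep i hi]
      intro s5 hm
      have hreg5 : ∀ r < 13, s5.reg r = s.reg r := fun r hr => (hm.reg r hr).trans (hreg4 r hr)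
      refine ⟨h.refresh hxA hreg5 ?_ ?_ ?_ ?_ (Or.inr ⟨?_, hc', hm.mark⟩), hreg5⟩
      · rw [hm.wreg 0 (by norm_num), f4, e2, hk.wreg 0 (by norm_num)]
      · rw [hm.warr, f3, e3, hk.warr]
      · intro a j ha haj
        rw [hm.arr a j ha, f2, e4 a j (by omega), hk.arr]
      · rw [hm.arr 3 x (by norm_num), hm.arr 4 x (by norm_num), hm.arr 5 x (by norm_num),
          hm.arr 6 x (by norm_num), f2]
        exact e5
      · rw [hm.wreg 1 (by norm_num), f5]
    · intro hc
      have hc' : s.wreg 1 ≤ rowSum I.n W x := by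
        simpa [Test.Holds, e2, hd, hk.wreg 1 (by norm_num)] using (le_of_not_ge hc)
      refine (ok_of_wp ?_).mono (show 1 ≤ _ by omega) fun _ h => h
      refine ⟨h.refresh hxA hreg3 ?_ ?_ ?_ e5 (Or.inl ⟨?_, hc', fun i => ?_⟩), hreg3⟩
      · rw [e2, hk.wreg 0 (by norm_num)]
      · rw [e3, hk.warr]
      · intro a j ha haj
        rw [e4 a j (by omega), hk.arr]
      · rw [e2, hk.wreg 1 (by norm_num)]
      · rw [e4 0 i (by omega), hk.arr]
  -- A vertex that has been merged away is not in `A`, so there is nothing to update.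
  · intro hc
    have hxA : x ∉ A := fun hxA => hc (by
      have := h.graph.merged.fix x hxA
      simp [Test.Holds, h13, h12', this])
    refine (ok_of_wp ?_).mono (show 1 ≤ _ by omega) fun _ h => h
    exact ⟨hI1.weaken fun y hy hyX => ⟨hyX, fun e => hxA (e ▸ hy)⟩, hk1.reg⟩

end RAM

/-! ### Merging two rows in place -/

/-- The matrix after the first `k` steps of merging `u` into `v`. -/
noncomputable def mergeUpTo (W : ℕ → ℕ → ℝ) (u v k a b : ℕ) : ℝ :=
  if (a = u ∧ b = v) ∨ (a = v ∧ b = u) then 0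
  else if ((a = u ∨ a = v) ∧ b < k) ∨ ((b = u ∨ b = v) ∧ a < k) then mergeW W u v a b
  else W a b

/-- The conditions appear in the reverse order of the four writes of a round, since later writes win
when `k` is `u` or `v`. -/
theorem IsWeight.mergeUpTo_succ {n : ℕ} {A : Finset ℕ} {W : ℕ → ℕ → ℝ} (h : IsWeight n A W)
    {u v : ℕ} (huv : u ≠ v) (k a b : ℕ) : mergeUpTo W u v (k + 1) a b =
      if a = k ∧ b = u then 0
      else if a = k ∧ b = v then mergeUpTo W u v k v k + mergeUpTo W u v k u k
      else if a = v ∧ b = k then mergeUpTo W u v k v k + mergeUpTo W u v k u k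
      else if a = u ∧ b = k then 0 else mergeUpTo W u v k a b := by
  have s1 := h.symm k v
  have s2 := h.symm k u
  have d1 := h.diag u
  have d2 := h.diag v
  -- The entries between `u` and `v` are cleared beforehand, so no loop of weight `W u v` appears at
  -- `v`.
  have e1 : mergeUpTo W u v k u k = if k = v then 0 else W u k := by
    unfold mergeUpTo
    by_cases hku : k = u <;> by_cases hkv : k = v <;> simp_all
  have e2 : mergeUpTo W u v k v k = if k = u then 0 else W v k := by
    unfold mergeUpTo
    by_cases hku : k = u <;> by_cases hkv : k = v <;> simp_all
  have l1 : a < k + 1 ↔ a < k ∨ a = k := by omega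
  have l2 : b < k + 1 ↔ b < k ∨ b = k := by omega
  rw [e1, e2]
  unfold mergeUpTo mergeW
  simp only [l1, l2]
  by_cases hau : a = u
  · by_cases hbk : b = k <;> by_cases hbu : b = u <;> by_cases hbv : b = v <;> simp_all <;> grind
  by_cases hav : a = v
  · by_cases hbk : b = k <;> by_cases hbu : b = u <;> by_cases hbv : b = v <;> simp_all <;> grind
  by_cases hak : a = k
  · by_cases hbu : b = u <;> by_cases hbv : b = v <;> simp_all
  · simp [hau, hav, hak]

theorem IsWeight.mergeUpTo_eq {n : ℕ} {A : Finset ℕ} {W : ℕ → ℕ → ℝ} (h : IsWeight n A W)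
    {u v : ℕ} (huv : u ≠ v) {a b : ℕ} (ha : a < n) (hb : b < n) :
    mergeUpTo W u v n a b = mergeW W u v a b := by
  have d1 := h.diag a
  unfold mergeUpTo mergeW
  grind

namespace RAM

variable {I : Input} {B : ℕ} {ρ : ℕ → ℕ} {A : Finset ℕ} {W : ℕ → ℕ → ℝ} {X : Set ℕ}

/-- The memory after the first `k` steps of merging `u` into `v`. -/
structure Merging (n : ℕ) (ρ : ℕ → ℕ) (W : ℕ → ℕ → ℝ) (u v k : ℕ) (s s' : State) : Prop where
  reg : ∀ r < 13, s'.reg r = s.reg r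
  reg15 : s'.reg 15 = u * n
  reg16 : s'.reg 16 = v * n
  wreg : ∀ r < 2, s'.wreg r = s.wreg r
  arr : ∀ a j, a ≠ 1 → s'.arr a j = s.arr a j
  rep : ∀ i < n, s'.arr 1 i = if i < k then foldMap u v (ρ i) else ρ i
  mat : ∀ a < n, ∀ b < n, s'.warr 0 (a * n + b) = mergeUpTo W u v k a b

theorem ok_mergePair (hB : I.n * I.n ≤ B) {s : State} (h : Inv I ρ A W X s) {u v : ℕ}
    (hu : u ∈ A) (hv : v ∈ A) (huv : u ≠ v) (h9 : s.reg 9 = u) (h10 : s.reg 10 = v) :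
    Ok I B mergePair s (I.n * 20 + 20) (Merging I.n ρ W u v I.n s) := by
  have hW := h.graph.merged.isWeight
  have hun := hW.lt u hu
  have hvn := hW.lt v hv
  have hnB : I.n ≤ B := le_trans (by nlinarith) hB
  have hle : ∀ a < I.n, ∀ b < I.n, a * I.n + b ≤ B := fun a ha b hb => (idx_lt ha hb).le.trans hB
  have hle' : ∀ a < I.n, a * I.n ≤ B := fun a ha => by nlinarith
  refine ((ok_of_wp (Q := Merging I.n ρ W u v 0 s) ?_).seq fun s1 h1 =>
    ok_forUp (T := 16) (n := I.n) (Merging I.n ρ W u v · s) hnB ?_ ?_ ?_ h1).mono ?_ ?_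
  · have h0 := h.fixed.reg0
    have hz := h.fixed.zero
    simp only [wp, block, Op.eval]
    simp [h9, h10, h0, hz, hle', hle, hun, hvn]
    refine ⟨fun r hr => ?_, by simp, by simp, fun r hr => rfl, fun _ _ _ => rfl,
      fun i hi => h.graph.rep i hi, fun a ha b hb => ?_⟩
    · simp [show r ≠ 17 by omega, show r ≠ 16 by omega, show r ≠ 15 by omega]
    · simp [idx_inj hb hvn, idx_inj hb hun, h.graph.mat a ha b hb, mergeUpTo]
      grind
  · exact fun k s' hk => ⟨(hk.reg 0 (by norm_num)).trans h.fixed.reg0,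
      (hk.reg 1 (by norm_num)).trans h.fixed.reg1⟩
  · intro k s' x hk
    refine ⟨fun r hr => ?_, ?_, ?_, hk.wreg, hk.arr, hk.rep, hk.mat⟩
    · rw [State.setReg_reg, if_neg (by omega), hk.reg r hr]
    · simpa using hk.reg15
    · simpa using hk.reg16
  · intro k hk s' hm h13
    refine (ok_of_wp ?_).mono (by decide) fun _ h => h
    have f0 := (hm.reg 0 (by norm_num)).trans h.fixed.reg0
    have f9 := (hm.reg 9 (by norm_num)).trans h9
    have f10 := (hm.reg 10 (by norm_num)).trans h10
    have fz := (hm.wreg 0 (by norm_num)).trans h.fixed.zero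
    have f15 := hm.reg15
    have f16 := hm.reg16
    have frep := hm.rep k hk
    rw [if_neg (lt_irrefl k)] at frep
    have hn0 : I.n ≠ 0 := by omega
    have m1 := hm.mat u hun k hk
    have m2 := hm.mat v hvn k hk
    have mk : ∀ t : State, (∀ r < 13, t.reg r = s'.reg r) → t.reg 15 = s'.reg 15 →
        t.reg 16 = s'.reg 16 → (∀ r < 2, t.wreg r = s'.wreg r) →
        (∀ a j, a ≠ 1 → t.arr a j = s'.arr a j) →
        (∀ i < I.n, t.arr 1 i = if i = k then foldMap u v (ρ k) else s'.arr 1 i) →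
        (∀ a < I.n, ∀ b < I.n, t.warr 0 (a * I.n + b) =
          if a = k ∧ b = u then 0
          else if a = k ∧ b = v then mergeUpTo W u v k v k + mergeUpTo W u v k u k
          else if a = v ∧ b = k then mergeUpTo W u v k v k + mergeUpTo W u v k u k
          else if a = u ∧ b = k then 0 else s'.warr 0 (a * I.n + b)) →
        Merging I.n ρ W u v (k + 1) s t := by
      intro t t1 t2 t3 t4 t5 t6 t7
      refine ⟨fun r hr => (t1 r hr).trans (hm.reg r hr), t2.trans f15, t3.trans f16,
        fun r hr => (t4 r hr).trans (hm.wreg r hr), fun a j ha => (t5 a j ha).trans (hm.arr a j ha),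
        fun i hi => ?_, fun a ha b hb => ?_⟩
      · rw [t6 i hi, hm.rep i hi]
        grind
      · rw [t7 a ha b hb, hm.mat a ha b hb, hW.mergeUpTo_succ huv]
    simp only [wp, block, Op.eval, Test.Holds]
    simp [f0, f9, f10, fz, f15, f16, h13, frep, m1, m2, hle, hle', hun, hvn, hk, huv.symm, hn0]
    have regs : ∀ r < 13, r ≠ 14 ∧ r ≠ 17 ∧ r ≠ 18 := fun r hr => by omega
    have wregs : ∀ r < 2, r ≠ 2 ∧ r ≠ 3 := fun r hr => by omega
    constructor
    · intro e
      refine mk _ (fun r hr => by simp [regs r hr]) (by simp) (by simp)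
        (fun r hr => by simp [wregs r hr]) (fun a j ha => by simp [ha])
        (fun i hi => by simp [foldMap, e]) (fun a ha b hb => ?_)
      simp [idx_inj hb hun, idx_inj hb hvn, idx_inj hb hk]
    · intro e
      refine mk _ (fun r hr => by simp [regs r hr]) (by simp) (by simp)
        (fun r hr => by simp [wregs r hr]) (fun a j ha => by simp)
        (fun i hi => ?_) (fun a ha b hb => ?_)
      · by_cases hik : i = k
        · subst hik
          simp [foldMap, e, frep]
        · simp [hik]
      · simp [idx_inj hb hun, idx_inj hb hvn, idx_inj hb hk]
  · simp [cost, block]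
    omega
  · exact fun _ h => h

end RAM

/-! ### What a record reveals about its row -/

namespace IsRecord

variable {n : ℕ} {A : Finset ℕ} {W : ℕ → ℕ → ℝ} {x c p q r : ℕ}

/-- Unused places of the list hold `x`, whose diagonal entry is zero, so one formula covers all
degrees up to three. -/
theorem rowSum_eq (h : IsRecord n (nbrs n W x) x c p q r) (hW : IsWeight n A W) (hc : c ≤ 3) :
    rowSum n W x = W x p + W x q + W x r := by
  rw [hW.rowSum_eq]
  have hcard := h.card
  have d := hW.diag x
  rcases (by omega : c = 0 ∨ c = 1 ∨ c = 2 ∨ c = 3) with hc | hc | hc | hc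
  · obtain ⟨h1, h2, h3⟩ := h.zero hc
    rw [card_eq_zero.1 (hcard.symm.trans hc), h1, h2, h3, d]
    simp
  · obtain ⟨h1, h2, h3⟩ := h.one hc
    rw [h1, h2, h3, d]
    simp
  · obtain ⟨h1, h2⟩ := h.two hc
    have hpq : p ≠ q := by
      rintro rfl
      rw [h1] at hcard
      simp at hcard
      omega
    rw [h1, h2, d, sum_pair hpq]
    simp
  · have h1 := h.three hc
    have h3 : ({p, q, r} : Finset ℕ).card = 3 := by rw [← h1, ← hcard, hc]
    have hpq : p ≠ q := by
      rintro rfl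
      rw [insert_eq_of_mem (mem_insert_self _ _)] at h3
      have := card_le_two (a := p) (b := r)
      omega
    have hpr : p ≠ r := by
      rintro rfl
      rw [insert_eq_of_mem (by simp)] at h3
      have := card_le_two (a := q) (b := p)
      omega
    have hqr : q ≠ r := by
      rintro rfl
      rw [pair_eq_singleton] at h3
      have := card_le_two (a := p) (b := q)
      omega
    rw [h1, sum_insert (by simp [hpq, hpr]), sum_pair hqr]
    ring

theorem eq_of_pos (h : IsRecord n (nbrs n W x) x c p q r) (hW : IsWeight n A W) (hc : c ≤ 3)
    {b : ℕ} (hb : 0 < W x b) : b = p ∨ b = q ∨ b = r := by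
  have hb := hW.mem_nbrs.2 hb
  rcases (by omega : c = 0 ∨ c = 1 ∨ c = 2 ∨ c = 3) with hc | hc | hc | hc
  · rw [card_eq_zero.1 (h.card.symm.trans hc)] at hb
    simp at hb
  · rw [(h.one hc).1] at hb
    simp at hb
    tauto
  · rw [(h.two hc).1] at hb
    simp at hb
    tauto
  · rw [h.three hc] at hb
    simpa using hb

theorem pos_iff (h : IsRecord n (nbrs n W x) x c p q r) (hW : IsWeight n A W) (hc : c = 3)
    {b : ℕ} : 0 < W x b ↔ b = p ∨ b = q ∨ b = r := by
  rw [← hW.mem_nbrs, h.three hc]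
  simp

end IsRecord

/-! ### The search for a pair to merge -/

namespace RAM

variable {I : Input} {B : ℕ} {ρ : ℕ → ℕ} {A : Finset ℕ} {W : ℕ → ℕ → ℝ} {X : Set ℕ}

/-- No vertex with at most three neighbours is dominated by one of them, among the vertices
in `S`. -/
def NoneDominated (n : ℕ) (W : ℕ → ℕ → ℝ) (S : Set ℕ) : Prop :=
  ∀ x ∈ S, (nbrs n W x).card ≤ 3 → ∀ c, 2 * W x c < rowSum n W x

/-- If register `11` is zero then `N` holds, otherwise it is one, and the registers `9` and `10`
satisfy `P`. -/
def Outcome (N : Prop) (P : ℕ → ℕ → Prop) (s : State) : Prop :=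
  (s.reg 11 = 0 ∧ N) ∨ (s.reg 11 = 1 ∧ P (s.reg 9) (s.reg 10))

theorem ok_findDominated (hB : I.n * I.n ≤ B) {k : ℕ} (hk : k < I.n) {s : State}
    (h : Inv I ρ A W ∅ s) (h5 : s.reg 5 = k) (hpos : 0 < s.wreg 1)
    (ho : Outcome (NoneDominated I.n W {x | x ∈ A ∧ x < k}) (Mergeable I.n A W) s) :
    Ok I B findDominated s 50 fun s' => Keeps 6 s s' ∧
      Outcome (NoneDominated I.n W {x | x ∈ A ∧ x < k + 1}) (Mergeable I.n A W) s' := by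
  have hW := h.graph.merged.isWeight
  have hnB : I.n ≤ B := le_trans (by nlinarith) hB
  -- The code has two kinds of exits: nothing is found at `k` and the earlier outcome persists, or a
  -- pair is chosen. Each path through the code then only has to name its exit.
  suffices main : ∀ Q : State → Prop,
      (∀ t, Keeps 6 s t → t.reg 9 = s.reg 9 → t.reg 10 = s.reg 10 → t.reg 11 = s.reg 11 →
        (k ∈ A → (nbrs I.n W k).card ≤ 3 → ∀ c, 2 * W k c < rowSum I.n W k) → Q t) →
      (∀ t v, Keeps 6 s t → t.reg 9 = k → t.reg 10 = v → t.reg 11 = 1 →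
        Mergeable I.n A W k v → Q t) → Ok I B findDominated s 50 Q by
    refine main _ (fun t ht t9 t10 t11 hN => ⟨ht, ?_⟩)
      (fun t v ht t9 t10 t11 hM => ⟨ht, Or.inr ⟨t11, by rwa [t9, t10]⟩⟩)
    unfold Outcome
    rw [t9, t10, t11]
    refine ho.imp (And.imp id ?_) id
    rintro hN' x ⟨hx, hxk⟩
    rcases (Nat.lt_succ_iff_lt_or_eq.1 hxk) with hxk | rfl
    · exact hN' x ⟨hx, hxk⟩
    · exact hN hx
  intro Q skip choose
  refine (ok_of_wp ?_).mono (by decide) fun _ h => h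
  have hrep := h.graph.rep k hk
  have f0 := h.fixed.reg0
  have f3 := h.fixed.reg3
  by_cases hkA : k ∈ A
  swap
  · have hne : ρ k ≠ k := fun e => hkA ((h.graph.merged.mem_iff hk).2 e)
    simp only [findDominated, wp, block, Test.Holds]
    simp [h5, hrep, hne]
    exact skip _ (by simp) rfl rfl rfl fun hA => absurd hA hkA
  have he := h.graph.merged.fix k hkA
  obtain ⟨hr, hrow⟩ := h.fresh k hkA (by simp)
  by_cases hdeg : s.arr 3 k ≤ 3
  swap
  · have hdeg' : 3 < s.arr 3 k := by omega
    simp only [findDominated, wp, block, Test.Holds]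
    simp [h5, hrep, he, f3, hdeg']
    exact skip _ (by simp) (by simp) (by simp) (by simp) fun _ hc =>
      absurd (hr.card.trans_le hc) hdeg
  have hmat := h.graph.mat k hk
  have hle : ∀ b < I.n, k * I.n + b ≤ B := fun b hb => (idx_lt hk hb).le.trans hB
  have hle' : k * I.n ≤ B := by nlinarith
  have hB1 : 1 ≤ B := by omega
  have hs := hr.rowSum_eq hW hdeg
  obtain ⟨hp, hq, hr'⟩ := hr.lt
  have hM : ∀ v, rowSum I.n W k ≤ 2 * W k v → Mergeable I.n A W k v := fun v hv =>
    hW.mergeable_of_dominated hkA (hr.card ▸ hdeg) (hpos.trans_le hrow) hv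
  simp only [findDominated, wp, block, Test.Holds, loadRecord, readEntries, choosePair, Op.eval]
  simp [h5, hrep, he, f0, f3, hdeg, hmat, hle, hle', hp, hq, hr', hB1]
  -- Comparing one entry with the sum of the other two decides whether it is at least half of the
  -- row sum, using additions and comparisons only.
  refine ⟨fun h1 => ?_, fun h1 => ⟨fun h2 => ?_, fun h2 => ⟨fun h3 => ?_, fun h3 => ?_⟩⟩⟩
  · exact choose _ (s.arr 4 k) (by simp) (by simp) (by simp) (by simp) (hM _ (by linarith))
  · exact choose _ (s.arr 5 k) (by simp) (by simp) (by simp) (by simp) (hM _ (by linarith))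
  · exact choose _ (s.arr 6 k) (by simp) (by simp) (by simp) (by simp) (hM _ (by linarith))
  · refine skip _ (by simp) (by simp) (by simp) (by simp) fun _ _ c => ?_
    by_cases hc : 0 < W k c
    · rcases hr.eq_of_pos hW hdeg hc with rfl | rfl | rfl <;> linarith
    · linarith

/-- The vertex in register `5` has degree three, and its neighbours are in the registers `6`, `7`
and `8`. -/
structure AtCubic (I : Input) (A : Finset ℕ) (W : ℕ → ℕ → ℝ) (u p q r : ℕ) (s : State) : Prop where
  reg5 : s.reg 5 = u
  reg6 : s.reg 6 = p
  reg7 : s.reg 7 = q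
  reg8 : s.reg 8 = r
  mem : u ∈ A
  card : (nbrs I.n W u).card = 3
  iff : ∀ b, 0 < W u b ↔ b = p ∨ b = q ∨ b = r

/-- The registers `9`, `10`, `11` after a search. -/
def Found (P : ℕ → ℕ → Prop) (s : State) : Prop :=
  s.reg 11 ≠ 0 → s.reg 11 = 1 ∧ P (s.reg 9) (s.reg 10)

variable {u p q r : ℕ}

theorem AtCubic.of_keeps {s t : State} (h : AtCubic I A W u p q r s) (hk : Keeps 9 s t) :
    AtCubic I A W u p q r t :=
  ⟨(hk.reg 5 (by norm_num)).trans h.reg5, (hk.reg 6 (by norm_num)).trans h.reg6,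
    (hk.reg 7 (by norm_num)).trans h.reg7, (hk.reg 8 (by norm_num)).trans h.reg8,
    h.mem, h.card, h.iff⟩

/-- A common neighbour must be one of the three listed neighbours of `u`, so three entries of the
row of the other vertex decide. -/
theorem ok_tryAdjacent (hB : I.n * I.n ≤ B) {s : State} (h : Inv I ρ A W ∅ s)
    (hc : AtCubic I A W u p q r s) (hf : Found (IsBuddyPair I.n A W) s) {x : ℕ} (hx : x < 9)
    (hv : 0 < W u (s.reg x)) :
    Ok I B (tryAdjacent x) s 30 fun t => Keeps 9 s t ∧ Found (IsBuddyPair I.n A W) t ∧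
      (t.reg 11 = 0 → s.reg 11 = 0 ∧ ∀ z, 0 < W u z → 0 < W (s.reg x) z →
        (nbrs I.n W (s.reg x)).card ≠ 3) := by
  have hW := h.graph.merged.isWeight
  obtain ⟨v, hvx⟩ : ∃ v, s.reg x = v := ⟨_, rfl⟩
  rw [hvx] at hv ⊢
  suffices main : ∀ Q : State → Prop,
      (∀ t, Keeps 9 s t → t.reg 9 = s.reg 9 → t.reg 10 = s.reg 10 → t.reg 11 = s.reg 11 →
        (∀ z, 0 < W u z → 0 < W v z → (nbrs I.n W v).card ≠ 3) → Q t) →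
      (∀ t, Keeps 9 s t → t.reg 9 = u → t.reg 10 = v → t.reg 11 = 1 →
        IsBuddyPair I.n A W u v → Q t) → Ok I B (tryAdjacent x) s 30 Q by
    refine main _ (fun t ht t9 t10 t11 hN => ⟨ht, ?_, fun e => ⟨t11 ▸ e, hN⟩⟩)
      (fun t ht t9 t10 t11 hM => ⟨ht, fun _ => ⟨t11, by rwa [t9, t10]⟩, fun e => by simp [t11] at e⟩)
    unfold Found
    rw [t9, t10, t11]
    exact hf
  intro Q skip choose
  refine (ok_of_wp ?_).mono (by simp [cost, block, tryAdjacent, readEntries, choosePair])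
    fun _ h => h
  have hvA := hW.supp' hv
  have hvn := hW.lt v hvA
  have f0 := h.fixed.reg0
  have f3 := h.fixed.reg3
  have fz := h.fixed.zero
  obtain ⟨hr, -⟩ := h.fresh v hvA (by simp)
  by_cases hdeg : s.arr 3 v = 3
  swap
  · simp only [tryAdjacent, wp, block, Test.Holds]
    simp [hvx, f3, hdeg]
    exact skip _ (by simp) rfl rfl rfl fun _ _ _ e => hdeg (hr.card.trans e)
  have hmat := h.graph.mat v hvn
  have hle : ∀ b < I.n, v * I.n + b ≤ B := fun b hb => (idx_lt hvn hb).le.trans hB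
  have hle' : v * I.n ≤ B := by nlinarith
  have hB1 : 1 ≤ B := by nlinarith
  have up := (hc.iff p).2 (by simp)
  have uq := (hc.iff q).2 (by simp)
  have ur := (hc.iff r).2 (by simp)
  have hp := hW.lt p (hW.supp' up)
  have hq := hW.lt q (hW.supp' uq)
  have hr' := hW.lt r (hW.supp' ur)
  have hP : ∀ z, 0 < W u z → 0 < W v z → IsBuddyPair I.n A W u v := fun z h1 h2 =>
    ⟨hc.mem, hvA, hW.ne hv, hc.card, hr.card ▸ hdeg, Or.inl ⟨hv, z, h1, h2⟩⟩
  have x13 : x ≠ 13 := by omega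
  have x14 : x ≠ 14 := by omega
  have x9 : x ≠ 9 := by omega
  simp only [tryAdjacent, wp, block, Test.Holds, readEntries, choosePair, Op.eval]
  simp [hvx, f0, f3, fz, hdeg, hmat, hle, hle', hp, hq, hr', hB1, hc.reg5, hc.reg6, hc.reg7,
    hc.reg8, x13, x14, x9]
  refine ⟨fun h1 => ⟨fun h2 => ⟨fun h3 => ?_, fun h3 => ?_⟩, fun h2 => ?_⟩, fun h1 => ?_⟩
  · refine skip _ (by simp) (by simp) (by simp) (by simp) fun z hz hz' _ => ?_
    rcases (hc.iff z).1 hz with rfl | rfl | rfl <;> linarith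
  · exact choose _ (by simp) (by simp) (by simp) (by simp) (hP r ur h3)
  · exact choose _ (by simp) (by simp) (by simp) (by simp) (hP q uq h2)
  · exact choose _ (by simp) (by simp) (by simp) (by simp) (hP p up h1)

theorem ok_tryTwin (hB : I.n * I.n ≤ B) {s : State} (h : Inv I ρ A W ∅ s)
    (hc : AtCubic I A W u p q r s) (hf : Found (IsBuddyPair I.n A W) s) {v : ℕ}
    (hv : s.reg 15 = v) (hvA : v ∈ A) (ha : ∃ a, 0 < W u a ∧ (nbrs I.n W a).card = 3) :
    Ok I B tryTwin s 30 fun t => Keeps 9 s t ∧ Found (IsBuddyPair I.n A W) t ∧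
      (t.reg 11 = 0 → s.reg 11 = 0 ∧ (u ≠ v → (nbrs I.n W v).card = 3 →
        ¬ ∀ w, 0 < W u w ↔ 0 < W v w)) := by
  have hW := h.graph.merged.isWeight
  suffices main : ∀ Q : State → Prop,
      (∀ t, Keeps 9 s t → t.reg 9 = s.reg 9 → t.reg 10 = s.reg 10 → t.reg 11 = s.reg 11 →
        (u ≠ v → (nbrs I.n W v).card = 3 → ¬ ∀ w, 0 < W u w ↔ 0 < W v w) → Q t) →
      (∀ t, Keeps 9 s t → t.reg 9 = u → t.reg 10 = v → t.reg 11 = 1 →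
        IsBuddyPair I.n A W u v → Q t) → Ok I B tryTwin s 30 Q by
    refine main _ (fun t ht t9 t10 t11 hN => ⟨ht, ?_, fun e => ⟨t11 ▸ e, hN⟩⟩)
      (fun t ht t9 t10 t11 hM => ⟨ht, fun _ => ⟨t11, by rwa [t9, t10]⟩, fun e => by simp [t11] at e⟩)
    unfold Found
    rw [t9, t10, t11]
    exact hf
  intro Q skip choose
  refine (ok_of_wp ?_).mono (by decide) fun _ h => h
  have hvn := hW.lt v hvA
  have f0 := h.fixed.reg0
  have f3 := h.fixed.reg3
  have fz := h.fixed.zero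
  obtain ⟨hr, -⟩ := h.fresh v hvA (by simp)
  by_cases huv : u = v
  · simp only [tryTwin, wp, block, Test.Holds]
    simp [hv, hc.reg5, huv]
    exact skip _ (by simp) rfl rfl rfl fun hne => absurd huv hne
  have hvu : v ≠ u := fun e => huv e.symm
  by_cases hdeg : s.arr 3 v = 3
  swap
  · simp only [tryTwin, wp, block, Test.Holds]
    simp [hv, f3, hdeg, hc.reg5, hvu]
    exact skip _ (by simp) rfl rfl rfl fun _ e => absurd (hr.card.trans e) hdeg
  have hmat := h.graph.mat v hvn
  have hle : ∀ b < I.n, v * I.n + b ≤ B := fun b hb => (idx_lt hvn hb).le.trans hB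
  have hle' : v * I.n ≤ B := by nlinarith
  have hB1 : 1 ≤ B := by nlinarith
  have up := (hc.iff p).2 (by simp)
  have uq := (hc.iff q).2 (by simp)
  have ur := (hc.iff r).2 (by simp)
  have hp := hW.lt p (hW.supp' up)
  have hq := hW.lt q (hW.supp' uq)
  have hr' := hW.lt r (hW.supp' ur)
  have hno : ∀ w, 0 < W u w → W v w ≤ 0 → u ≠ v → (nbrs I.n W v).card = 3 →
      ¬ ∀ w, 0 < W u w ↔ 0 < W v w := fun w h1 h2 _ _ h3 => ((h3 w).1 h1).not_ge h2
  simp only [tryTwin, wp, block, Test.Holds, readEntries, choosePair, Op.eval]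
  simp [hv, f0, f3, fz, hdeg, hmat, hle, hle', hp, hq, hr', hB1, hc.reg5, hc.reg6, hc.reg7,
    hc.reg8, hvu]
  refine ⟨fun h1 => ?_, fun h1 => ⟨fun h2 => ?_, fun h2 => ⟨fun h3 => ?_, fun h3 => ?_⟩⟩⟩
  · exact skip _ (by simp) (by simp) (by simp) (by simp) (hno p up h1)
  · exact skip _ (by simp) (by simp) (by simp) (by simp) (hno q uq h2)
  · exact skip _ (by simp) (by simp) (by simp) (by simp) (hno r ur h3)
  · refine choose _ (by simp) (by simp) (by simp) (by simp)
      ⟨hc.mem, hvA, huv, hc.card, hr.card ▸ hdeg, Or.inr ⟨?_, ha⟩⟩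
    -- One inclusion suffices, because both neighbourhoods have three elements.
    have hsub : nbrs I.n W u ⊆ nbrs I.n W v := by
      intro w hw
      rw [hW.mem_nbrs] at hw ⊢
      rcases (hc.iff w).1 hw with rfl | rfl | rfl <;> assumption
    have heq := eq_of_subset_of_card_le hsub (by rw [hc.card, ← hr.card, hdeg])
    intro w
    rw [← hW.mem_nbrs, heq, hW.mem_nbrs]

end RAM

namespace RAM

variable {I : Input} {B : ℕ} {ρ : ℕ → ℕ} {A : Finset ℕ} {W : ℕ → ℕ → ℝ} {X : Set ℕ}
  {u p q r : ℕ}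

theorem ok_loadTwin (hB : I.n * I.n ≤ B) {s : State} (h : Inv I ρ A W ∅ s)
    (hc : AtCubic I A W u p q r s) (hf : Found (IsBuddyPair I.n A W) s) {x i v : ℕ}
    (hv : s.arr i (s.reg x) = v) (hvA : v ∈ A)
    (ha : ∃ a, 0 < W u a ∧ (nbrs I.n W a).card = 3) :
    Ok I B (.seq (.load 15 i x) tryTwin) s 31 fun t => Keeps 9 s t ∧
      Found (IsBuddyPair I.n A W) t ∧ (t.reg 11 = 0 → s.reg 11 = 0 ∧ (u ≠ v →
        (nbrs I.n W v).card = 3 → ¬ ∀ w, 0 < W u w ↔ 0 < W v w)) := by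
  refine Ok.seq (T := 1) (T' := 30) (R := fun t => t = s.setReg 15 v) (ok_of_wp ?_) ?_
  · simp [wp, hv]
  rintro t rfl
  have hk : Keeps 9 s (s.setReg 15 v) := by simp
  refine (ok_tryTwin hB (h.of_keeps (hk.mono (by norm_num))) (hc.of_keeps hk)
    (by simpa [Found] using hf) (by simp) hvA ha).mono le_rfl ?_
  rintro t ⟨h1, h2, h3⟩
  exact ⟨hk.trans h1, h2, by simpa using h3⟩

/-- A twin of `u` is also a neighbour of `a`, and for cubic `a` the record lists all candidates.
This is why a cubic common neighbour is demanded of twins. -/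
theorem ok_tryTwins (hB : I.n * I.n ≤ B) {s : State} (h : Inv I ρ A W ∅ s)
    (hc : AtCubic I A W u p q r s) (hf : Found (IsBuddyPair I.n A W) s) {x : ℕ} (hx : x < 9)
    (hv : 0 < W u (s.reg x)) :
    Ok I B (tryTwins x) s 100 fun t => Keeps 9 s t ∧ Found (IsBuddyPair I.n A W) t ∧
      (t.reg 11 = 0 → s.reg 11 = 0 ∧ ∀ v, u ≠ v → 0 < W (s.reg x) v →
        (nbrs I.n W (s.reg x)).card = 3 → (nbrs I.n W v).card = 3 →
          ¬ ∀ w, 0 < W u w ↔ 0 < W v w) := by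
  have hW := h.graph.merged.isWeight
  obtain ⟨a, hax⟩ : ∃ a, s.reg x = a := ⟨_, rfl⟩
  rw [hax] at hv ⊢
  have haA := hW.supp' hv
  obtain ⟨hr, -⟩ := h.fresh a haA (by simp)
  refine Ok.mono (T := 1 + (31 + (31 + 31) + 1)) ?_ (by norm_num) fun _ h => h
  refine Ok.seq (R := fun t => t = s.setReg 13 (s.arr 3 a)) (ok_of_wp ?_) ?_
  · simp [wp, hax]
  rintro s1 rfl
  have hk : Keeps 9 s (s.setReg 13 (s.arr 3 a)) := by simp
  have h1 := h.of_keeps (hk.mono (by norm_num))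
  have hc1 := hc.of_keeps hk
  have hf1 : Found (IsBuddyPair I.n A W) (s.setReg 13 (s.arr 3 a)) := by simpa [Found] using hf
  refine Ok.ite (fun ht => ?_) fun ht => ?_
  · have h3 : s.arr 3 a = 3 := by simpa [Test.Holds, h.fixed.reg3] using ht
    have ha : ∃ a, 0 < W u a ∧ (nbrs I.n W a).card = 3 := ⟨a, hv, hr.card ▸ h3⟩
    have hiff : ∀ b, 0 < W a b ↔ b = s.arr 4 a ∨ b = s.arr 5 a ∨ b = s.arr 6 a :=
      fun b => hr.pos_iff hW h3
    have m4 := hW.supp' ((hiff (s.arr 4 a)).2 (by simp))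
    have m5 := hW.supp' ((hiff (s.arr 5 a)).2 (by simp))
    have m6 := hW.supp' ((hiff (s.arr 6 a)).2 (by simp))
    have hx13 : x ≠ 13 := by omega
    have load : ∀ t, Keeps 9 s t → ∀ i, t.arr i (t.reg x) = s.arr i a := by
      intro t ht i
      rw [ht.arr, ht.reg x hx, hax]
    refine (ok_loadTwin hB h1 hc1 hf1 (load _ hk 4) m4 ha).seq (T' := 62) ?_
    rintro s2 ⟨k2, f2, n2⟩
    have k2' := hk.trans k2
    refine (ok_loadTwin hB (h.of_keeps (k2'.mono (by norm_num))) (hc.of_keeps k2') f2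
      (load _ k2' 5) m5 ha).seq (T' := 31) ?_
    rintro s3 ⟨k3, f3, n3⟩
    have k3' := k2'.trans k3
    refine (ok_loadTwin hB (h.of_keeps (k3'.mono (by norm_num))) (hc.of_keeps k3') f3
      (load _ k3' 6) m6 ha).mono le_rfl ?_
    rintro s4 ⟨k4, f4, n4⟩
    refine ⟨k3'.trans k4, f4, fun e => ?_⟩
    obtain ⟨e3, n4⟩ := n4 e
    obtain ⟨e2, n3⟩ := n3 e3
    obtain ⟨e1, n2⟩ := n2 e2
    refine ⟨by simpa using e1, fun v huv hav _ => ?_⟩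
    rcases (hiff v).1 hav with rfl | rfl | rfl
    exacts [n2 huv, n3 huv, n4 huv]
  · refine (ok_of_wp ?_).mono (show 1 ≤ _ by norm_num) fun _ h => h
    refine ⟨hk, hf1, fun e => ⟨by simpa using e, fun v _ _ h3 => absurd ?_ ht⟩⟩
    simp [Test.Holds, h.fixed.reg3, hr.card.trans h3]

/-- No vertex in `S` belongs to a pair of buddies. -/
def NoBuddies (n : ℕ) (A : Finset ℕ) (W : ℕ → ℕ → ℝ) (S : Set ℕ) : Prop :=
  ∀ x ∈ S, ∀ y, ¬ IsBuddyPair n A W x y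

theorem ok_findBuddy (hB : I.n * I.n ≤ B) {k : ℕ} (hk : k < I.n) {s : State}
    (h : Inv I ρ A W ∅ s) (h5 : s.reg 5 = k)
    (ho : Outcome (NoBuddies I.n A W {x | x < k}) (IsBuddyPair I.n A W) s) :
    Ok I B findBuddy s 500 fun s' => Keeps 6 s s' ∧
      Outcome (NoBuddies I.n A W {x | x < k + 1}) (IsBuddyPair I.n A W) s' := by
  have hW := h.graph.merged.isWeight
  have skip : ∀ t, Keeps 6 s t → Found (IsBuddyPair I.n A W) t →
      (t.reg 11 = 0 → s.reg 11 = 0 ∧ ∀ y, ¬ IsBuddyPair I.n A W k y) → Keeps 6 s t ∧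
      Outcome (NoBuddies I.n A W {x | x < k + 1}) (IsBuddyPair I.n A W) t := by
    intro t ht hf hN
    refine ⟨ht, ?_⟩
    by_cases h0 : t.reg 11 = 0
    · obtain ⟨h1, h2⟩ := hN h0
      rcases ho with ⟨-, h3⟩ | ⟨h3, -⟩
      · refine Or.inl ⟨h0, fun x hx => ?_⟩
        rcases Nat.lt_succ_iff_lt_or_eq.1 hx with hx | rfl
        exacts [h3 x hx, h2]
      · omega
    · exact Or.inr (hf h0)
  have hf : Found (IsBuddyPair I.n A W) s := by
    intro h0
    rcases ho with ⟨h1, -⟩ | h1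
    exacts [absurd h1 h0, h1]
  refine Ok.mono (T := 2 + (3 + (30 + (30 + (30 + (100 + (100 + 100))))) + 1 + 1)) ?_
    (by norm_num) fun _ h => h
  refine Ok.seq (R := fun t => t = (s.setReg 13 (ρ k)).setReg 14 (s.arr 3 k)) (ok_of_wp ?_) ?_
  · simp [wp, block, h5, h.graph.rep k hk]
  rintro s1 rfl
  have k1 : Keeps 9 s ((s.setReg 13 (ρ k)).setReg 14 (s.arr 3 k)) := by simp
  have f1 : Found (IsBuddyPair I.n A W) ((s.setReg 13 (ρ k)).setReg 14 (s.arr 3 k)) := by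
    simpa [Found] using hf
  refine Ok.ite (fun ht => ?_) fun ht => ?_
  swap
  · refine (ok_of_wp ?_).mono (show 1 ≤ _ by norm_num) fun _ h => h
    refine skip _ (k1.mono (by norm_num)) f1 fun e => ⟨by simpa using e, fun y hy => ht ?_⟩
    simp [Test.Holds, h5, h.graph.merged.fix k hy.left]
  have hkA : k ∈ A := by
    refine (h.graph.merged.mem_iff hk).2 ?_
    simpa [Test.Holds, h5] using ht
  obtain ⟨hr, -⟩ := h.fresh k hkA (by simp)
  refine Ok.ite (fun ht => ?_) fun ht => ?_
  swap
  · refine (ok_of_wp ?_).mono (show 1 ≤ _ by norm_num) fun _ h => h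
    refine skip _ (k1.mono (by norm_num)) f1 fun e => ⟨by simpa using e, fun y hy => ht ?_⟩
    simp [Test.Holds, h.fixed.reg3, hr.card.trans hy.card_left]
  have h3 : s.arr 3 k = 3 := by simpa [Test.Holds, h.fixed.reg3] using ht
  have hiff : ∀ b, 0 < W k b ↔ b = s.arr 4 k ∨ b = s.arr 5 k ∨ b = s.arr 6 k :=
    fun b => hr.pos_iff hW h3
  refine Ok.seq (R := fun t => Keeps 6 s t ∧ Found (IsBuddyPair I.n A W) t ∧
    t.reg 11 = s.reg 11 ∧ AtCubic I A W k (s.arr 4 k) (s.arr 5 k) (s.arr 6 k) t) (ok_of_wp ?_) ?_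
  · simp only [wp, block, loadRecord]
    refine ⟨by simp, by simpa [Found] using hf, by simp, ⟨by simp [h5], by simp [h5], by simp [h5],
      by simp [h5], hkA, hr.card ▸ h3, hiff⟩⟩
  rintro s2 ⟨k2, f2, e2, c2⟩
  have h2 := h.of_keeps (k2.mono (by norm_num))
  have w6 : ∀ t, Keeps 9 s2 t → t.reg 6 = s.arr 4 k :=
    fun t ht => (ht.reg 6 (by norm_num)).trans c2.reg6
  have w7 : ∀ t, Keeps 9 s2 t → t.reg 7 = s.arr 5 k :=
    fun t ht => (ht.reg 7 (by norm_num)).trans c2.reg7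
  have w8 : ∀ t, Keeps 9 s2 t → t.reg 8 = s.arr 6 k :=
    fun t ht => (ht.reg 8 (by norm_num)).trans c2.reg8
  have p4 : 0 < W k (s.arr 4 k) := (hiff _).2 (by simp)
  have p5 : 0 < W k (s.arr 5 k) := (hiff _).2 (by simp)
  have p6 : 0 < W k (s.arr 6 k) := (hiff _).2 (by simp)
  have inv : ∀ t, Keeps 9 s2 t → Inv I ρ A W ∅ t := fun t ht => h2.of_keeps (ht.mono (by norm_num))
  have l2 := Keeps.refl 9 s2
  refine (ok_tryAdjacent hB (inv _ l2) (c2.of_keeps l2) f2 (x := 6) (by norm_num)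
    (by rwa [w6 _ l2])).seq (T' := 360) ?_
  rintro s3 ⟨k3, f3, n3⟩
  have l3 := l2.trans k3
  refine (ok_tryAdjacent hB (inv _ l3) (c2.of_keeps l3) f3 (x := 7) (by norm_num)
    (by rwa [w7 _ l3])).seq (T' := 330) ?_
  rintro s4 ⟨k4, f4, n4⟩
  have l4 := l3.trans k4
  refine (ok_tryAdjacent hB (inv _ l4) (c2.of_keeps l4) f4 (x := 8) (by norm_num)
    (by rwa [w8 _ l4])).seq (T' := 300) ?_
  rintro s5 ⟨k5, f5, n5⟩
  have l5 := l4.trans k5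
  refine (ok_tryTwins hB (inv _ l5) (c2.of_keeps l5) f5 (x := 6) (by norm_num)
    (by rwa [w6 _ l5])).seq (T' := 200) ?_
  rintro s6 ⟨k6, f6, n6⟩
  have l6 := l5.trans k6
  refine (ok_tryTwins hB (inv _ l6) (c2.of_keeps l6) f6 (x := 7) (by norm_num)
    (by rwa [w7 _ l6])).seq (T' := 100) ?_
  rintro s7 ⟨k7, f7, n7⟩
  have l7 := l6.trans k7
  refine (ok_tryTwins hB (inv _ l7) (c2.of_keeps l7) f7 (x := 8) (by norm_num)
    (by rwa [w8 _ l7])).mono le_rfl ?_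
  rintro s8 ⟨k8, f8, n8⟩
  have l8 := l7.trans k8
  refine skip _ (k2.trans (l8.mono (by norm_num))) f8 fun e8 => ?_
  obtain ⟨e7, n8⟩ := n8 e8
  obtain ⟨e6, n7⟩ := n7 e7
  obtain ⟨e5, n6⟩ := n6 e6
  obtain ⟨e4, n5⟩ := n5 e5
  obtain ⟨e3, n4⟩ := n4 e4
  obtain ⟨e9, n3⟩ := n3 e3
  rw [w6 _ l2] at n3
  rw [w7 _ l3] at n4
  rw [w8 _ l4] at n5
  rw [w6 _ l5] at n6
  rw [w7 _ l6] at n7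
  rw [w8 _ l7] at n8
  -- A partner of `k` is a listed neighbour, excluded by the first three tests, or a twin, excluded
  -- by the tests at the cubic common neighbour.
  refine ⟨e2.symm.trans e9, fun y hy => ?_⟩
  rcases hy.or with ⟨h1, z, hz, hz'⟩ | ⟨hw, a, ha, ha3⟩
  · rcases (hiff y).1 h1 with rfl | rfl | rfl
    exacts [n3 z hz hz' hy.card_right, n4 z hz hz' hy.card_right, n5 z hz hz' hy.card_right]
  · have hay : 0 < W a y := hW.symm y a ▸ (hw a).1 ha
    rcases (hiff a).1 ha with rfl | rfl | rfl
    exacts [n6 y hy.ne hay ha3 hy.card_right hw, n7 y hy.ne hay ha3 hy.card_right hw,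
      n8 y hy.ne hay ha3 hy.card_right hw]

end RAM

/-! ### One round of merging, and the main loop -/

namespace RAM

variable {I : Input} {B : ℕ} {ρ : ℕ → ℕ} {A : Finset ℕ} {W : ℕ → ℕ → ℝ} {X : Set ℕ}
  {u v : ℕ}

theorem ok_refreshReg (hB : I.n * I.n ≤ B) {r x : ℕ} (hx : x < I.n) {s : State}
    (h : Inv I ρ A W X s) (hrx : s.reg r = x) :
    Ok I B (.seq (.copy 12 r) refresh) s (I.n * 40 + 41) fun s' =>
      Inv I ρ A W (X \ {x}) s' ∧ ∀ r < 12, s'.reg r = s.reg r := by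
  refine Ok.mono (T := 1 + (I.n * 40 + 40)) ?_ (by omega) fun _ h => h
  refine Ok.seq (R := fun t => t = s.setReg 12 x) (ok_of_wp ?_) ?_
  · simp [wp, hrx]
  rintro t rfl
  refine (ok_refresh hB hx (h.of_keeps (by simp)) (by simp)).mono le_rfl ?_
  rintro t ⟨h1, h2⟩
  refine ⟨h1, fun r hr => ?_⟩
  rw [h2 r (by omega), State.setReg_reg, if_neg (by omega)]

theorem ok_refreshAll (hB : I.n * I.n ≤ B) {a b c d : ℕ} {s : State}
    (h : Inv I ρ A W {a, b, c, d} s) (ha : a < I.n) (hb : b < I.n) (hc : c < I.n) (hd : d < I.n)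
    (h10 : s.reg 10 = a) (h6 : s.reg 6 = b) (h7 : s.reg 7 = c) (h8 : s.reg 8 = d) :
    Ok I B refreshAll s (I.n * 160 + 164) (Inv I ρ A W ∅) := by
  refine Ok.mono (T := (I.n * 40 + 41) + ((I.n * 40 + 41) + ((I.n * 40 + 41) + (I.n * 40 + 41))))
    ?_ (by omega) fun _ h => h
  refine (ok_refreshReg hB ha h h10).seq ?_
  rintro s1 ⟨i1, r1⟩
  refine (ok_refreshReg hB hb i1 ((r1 6 (by norm_num)).trans h6)).seq ?_
  rintro s2 ⟨i2, r2⟩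
  have r2 : ∀ r < 12, s2.reg r = s.reg r := fun r hr => (r2 r hr).trans (r1 r hr)
  refine (ok_refreshReg hB hc i2 ((r2 7 (by norm_num)).trans h7)).seq ?_
  rintro s3 ⟨i3, r3⟩
  have r3 : ∀ r < 12, s3.reg r = s.reg r := fun r hr => (r3 r hr).trans (r2 r hr)
  refine (ok_refreshReg hB hd i3 ((r3 8 (by norm_num)).trans h8)).mono le_rfl ?_
  rintro s4 ⟨i4, -⟩
  refine i4.weaken fun x _ hx => ?_
  simp only [Set.mem_sdiff, Set.mem_insert_iff, Set.mem_singleton_iff] at hx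
  tauto

/-- Since `u` has at most three neighbours, its old record lists all of them; together with `v` they
are the only vertices to be refreshed. -/
theorem Inv.merge {s t : State} (h : Inv I ρ A W ∅ s) (hA : 2 < A.card)
    (hm : Mergeable I.n A W u v) (ht : Merging I.n ρ W u v I.n s t) :
    Inv I (fun i => foldMap u v (ρ i)) (A.erase u) (mergeW W u v)
      {v, s.arr 4 u, s.arr 5 u, s.arr 6 u} (t.setReg 4 (A.card - 1)) := by
  have hW := h.graph.merged.isWeight
  have hcard : (A.erase u).card = A.card - 1 := card_erase_of_mem hm.left
  have hw := ht.wreg 1 (by norm_num)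
  have ha : ∀ j, t.arr 0 j = s.arr 0 j := fun j => ht.arr 0 j (by norm_num)
  refine ⟨⟨?_, ?_, ?_, ?_, ?_, ?_⟩, by omega, ⟨h.graph.merged.merge hm, ?_, ?_⟩, ⟨?_, ?_, ?_⟩, ?_⟩
  · simpa using (ht.reg 0 (by norm_num)).trans h.fixed.reg0
  · simpa using (ht.reg 1 (by norm_num)).trans h.fixed.reg1
  · simpa using (ht.reg 2 (by norm_num)).trans h.fixed.reg2
  · simpa using (ht.reg 3 (by norm_num)).trans h.fixed.reg3
  · simp [hcard]
  · exact (ht.wreg 0 (by norm_num)).trans h.fixed.zero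
  · intro a ha b hb
    exact (ht.mat a ha b hb).trans (hW.mergeUpTo_eq hm.ne ha hb)
  · intro i hi
    exact (ht.rep i hi).trans (if_pos hi)
  · rw [State.setReg_wreg, hw]
    exact h.graph.merged.dominates_merge hm (fun x hx => (h.fresh x hx (by simp)).row) h.best.dom
  · simpa [ha] using h.best.splits
  · simpa [ha, hw] using h.best.cut
  · intro x hx hxX
    obtain ⟨hxu, hxA⟩ := mem_erase.1 hx
    simp only [Set.mem_insert_iff, Set.mem_singleton_iff, not_or] at hxX
    have hrec := (h.fresh u hm.left (by simp)).record
    have hnu : ¬ 0 < W u x := fun hp => by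
      have := hrec.eq_of_pos hW (hrec.card.trans_le hm.card) hp
      tauto
    obtain ⟨h1, h2⟩ := h.fresh x hxA (by simp)
    refine ⟨?_, ?_⟩
    · rw [hW.nbrs_mergeW hxu hxX.1 hnu, State.setReg_arr, ht.arr 3 x (by norm_num),
        ht.arr 4 x (by norm_num), ht.arr 5 x (by norm_num), ht.arr 6 x (by norm_num)]
      exact h1
    · rw [hW.rowSum_mergeW hm.left hm.right hm.ne hxu hxX.1, State.setReg_wreg, hw]
      exact h2

/-- The output is a minimum cut. -/
structure Solved (I : Input) (s : State) : Prop where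
  splits : Splits (range I.n) {i | s.arr 0 i = 1}
  le : ∀ U, Splits (range I.n) U →
    cutM I.n I.weightAt {i | s.arr 0 i = 1} ≤ cutM I.n I.weightAt U

theorem ok_findPair (hB : I.n * I.n ≤ B) {s : State} (h : Inv I ρ A W ∅ s)
    (hpos : 0 < s.wreg 1) (h11 : s.reg 11 = 0) :
    Ok I B findPair s (I.n * 554 + 5) fun s' => Keeps 5 s s' ∧ Mergeable I.n A W (s'.reg 9) (s'.reg 10) := by
  have hW := h.graph.merged.isWeight
  have hnB : I.n ≤ B := le_trans (by nlinarith) hB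
  have hA := h.two_le
  refine Ok.mono (T := (I.n * (50 + 2) + 2) + ((I.n * (500 + 2) + 2) + 1)) ?_ (by omega)
    fun _ h => h
  refine (ok_forUp (n := I.n) (T := 50) (fun k t => Keeps 5 s t ∧
    Outcome (NoneDominated I.n W {x | x ∈ A ∧ x < k}) (Mergeable I.n A W) t) hnB
    ?_ ?_ ?_ ?_).seq ?_
  · exact fun k t ht => ⟨(ht.1.reg 0 (by norm_num)).trans h.fixed.reg0,
      (ht.1.reg 1 (by norm_num)).trans h.fixed.reg1⟩
  · intro k t x ht
    simpa [Outcome] using ht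
  · rintro k hk t ⟨ht, ho⟩ h5
    refine (ok_findDominated hB hk (h.of_keeps ht) h5
      (by rwa [ht.wreg 1 (by norm_num)]) ho).mono le_rfl ?_
    rintro t' ⟨h1, h2⟩
    exact ⟨⟨ht.trans (h1.mono (by norm_num)), h2⟩, (h1.reg 5 (by norm_num)).trans h5⟩
  · exact ⟨Keeps.refl _ _, Or.inl ⟨h11, fun x hx => absurd hx.2 (Nat.not_lt_zero x)⟩⟩
  rintro s1 ⟨k1, o1⟩
  have i1 := h.of_keeps k1
  refine Ok.ite (fun ht => ?_) fun ht => ?_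
  · refine (ok_of_wp ?_).mono (show 1 ≤ _ by omega) fun _ h => h
    refine ⟨k1, ?_⟩
    rcases o1 with ⟨h0, -⟩ | ⟨-, hm⟩
    · simp [Test.Holds, h0, i1.fixed.reg1] at ht
    · exact hm
  obtain ⟨h0, hnd⟩ : s1.reg 11 = 0 ∧ NoneDominated I.n W {x | x ∈ A ∧ x < I.n} := by
    rcases o1 with h0 | ⟨h1, -⟩
    · exact h0
    · simp [Test.Holds, h1, i1.fixed.reg1] at ht
  have hnd : ∀ x ∈ A, (nbrs I.n W x).card ≤ 3 → ∀ c, 2 * W x c < rowSum I.n W x :=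
    fun x hx => hnd x ⟨hx, hW.lt x hx⟩
  refine (ok_forUp (n := I.n) (T := 500) (fun k t => Keeps 5 s t ∧
    Outcome (NoBuddies I.n A W {x | x < k}) (IsBuddyPair I.n A W) t) hnB
    ?_ ?_ ?_ ?_).mono le_rfl ?_
  · exact fun k t ht => ⟨(ht.1.reg 0 (by norm_num)).trans h.fixed.reg0,
      (ht.1.reg 1 (by norm_num)).trans h.fixed.reg1⟩
  · intro k t x ht
    simpa [Outcome] using ht
  · rintro k hk t ⟨ht, ho⟩ h5
    refine (ok_findBuddy hB hk (h.of_keeps ht) h5 ho).mono le_rfl ?_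
    rintro t' ⟨h1, h2⟩
    exact ⟨⟨ht.trans (h1.mono (by norm_num)), h2⟩, (h1.reg 5 (by norm_num)).trans h5⟩
  · exact ⟨k1, Or.inl ⟨h0, fun x hx => absurd hx (Nat.not_lt_zero x)⟩⟩
  rintro s2 ⟨k2, o2⟩
  refine ⟨k2, ?_⟩
  -- The search cannot fail: all row sums are positive and no vertex of small degree is dominated,
  -- so the structure theory provides a pair.
  rcases o2 with ⟨-, hno⟩ | ⟨-, hb⟩
  · obtain ⟨x, y, hxy⟩ := hW.exists_buddyPair h.graph.merged.minor hA
      (fun x hx => hpos.trans_le (h.fresh x hx (by simp)).row) hnd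
    exact absurd hxy (hno x (hW.lt x hxy.left) y)
  · exact hW.mergeable_of_buddyPair hb fun x hx hc c => (hnd x hx hc c).le

theorem ok_reduceStep (hB : I.n * I.n ≤ B) {s : State} (h : Inv I ρ A W ∅ s) (hA : 2 < A.card) :
    Ok I B reduceStep s (I.n * 800 + 300) fun s' =>
      (s'.reg 2 = 2 ∧ s'.reg 4 = 2 ∧ Solved I s') ∨
      ∃ ρ' A' W', Inv I ρ' A' W' ∅ s' ∧ A'.card + 1 = A.card := by
  have hn3 : A.card ≤ I.n := by
    have : A ⊆ range I.n := fun x hx => mem_range.2 (h.graph.merged.isWeight.lt x hx)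
    simpa using card_le_card this
  have hnB : I.n ≤ B := le_trans (by nlinarith) hB
  refine Ok.mono (T := (1 + ((I.n * 554 + 5) + (3 + ((I.n * 20 + 20) + (1 + (I.n * 160 + 164))))))
    + 1) ?_ (by omega) fun _ h => h
  refine Ok.ite (fun ht => ?_) fun ht => ?_
  -- A cut of weight zero is optimal. Setting the vertex counter to `2` ends the main loop.
  · refine (ok_of_wp ?_).mono (show 1 ≤ _ by omega) fun _ h => h
    have hle : s.wreg 1 ≤ 0 := by simpa [Test.Holds, h.fixed.zero] using ht
    refine Or.inl ⟨by simp [h.fixed.reg2], by simp [h.fixed.reg2], h.best.splits, fun U hU => ?_⟩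
    exact h.best.cut.trans_le (h.graph.merged.le_cutM_of_nonpos hle h.best.dom hU)
  have hpos : 0 < s.wreg 1 := by simpa [Test.Holds, h.fixed.zero] using ht
  refine Ok.seq (R := fun t => t = s.setReg 11 0) (ok_of_wp ?_) ?_
  · simp [wp]
  rintro s1 rfl
  have k1 : Keeps 5 s (s.setReg 11 0) := by simp
  have h1 := h.of_keeps k1
  refine (ok_findPair hB h1 (by simpa using hpos) (by simp)).seq
    (T' := 3 + ((I.n * 20 + 20) + (1 + (I.n * 160 + 164)))) ?_
  rintro s2 ⟨k2, hm⟩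
  have h2 := h1.of_keeps k2
  obtain ⟨u, hu⟩ : ∃ u, s2.reg 9 = u := ⟨_, rfl⟩
  obtain ⟨v, hv⟩ : ∃ v, s2.reg 10 = v := ⟨_, rfl⟩
  rw [hu, hv] at hm
  have hrec := (h.fresh u hm.left (by simp)).record
  have hs2 : s2.arr = s.arr := k2.arr
  refine Ok.seq (R := fun t => Keeps 5 s2 t ∧ t.reg 9 = u ∧ t.reg 10 = v ∧ t.reg 6 = s.arr 4 u ∧
    t.reg 7 = s.arr 5 u ∧ t.reg 8 = s.arr 6 u) (T := 3)
    (T' := (I.n * 20 + 20) + (1 + (I.n * 160 + 164))) ((ok_of_wp ?_).mono (by decide) fun _ h => h)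
    ?_
  · simp [wp, block, loadRecord, hu, hv, hs2]
  rintro s3 ⟨k3, r9, r10, r6, r7, r8⟩
  have h3 := h2.of_keeps k3
  have hs3 : s3.arr = s.arr := k3.arr.trans hs2
  refine (ok_mergePair hB h3 hm.left hm.right hm.ne r9 r10).seq
    (T' := 1 + (I.n * 160 + 164)) ?_
  intro s4 h4
  have hi := h3.merge hA hm h4
  rw [hs3] at hi
  refine Ok.seq (R := fun t => t = s4.setReg 4 (A.card - 1)) (T := 1) (T' := I.n * 160 + 164)
    (ok_of_wp ?_) ?_
  · have e4 : s4.reg 4 = A.card := (h4.reg 4 (by norm_num)).trans h3.fixed.reg4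
    have e1 : s4.reg 1 = 1 := (h4.reg 1 (by norm_num)).trans h3.fixed.reg1
    simp [wp, Op.eval, e4, e1]
    omega
  rintro s5 rfl
  refine (ok_refreshAll hB hi (h.graph.merged.isWeight.lt v hm.right) hrec.lt.1 hrec.lt.2.1
    hrec.lt.2.2 ?_ ?_ ?_ ?_).mono le_rfl fun t ht => Or.inr ⟨_, _, _, ht, ?_⟩
  · simpa using (h4.reg 10 (by norm_num)).trans r10
  · simpa using (h4.reg 6 (by norm_num)).trans r6
  · simpa using (h4.reg 7 (by norm_num)).trans r7
  · simpa using (h4.reg 8 (by norm_num)).trans r8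
  · rw [card_erase_of_mem hm.left]
    omega

theorem ok_loop (hB : I.n * I.n ≤ B) {s : State} (h : Inv I ρ A W ∅ s) :
    Ok I B (.loop (.lt 2 4) reduceStep) s (A.card * (I.n * 800 + 301) + 1) (Solved I) := by
  obtain ⟨m, hm⟩ : ∃ m, A.card = m := ⟨_, rfl⟩
  induction m generalizing s ρ A W with
  | zero =>
    have := h.two_le
    omega
  | succ m ih =>
    by_cases hA : A.card = 2
    · refine ⟨s, 1, .loop_false ?_, by omega, h.best.splits, fun U hU => ?_⟩
      · simp [Test.Holds, h.fixed.reg2, h.fixed.reg4, hA]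
      · exact h.best.cut.trans_le (h.graph.merged.le_cutM_of_card hA.le
          (fun x hx => (h.fresh x hx (by simp)).row) h.best.dom hU)
    · have hA2 : 2 < A.card := lt_of_le_of_ne h.two_le (Ne.symm hA)
      have ht : (Test.lt 2 4).Holds I s := by
        simpa [Test.Holds, h.fixed.reg2, h.fixed.reg4] using hA2
      obtain ⟨s1, t1, r1, b1, h1⟩ := ok_reduceStep hB h hA2
      have e : A.card * (I.n * 800 + 301) = m * (I.n * 800 + 301) + (I.n * 800 + 301) := by
        rw [hm]
        ring
      rcases h1 with ⟨e2, e4, h1⟩ | ⟨ρ', A', W', h1, hc⟩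
      · exact ⟨s1, _, .loop_true ht r1 (.loop_false (by simp [Test.Holds, e2, e4])), by omega, h1⟩
      · obtain ⟨s2, t2, r2, b2, h2⟩ := ih h1 (by omega)
        have e' : A'.card = m := by omega
        rw [e'] at b2
        exact ⟨s2, _, .loop_true ht r1 r2, by omega, h2⟩

/-! ### Initialization and the final bound -/

/-- The memory while the matrix is copied: the rows before `k` and the first `j` entries of row `k`
are done. -/
structure Filled (I : Input) (i k j : ℕ) (s : State) : Prop where
  fixed : Fixed I.n I.n s
  out : ∀ a, s.arr 0 a = 0
  rep : ∀ a < i, s.arr 1 a = a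
  mat : ∀ a < I.n, ∀ b < I.n, a < k ∨ (a = k ∧ b < j) → s.warr 0 (a * I.n + b) = I.weightAt a b

theorem Fixed.setReg {n m x y : ℕ} {s : State} (h : Fixed n m s) (hx : 5 ≤ x) :
    Fixed n m (s.setReg x y) :=
  ⟨by rw [State.setReg_reg, if_neg (by omega), h.reg0],
    by rw [State.setReg_reg, if_neg (by omega), h.reg1],
    by rw [State.setReg_reg, if_neg (by omega), h.reg2],
    by rw [State.setReg_reg, if_neg (by omega), h.reg3],
    by rw [State.setReg_reg, if_neg (by omega), h.reg4], h.zero⟩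

theorem Filled.setReg {i k j x y : ℕ} {s : State} (h : Filled I i k j s) (hx : 5 ≤ x) :
    Filled I i k j (s.setReg x y) :=
  ⟨h.fixed.setReg hx, h.out, h.rep, h.mat⟩

theorem ok_prepare (hB : I.n * I.n ≤ B) (hn : 2 ≤ I.n)
    (hM : IsMerged I.n I.weightAt id (range I.n) I.weightAt) :
    Ok I B prepare (State.init I.n) (I.n * I.n * 100 + I.n * 100 + 100)
      (Inv I id (range I.n) I.weightAt ∅) := by
  have hnB : I.n ≤ B := le_trans (by nlinarith) hB
  have hB4 : 4 ≤ B := le_trans (by nlinarith) hB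
  refine Ok.mono (T := 4 + ((I.n * (2 + (I.n * (3 + 2) + 2) + 2) + 2) + ((1 + (I.n * 20 + 20)) +
    (3 + (I.n * (I.n * 40 + 41 + 2) + 2))))) ?_ (by ring_nf; omega) fun _ h => h
  refine Ok.seq (R := Filled I 0 0 0) ((ok_of_wp ?_).mono (by decide) fun _ h => h) ?_
  · simp only [wp, block]
    refine ⟨by omega, by omega, by omega, ⟨?_, ?_, ?_, ?_, ?_, ?_⟩, ?_, ?_, ?_⟩ <;>
      simp [State.init]
  intro s1 h1
  refine (ok_forUp (n := I.n) (T := 2 + (I.n * (3 + 2) + 2)) (fun k t => Filled I k k 0 t)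
    hnB (fun k t ht => ⟨ht.fixed.reg0, ht.fixed.reg1⟩)
    (fun k t x ht => ht.setReg (by norm_num)) ?_ h1).seq
    (T' := (1 + (I.n * 20 + 20)) + (3 + (I.n * (I.n * 40 + 41 + 2) + 2))) ?_
  · intro k hk t ht h5
    refine Ok.seq (R := fun t => Filled I (k + 1) k 0 t ∧ t.reg 5 = k ∧ t.reg 14 = k * I.n)
      (T := 2) (T' := I.n * (3 + 2) + 2) ((ok_of_wp ?_).mono (by decide) fun _ h => h) ?_
    · have hle : k * I.n ≤ B := by nlinarith
      have f0 := ht.fixed.reg0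
      simp only [wp, block, Op.eval]
      simp only [State.setArr_reg, h5, f0]
      refine ⟨hle, ⟨Fixed.setReg ⟨f0, ht.fixed.reg1, ht.fixed.reg2, ht.fixed.reg3, ht.fixed.reg4,
        ht.fixed.zero⟩ (by norm_num), fun a => ?_, fun a ha => ?_, ht.mat⟩, ?_, ?_⟩
      · simpa using ht.out a
      · by_cases hak : a = k
        · simp [hak]
        · simpa [hak] using ht.rep a (by omega)
      · simp [h5]
      · simp
    rintro t1 ⟨h1, r5, r14⟩
    refine (ok_forUp (n := I.n) (T := 3) (fun j t => Filled I (k + 1) k j t ∧ t.reg 5 = k ∧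
      t.reg 14 = k * I.n) hnB (fun k t ht => ⟨ht.1.fixed.reg0, ht.1.fixed.reg1⟩)
      ?_ ?_ ⟨h1, r5, r14⟩).mono le_rfl ?_
    · rintro j t x ⟨ht, h5, h14⟩
      exact ⟨ht.setReg (by norm_num), by simpa using h5, by simpa using h14⟩
    · rintro j hj t ⟨ht, h5, h14⟩ h13
      refine (ok_of_wp ?_).mono (by decide) fun _ h => h
      have hle : k * I.n + j ≤ B := (idx_lt hk hj).le.trans hB
      simp only [wp, block, Op.eval]
      refine ⟨by simpa [h13, h14] using hle, ⟨⟨⟨?_, ?_, ?_, ?_, ?_, ?_⟩, ht.out, ht.rep, ?_⟩,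
        ?_, ?_⟩, ?_⟩
      · simpa using ht.fixed.reg0
      · simpa using ht.fixed.reg1
      · simpa using ht.fixed.reg2
      · simpa using ht.fixed.reg3
      · simpa using ht.fixed.reg4
      · simpa using ht.fixed.zero
      · intro a ha b hb hab
        simp [h13, h14, h5, idx_inj hb hj]
        split_ifs with he
        · rw [he.1, he.2]
        · exact ht.mat a ha b hb (by omega)
      · simpa using h5
      · simpa using h14
      · simpa using h13
    · rintro t2 ⟨h2, h5, -⟩
      exact ⟨⟨h2.fixed, h2.out, h2.rep, fun a ha b hb hab => h2.mat a ha b hb (by omega)⟩, h5⟩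
  intro s2 h2
  have hmat : ∀ a < I.n, ∀ b < I.n, s2.warr 0 (a * I.n + b) = I.weightAt a b :=
    fun a ha b hb => h2.mat a ha b hb (Or.inl ha)
  refine Ok.seq (R := fun t => Keeps 5 s2 t ∧ t.wreg 2 = rowSum I.n I.weightAt 0)
    (T := 1 + (I.n * 20 + 20)) (T' := 3 + (I.n * (I.n * 40 + 41 + 2) + 2)) ?_ ?_
  · refine Ok.seq (R := fun t => t = s2.setReg 12 0) (ok_of_wp (by simp [wp])) ?_
    rintro t rfl
    have ht := h2.setReg (x := 12) (y := 0) (by norm_num)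
    refine (ok_scanRow hB (x := 0) (by omega) ht.fixed.reg0 ht.fixed.reg1 (by simp) ht.fixed.zero
      (hmat 0 (by omega))).mono le_rfl ?_
    rintro t ⟨k1, h3, -⟩
    exact ⟨(show Keeps 5 s2 _ by simp).trans (k1.mono (by norm_num)), h3⟩
  rintro s3 ⟨k3, hd⟩
  have h0 : (0 : ℕ) ∈ range I.n := mem_range.2 (by omega)
  have hcard : 2 ≤ (range I.n).card := by simpa using hn
  -- All vertices are stale at first; the last loop reduces the stale ones to those from `k` on.
  refine Ok.seq (R := Inv I id (range I.n) I.weightAt {x | 0 ≤ x}) (T := 3)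
    (T' := I.n * (I.n * 40 + 41 + 2) + 2) ((ok_of_wp ?_).mono (by decide) fun _ h => h) ?_
  · simp only [wp, block]
    have f0 := (k3.reg 0 (by norm_num)).trans h2.fixed.reg0
    have f1 := (k3.reg 1 (by norm_num)).trans h2.fixed.reg1
    have f2 := (k3.reg 2 (by norm_num)).trans h2.fixed.reg2
    have f3 := (k3.reg 3 (by norm_num)).trans h2.fixed.reg3
    have f4 := (k3.reg 4 (by norm_num)).trans h2.fixed.reg4
    have fz := (k3.wreg 0 (by norm_num)).trans h2.fixed.zero
    have fo : ∀ a, s3.arr 0 a = 0 := fun a => by rw [k3.arr, h2.out]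
    have hout : ∀ a, (if a = 0 then s3.reg 1 else s3.arr 0 a) = 1 ↔ a = 0 := by
      intro a
      by_cases ha : a = 0 <;> simp [ha, f1, fo]
    refine ⟨by omega, ⟨?_, ?_, ?_, ?_, ?_, ?_⟩, hcard, ⟨hM, ?_, ?_⟩, ⟨?_, ?_, ?_⟩, ?_⟩
    · simpa using f0
    · simpa using f1
    · simpa using f2
    · simpa using f3
    · simpa using f4
    · simpa using fz
    · intro a ha b hb
      simpa [k3.warr] using hmat a ha b hb
    · intro i hi
      simpa [k3.arr] using h2.rep i hi
    -- Nothing has been merged yet, so no cut has been lost.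
    · exact fun c _ hc => hc
    · refine splits_congr (fun i hi => ?_) (hM.splits_class hcard h0)
      simpa using (hout i).symm
    · refine Eq.trans (cutM_congr fun i hi => ?_) ((hM.cutM_class h0).trans ?_)
      · simpa using hout i
      · simp [hd]
    · exact fun x _ hx => absurd (Nat.zero_le x) hx
  intro s4 h4
  refine (ok_forUp (n := I.n) (T := I.n * 40 + 41)
    (fun k t => Inv I id (range I.n) I.weightAt {x | k ≤ x} t) hnB
    (fun k t ht => ⟨ht.fixed.reg0, ht.fixed.reg1⟩)
    (fun k t x ht => ht.of_keeps (by simp)) ?_ h4).mono le_rfl ?_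
  · intro k hk t ht h5
    refine (ok_refreshReg hB hk ht h5).mono le_rfl ?_
    rintro t' ⟨h1, h2⟩
    refine ⟨h1.weaken fun x _ hx => ?_, (h2 5 (by norm_num)).trans h5⟩
    have h1 : k ≤ x := hx.1
    have h2 : x ≠ k := hx.2
    exact (show k + 1 ≤ x by omega)
  · intro t ht
    exact ht.weaken fun x hx hx' => absurd (mem_range.1 hx) (not_lt.2 hx')

end RAM

/-- There is one program that, on words of `O(log n)` bits, solves MIN CUT in `O(n ^ 2)` steps for
all positively weighted graphs with `n ≥ 2` vertices that have no minor `K₅` minus an edge. -/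
theorem corollary2p6 :
    ∃ (p : RAM.Program) (C k : ℕ), ∀ (n : ℕ), 2 ≤ n → ∀ (G : SimpleGraph (Fin n)),
      ¬ IsGraphMinor K5DeleteEdge G →
      ∀ (w : Sym2 (Fin n) → ℝ), (∀ e ∈ G.edgeSet, 0 < w e) →
        SolvesMinCut p G w (n ^ k) (C * n ^ 2) := by
  -- The exponent `2` accommodates the matrix addresses. The two phases take at most `900 * n ^ 2 +
  -- 401 * n + 101` steps, so `2000` is generous.
  refine ⟨RAM.minCutProgram, 2000, 2, fun n hn G hG w hw => ?_⟩
  have hI := RAM.Input.isWeight_weightAt ⟨n, G, w⟩ hw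
  have hM := IsMerged.init hI fun h => hG (h.trans (RAM.Input.weightGraph_minor ⟨n, G, w⟩ hw))
  have hB : n * n ≤ n ^ 2 := (sq n).ge
  obtain ⟨s, t, hr, ht, hs⟩ := (RAM.ok_prepare (I := ⟨n, G, w⟩) hB hn hM).seq
    fun s hs => RAM.ok_loop hB hs
  refine ⟨s, t, hr, ht.trans ?_, RAM.Input.isMinCut_of_le ⟨n, G, w⟩ hs.splits hs.le⟩
  simp only [card_range]
  nlinarith
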